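/- Let $1\le p,q<\infty$, $\lambda>-1$, $\Pi=\{z=x+iy: y>0\}$, $\mathbb R_+=(0,\infty)$, $d\nu_\lambda(y)=(\lambda+1)(2y)^\lambda\,dy$ on $\mathbb R_+$ and $d\mu_\lambda(x+iy)=\frac1\pi(\lambda+1)(2y)^\lambda\,dx\,dy$ on $\Pi$. Let $\mathcal A^{q,p}_\lambda(\Pi)$ be the space of holomorphic functions $f$ on $\Pi$ which are distributions tempered in $x$ and whose distributional Fourier transform in the first variable, $\hat f(\xi,y)$ (the extension of $\frac1{\sqrt{2\pi}}\int_{\mathbb R}e^{-i\xi x}f(x+iy)\,dx$), belongs to $L^q(\mathbb R;L^p(\mathbb R_+,\nu_\lambda))$, with the norm $\|f\|=\big\|\tfrac1{\sqrt\pi}\hat f\big\|_{L^q(\mathbb R;L^p(\mathbb R_+,\nu_\lambda))}$. Let $$B^{(\lambda)}_\Pi g(z)=\int_\Pi g(w)K_\lambda(z,w)\,d\mu_\lambda(w),\qquad K_\lambda(z,w)=-\,i^\lambda (z-\overline w)^{-(2+\lambda)},$$ be the weighted Bergman projection (principal branches of the powers). Let $a:\mathbb R_+\to\mathbb C$ be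 such that $a(y)e^{-\varepsilon y}\in L^1(\mathbb R_+)$ for every $\varepsilon>0$ and, if $-1<\lambda<0$, such that moreover $a(y)y^\lambda$ is integrable in a neighbourhood of zero. The Toeplitz operator $T_a^{(\lambda)}f=B^{(\lambda)}_\Pi(af)$, where $(af)(w)=a(\operatorname{Im}w)f(w)$, acts in $\mathcal A^{q,p}_\lambda(\Pi)$ with domain the set of all $f\in\mathcal A^{q,p}_\lambda(\Pi)$ for which the integral $B^{(\lambda)}_\Pi(af)(z)$ converges absolutely for every $z\in\Pi$ and $B^{(\lambda)}_\Pi(af)\in\mathcal A^{q,p}_\lambda(\Pi)$. Put $$\gamma_{a,\lambda}(x)=\frac{x^{\lambda+1}}{\Gamma(\lambda+1)}\int_0^\infty a(t/p)\,e^{-tx}\,t^\lambda\,dt,\qquad x\in\mathbb R_+ .$$ Then $T_a^{(\lambda)}$ is densely defined, and it is bounded (that is, $\|T_a^{(\lambda)}f\|\le C\|f\|$ for some constant $C$ and all $f$ in its domain) if and only if the function $\gamma_{a,\lambda}$ is bounded on $\mathbb R_+$. In that case $T_a^{(\lambda)}$ extends to a bounded linear operator on $\mathcal A^{q,p}_\lambda(\Pi)$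 (uniquely, as its domain is dense), and the spectrum of this operator is the closure in $\mathbb C$ of the range of $\gamma_{a,\lambda}$: $$\operatorname{spec}T_a^{(\lambda)}=\overline{\{\gamma_{a,\lambda}(x):x\in\mathbb R_+\}} .$$ -/

import Mathlib

open MeasureTheory Set
open scoped ENNReal ContDiff SchwartzMap UpperHalfPlane ComplexConjugate

noncomputable section

namespace ToeplitzHalfPlane

/-- The density `(λ + 1) (2 y) ^ λ`. -/
def dens (lam y : ℝ) : ℝ := (lam + 1) * (2 * y) ^ lam

/-- The measure `dν_λ(y) = (λ + 1) (2 y) ^ λ dy` on `(0, ∞)`. -/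
def nu (lam : ℝ) : Measure ℝ :=
  (volume.restrict (Ioi 0)).withDensity fun y => ENNReal.ofReal (dens lam y)

/-- The Banach space `L^p(ℝ₊, ν_λ)`. -/
abbrev VertLp (lam : ℝ) (p : ℝ≥0∞) : Type := Lp ℂ p (nu lam)

/-- The mixed norm space `L^q(ℝ; L^p(ℝ₊, ν_λ))` (a Bochner space). -/
abbrev MixedLp (lam : ℝ) (p q : ℝ≥0∞) [Fact (1 ≤ p)] : Type :=
  Lp (VertLp lam p) q (volume : Measure ℝ)

/-- Complex-valued test functions on `ℝ₊ = (0, ∞)`. -/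
structure IsTest (v : ℝ → ℂ) : Prop where
  smooth : ContDiff ℝ ∞ v
  compact : HasCompactSupport v
  supp : tsupport v ⊆ Ioi 0

/-- The point `x + i y` of the upper half-plane (used for `y > 0`). -/
def pt (x y : ℝ) : ℍ := UpperHalfPlane.ofComplex ((x : ℂ) + (y : ℂ) * Complex.I)

/-- The unitary Fourier transform `(2π)^{-1/2} ∫ e^{-i u x} g(x) dx`. -/
def fourierR (g : ℝ → ℂ) (u : ℝ) : ℂ :=
  ((Real.sqrt (2 * Real.pi) : ℝ) : ℂ)⁻¹ *
    ∫ x : ℝ, Complex.exp (-(Complex.I * (u : ℂ) * (x : ℂ))) * g x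

/-- `φ ∈ L^q(ℝ; L^p(ℝ₊, ν_λ))` is the distributional Fourier transform `f̂(ξ, y)` of `f(x + i y)`
in the first variable: `⟨f̂, u ⊗ v⟩ = ⟨f, û ⊗ v⟩` for all Schwartz functions `u` on `ℝ` and all
test functions `v` on `ℝ₊` (these products are total in the space of test functions that are
rapidly decreasing in `x` and compactly supported in `y`). The pairing with a function on the
half-plane is integration against `dx dy`. The integrability is automatic for a holomorphic `f`
that is a distribution tempered in `x`, by the mean value property. -/
def IsPartialFourier {lam : ℝ} {p q : ℝ≥0∞} [Fact (1 ≤ p)]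
    (f : ℍ → ℂ) (φ : MixedLp lam p q) : Prop :=
  ∀ (u : 𝓢(ℝ, ℂ)) (v : ℝ → ℂ), IsTest v →
    Integrable (fun w : ℝ × ℝ => f (pt w.1 w.2) * (fourierR u w.1 * v w.2))
      ((volume : Measure ℝ).prod (volume.restrict (Ioi 0))) ∧
    ∫ w : ℝ × ℝ, f (pt w.1 w.2) * (fourierR u w.1 * v w.2)
      ∂((volume : Measure ℝ).prod (volume.restrict (Ioi 0))) =
    ∫ ξ : ℝ, (∫ y in Ioi (0 : ℝ), (φ ξ : ℝ → ℂ) y * v y) * u ξ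

/-- Holomorphic functions on the upper half-plane. -/
def IsHol (f : ℍ → ℂ) : Prop :=
  DifferentiableOn ℂ (fun z : ℂ => f (UpperHalfPlane.ofComplex z)) {z : ℂ | 0 < z.im}

section Aux

variable {lam : ℝ} {p q : ℝ≥0∞}

theorem dens_pos (hl : -1 < lam) {y : ℝ} (hy : 0 < y) : 0 < dens lam y :=
  mul_pos (by linarith) (Real.rpow_pos_of_pos (by linarith) _)

theorem continuousOn_dens : ContinuousOn (dens lam) (Ioi 0) := by
  unfold dens
  refine continuousOn_const.mul (ContinuousOn.rpow_const (by fun_prop) ?_)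
  intro y hy
  left
  have : (0 : ℝ) < y := hy
  positivity

theorem measurable_dens : Measurable (dens lam) := by
  unfold dens
  fun_prop

theorem nu_compact_lt_top {K : Set ℝ} (hK : IsCompact K) (hK0 : K ⊆ Ioi 0) :
    nu lam K < ⊤ := by
  have h1 : IntegrableOn (dens lam) K volume :=
    (continuousOn_dens.mono hK0).integrableOn_compact hK
  rw [nu, withDensity_apply _ hK.measurableSet, Measure.restrict_restrict hK.measurableSet,
    inter_eq_left.2 hK0]
  exact h1.lintegral_lt_top

theorem IsTest.memLp {v : ℝ → ℂ} (hv : IsTest v) (hl : -1 < lam) (r : ℝ≥0∞) :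
    MemLp (fun y => v y / (dens lam y : ℂ)) r (nu lam) := by
  have hc : ContinuousOn (fun y => v y / (dens lam y : ℂ)) (tsupport v) := by
    refine hv.smooth.continuous.continuousOn.div
      (Complex.continuous_ofReal.comp_continuousOn (continuousOn_dens.mono hv.supp)) ?_
    intro y hy
    exact Complex.ofReal_ne_zero.2 (dens_pos hl (hv.supp hy)).ne'
  obtain ⟨C, hC⟩ := hv.compact.isCompact.exists_bound_of_continuousOn hc
  have hfin : IsFiniteMeasure ((nu lam).restrict (tsupport v)) :=
    ⟨by simpa using nu_compact_lt_top hv.compact.isCompact hv.supp⟩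
  have hm : Measurable (fun y => v y / (dens lam y : ℂ)) :=
    hv.smooth.continuous.measurable.div (Complex.measurable_ofReal.comp measurable_dens)
  have h1 : MemLp (fun y => v y / (dens lam y : ℂ)) r ((nu lam).restrict (tsupport v)) :=
    MemLp.of_bound hm.aestronglyMeasurable C
      ((ae_restrict_iff' hv.compact.isCompact.measurableSet).2 (ae_of_all _ hC))
  have h2 := (memLp_indicator_iff_restrict hv.compact.isCompact.measurableSet).2 h1
  have h3 : (tsupport v).indicator (fun y => v y / (dens lam y : ℂ)) =
      fun y => v y / (dens lam y : ℂ) := by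
    ext y
    by_cases hy : y ∈ tsupport v
    · simp [hy]
    · simp [hy, image_eq_zero_of_notMem_tsupport hy]
  rwa [h3] at h2

theorem integral_nu_test (hl : -1 < lam) (g v : ℝ → ℂ) :
    ∫ y, g y * (v y / (dens lam y : ℂ)) ∂(nu lam) = ∫ y in Ioi (0 : ℝ), g y * v y := by
  rw [nu, integral_withDensity_eq_integral_toReal_smul₀
    (measurable_dens.ennreal_ofReal.aemeasurable) (ae_of_all _ fun _ => ENNReal.ofReal_lt_top)]
  refine setIntegral_congr_fun measurableSet_Ioi ?_
  intro y hy
  have h := dens_pos hl (show (0 : ℝ) < y from hy)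
  have h' : (dens lam y : ℂ) ≠ 0 := Complex.ofReal_ne_zero.2 h.ne'
  simp only [ENNReal.toReal_ofReal h.le, Complex.real_smul]
  field_simp

/-- Testing an element of `L^p(ν_λ)` against a test function, with respect to `dy`, is a
continuous functional. -/
theorem exists_pairing [Fact (1 ≤ p)] (hl : -1 < lam) {v : ℝ → ℂ} (hv : IsTest v) :
    ∃ ℓ : VertLp lam p →L[ℂ] ℂ, ∀ g : VertLp lam p,
      ℓ g = ∫ y in Ioi (0 : ℝ), (g : ℝ → ℂ) y * v y := by
  have hpq : p.HolderConjugate (ENNReal.conjExponent p) :=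
    ENNReal.HolderConjugate.conjExponent Fact.out
  have : Fact (1 ≤ ENNReal.conjExponent p) := ⟨hpq.symm.one_le⟩
  have hm := hv.memLp (lam := lam) hl (ENNReal.conjExponent p)
  refine ⟨((ContinuousLinearMap.mul ℂ ℂ).lpPairing (nu lam) p
    (ENNReal.conjExponent p)).flip hm.toLp, fun g => ?_⟩
  rw [ContinuousLinearMap.flip_apply, ContinuousLinearMap.lpPairing_eq_integral,
    ← integral_nu_test hl]
  refine integral_congr_ae ?_
  filter_upwards [hm.coeFn_toLp] with y hy
  simp [hy]

theorem integrable_pairing [Fact (1 ≤ p)] [Fact (1 ≤ q)] (hl : -1 < lam) {v : ℝ → ℂ}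
    (hv : IsTest v) (φ : MixedLp lam p q) (u : 𝓢(ℝ, ℂ)) :
    Integrable fun ξ : ℝ => (∫ y in Ioi (0 : ℝ), (φ ξ : ℝ → ℂ) y * v y) * u ξ := by
  obtain ⟨ℓ, hℓ⟩ := exists_pairing (p := p) hl hv
  have hpq : q.HolderConjugate (ENNReal.conjExponent q) :=
    ENNReal.HolderConjugate.conjExponent Fact.out
  have h1 : MemLp (fun ξ : ℝ => ℓ (φ ξ)) q volume := ℓ.comp_memLp' (Lp.memLp φ)
  have h2 : MemLp u (ENNReal.conjExponent q) volume := u.memLp _ _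
  have h3 := h1.integrable_mul h2
  refine h3.congr (ae_of_all _ fun ξ => ?_)
  simp [hℓ]

theorem IsPartialFourier.add [Fact (1 ≤ p)] [Fact (1 ≤ q)] (hl : -1 < lam) {f g : ℍ → ℂ}
    {φ ψ : MixedLp lam p q} (hf : IsPartialFourier f φ) (hg : IsPartialFourier g ψ) :
    IsPartialFourier (f + g) (φ + ψ) := by
  intro u v hv
  obtain ⟨hf1, hf2⟩ := hf u v hv
  obtain ⟨hg1, hg2⟩ := hg u v hv
  have e : (fun w : ℝ × ℝ => (f + g) (pt w.1 w.2) * (fourierR u w.1 * v w.2)) =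
      fun w => f (pt w.1 w.2) * (fourierR u w.1 * v w.2) +
        g (pt w.1 w.2) * (fourierR u w.1 * v w.2) := by
    ext w
    simp [add_mul]
  rw [e]
  refine ⟨hf1.add hg1, ?_⟩
  rw [integral_add hf1 hg1, hf2, hg2,
    ← integral_add (integrable_pairing hl hv φ u) (integrable_pairing hl hv ψ u)]
  obtain ⟨ℓ, hℓ⟩ := exists_pairing (p := p) hl hv
  refine integral_congr_ae ?_
  filter_upwards [Lp.coeFn_add φ ψ] with ξ hξ
  simp only [← hℓ, hξ, Pi.add_apply, map_add, add_mul]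

theorem IsPartialFourier.smul [Fact (1 ≤ p)] [Fact (1 ≤ q)] (hl : -1 < lam) {f : ℍ → ℂ}
    {φ : MixedLp lam p q} (c : ℂ) (hf : IsPartialFourier f φ) :
    IsPartialFourier (c • f) (c • φ) := by
  intro u v hv
  obtain ⟨hf1, hf2⟩ := hf u v hv
  have e : (fun w : ℝ × ℝ => (c • f) (pt w.1 w.2) * (fourierR u w.1 * v w.2)) =
      fun w => c * (f (pt w.1 w.2) * (fourierR u w.1 * v w.2)) := by
    ext w
    simp [mul_assoc]
  rw [e]
  refine ⟨hf1.const_mul c, ?_⟩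
  rw [integral_const_mul, hf2, ← integral_const_mul]
  obtain ⟨ℓ, hℓ⟩ := exists_pairing (p := p) hl hv
  refine integral_congr_ae ?_
  filter_upwards [Lp.coeFn_smul c φ] with ξ hξ
  simp only [← hℓ, hξ, Pi.smul_apply, map_smul, smul_eq_mul, mul_assoc]

theorem isPartialFourier_zero [Fact (1 ≤ p)] [Fact (1 ≤ q)] (hl : -1 < lam) :
    IsPartialFourier (0 : ℍ → ℂ) (0 : MixedLp lam p q) := by
  intro u v hv
  obtain ⟨ℓ, hℓ⟩ := exists_pairing (p := p) (lam := lam) hl hv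
  refine ⟨by simp, ?_⟩
  simp only [Pi.zero_apply, zero_mul, integral_zero]
  symm
  refine integral_eq_zero_of_ae ?_
  filter_upwards [Lp.coeFn_zero (VertLp lam p) q (volume : Measure ℝ)] with ξ hξ
  rw [← hℓ, hξ]
  simp

theorem ofReal_isTest {g : ℝ → ℝ} (h1 : ContDiff ℝ ∞ g) (h2 : HasCompactSupport g)
    (h3 : tsupport g ⊆ Ioi 0) : IsTest fun y => (g y : ℂ) := by
  refine ⟨Complex.ofRealCLM.contDiff.comp h1, h2.comp_left Complex.ofReal_zero, ?_⟩
  refine (closure_mono ?_).trans h3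
  intro y hy
  simpa using hy

/-- The Fourier transform in the first variable is unique. -/
theorem IsPartialFourier.eq_zero [Fact (1 ≤ p)] [Fact (1 ≤ q)] (hl : -1 < lam)
    {φ : MixedLp lam p q} (h : IsPartialFourier 0 φ) : φ = 0 := by
  have hloc : LocallyIntegrable (φ : ℝ → VertLp lam p) volume :=
    (Lp.memLp φ).locallyIntegrable Fact.out
  have key := ae_eq_zero_of_integral_contDiff_smul_eq_zero hloc (fun g hg hgc => ?_)
  · rw [Lp.eq_zero_iff_ae_eq_zero]
    exact key
  have hint : Integrable (fun ξ => g ξ • φ ξ) volume :=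
    hloc.integrable_smul_left_of_hasCompactSupport hg.continuous hgc
  set J : VertLp lam p := ∫ ξ, g ξ • φ ξ with hJ
  have hJv : ∀ v : ℝ → ℂ, IsTest v → ∫ y in Ioi (0 : ℝ), (J : ℝ → ℂ) y * v y = 0 := by
    intro v hv
    obtain ⟨ℓ, hℓ⟩ := exists_pairing (p := p) (lam := lam) hl hv
    rw [← hℓ, hJ, ← ContinuousLinearMap.integral_comp_comm _ hint]
    have hgC : HasCompactSupport fun ξ => (g ξ : ℂ) := hgc.comp_left Complex.ofReal_zero
    have hgS : ContDiff ℝ ∞ fun ξ => (g ξ : ℂ) := Complex.ofRealCLM.contDiff.comp hg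
    obtain ⟨G, hG⟩ : ∃ G : 𝓢(ℝ, ℂ), ∀ ξ, G ξ = (g ξ : ℂ) :=
      ⟨hgC.toSchwartzMap hgS, fun _ => rfl⟩
    have := (h G v hv).2
    simp only [Pi.zero_apply, zero_mul, integral_zero] at this
    rw [this]
    refine integral_congr_ae (ae_of_all _ fun ξ => ?_)
    have e : g ξ • φ ξ = (g ξ : ℂ) • φ ξ := (Complex.coe_smul _ _).symm
    simp only [← hℓ, hG]
    rw [e, map_smul, smul_eq_mul, mul_comm]
  have hac : nu lam ≪ volume.restrict (Ioi 0) := withDensity_absolutelyContinuous _ _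
  have hac' : volume.restrict (Ioi 0) ≪ nu lam := by
    refine withDensity_absolutelyContinuous' measurable_dens.ennreal_ofReal.aemeasurable ?_
    refine (ae_restrict_iff' measurableSet_Ioi).2 (ae_of_all _ fun y hy => ?_)
    simpa using dens_pos hl hy
  have hJloc : LocallyIntegrableOn (J : ℝ → ℂ) (Ioi 0) volume := by
    rw [locallyIntegrableOn_iff isOpen_Ioi.isLocallyClosed]
    intro K hK0 hK
    have hfin : IsFiniteMeasure ((nu lam).restrict K) :=
      ⟨by simpa using nu_compact_lt_top hK hK0⟩
    have h1 : Integrable (J : ℝ → ℂ) ((nu lam).restrict K) :=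
      ((Lp.memLp J).restrict K).integrable Fact.out
    generalize (J : ℝ → ℂ) = Jf at h1 ⊢
    rw [nu, restrict_withDensity hK.measurableSet, Measure.restrict_restrict hK.measurableSet,
      inter_eq_left.2 hK0, integrable_withDensity_iff_integrable_smul'
        measurable_dens.ennreal_ofReal (ae_of_all _ fun _ => ENNReal.ofReal_lt_top)] at h1
    have h2 : IntegrableOn (fun y => (dens lam y)⁻¹ •
        ((ENNReal.ofReal (dens lam y)).toReal • Jf y)) K volume := by
      refine IntegrableOn.continuousOn_smul h1 ?_ hK
      exact (continuousOn_dens.mono hK0).inv₀ fun y hy => (dens_pos hl (hK0 hy)).ne'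
    refine h2.congr_fun (fun y hy => ?_) hK.measurableSet
    have h3 := dens_pos hl (hK0 hy)
    simp only [ENNReal.toReal_ofReal h3.le, smul_smul, inv_mul_cancel₀ h3.ne', one_smul]
  have hJ0 : ∀ᵐ y, y ∈ Ioi (0 : ℝ) → (J : ℝ → ℂ) y = 0 := by
    refine isOpen_Ioi.ae_eq_zero_of_integral_contDiff_smul_eq_zero hJloc fun k hk hkc hks => ?_
    have h1 := hJv _ (ofReal_isTest hk hkc hks)
    rw [setIntegral_eq_integral_of_forall_compl_eq_zero] at h1
    · rw [← h1]
      refine integral_congr_ae (ae_of_all _ fun y => ?_)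
      simp [mul_comm]
    · intro y hy
      have : k y = 0 := image_eq_zero_of_notMem_tsupport fun h' => hy (hks h')
      simp [this]
  rw [Lp.eq_zero_iff_ae_eq_zero]
  exact hac.ae_le ((ae_restrict_iff' measurableSet_Ioi).2 hJ0)

theorem exists_fourierR_eq (w : 𝓢(ℝ, ℂ)) : ∃ u : 𝓢(ℝ, ℂ), ∀ x, fourierR u x = w x := by
  have hpi : (2 * Real.pi) ≠ 0 := by positivity
  let e : ℝ ≃L[ℝ] ℝ := ContinuousLinearEquiv.unitsEquivAut ℝ (Units.mk0 _ hpi)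
  let W : 𝓢(ℝ, ℂ) := ((Real.sqrt (2 * Real.pi) : ℝ) : ℂ) •
    SchwartzMap.compCLMOfContinuousLinearEquiv ℂ e w
  have hW : ∀ s, W s = ((Real.sqrt (2 * Real.pi) : ℝ) : ℂ) * w (s * (2 * Real.pi)) :=
    fun s => rfl
  refine ⟨FourierTransform.fourierInv W, fun x => ?_⟩
  have h1 : FourierTransform.fourier (FourierTransform.fourierInv W) = W :=
    FourierTransform.fourier_fourierInv_eq W
  have h2 := congrArg (fun g : 𝓢(ℝ, ℂ) => g (x / (2 * Real.pi))) h1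
  simp only [SchwartzMap.fourier_coe, hW, Real.fourier_real_eq_integral_exp_smul] at h2
  rw [div_mul_cancel₀ _ hpi] at h2
  have hs : ((Real.sqrt (2 * Real.pi) : ℝ) : ℂ) ≠ 0 :=
    Complex.ofReal_ne_zero.2 (Real.sqrt_ne_zero'.2 (by positivity))
  rw [fourierR, inv_mul_eq_iff_eq_mul₀ hs, ← h2]
  refine integral_congr_ae (ae_of_all _ fun t => ?_)
  simp only [smul_eq_mul]
  congr 2
  push_cast
  have : (Real.pi : ℂ) ≠ 0 := Complex.ofReal_ne_zero.2 Real.pi_ne_zero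
  field_simp

theorem continuousOn_pt {f : ℍ → ℂ} (hf : IsHol f) :
    ContinuousOn (fun w : ℝ × ℝ => f (pt w.1 w.2)) {w | 0 < w.2} := by
  refine ContinuousOn.comp (g := fun z : ℂ => f (UpperHalfPlane.ofComplex z))
    (f := fun w : ℝ × ℝ => (w.1 : ℂ) + (w.2 : ℂ) * Complex.I) hf.continuousOn (by fun_prop) ?_
  intro w hw
  simpa using hw

/-- A holomorphic function whose Fourier transform in the first variable vanishes is zero. -/
theorem IsPartialFourier.eq_zero_of_zero [Fact (1 ≤ p)] [Fact (1 ≤ q)] (hl : -1 < lam)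
    {f : ℍ → ℂ} (hf : IsHol f) (h : IsPartialFourier f (0 : MixedLp lam p q)) : f = 0 := by
  by_contra hne
  obtain ⟨z, hz⟩ := Function.ne_iff.1 hne
  simp only [Pi.zero_apply] at hz
  set P : ℝ × ℝ := (z.re, z.im) with hP
  have hPz : f (pt P.1 P.2) = f z := by
    congr 1
    rw [pt, hP]
    have : ((z.re : ℝ) : ℂ) + ((z.im : ℝ) : ℂ) * Complex.I = (z : ℂ) := Complex.re_add_im _
    simp only [this, UpperHalfPlane.ofComplex_apply]
  have hopen : IsOpen {w : ℝ × ℝ | 0 < w.2} := isOpen_lt continuous_const continuous_snd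
  have hPm : P ∈ {w : ℝ × ℝ | 0 < w.2} := z.im_pos
  have hcont : ContinuousAt (fun w : ℝ × ℝ => ((f z)⁻¹ * f (pt w.1 w.2)).re) P :=
    Complex.continuous_re.continuousAt.comp
      (continuousAt_const.mul ((continuousOn_pt hf).continuousAt (hopen.mem_nhds hPm)))
  have hval : ((f z)⁻¹ * f (pt P.1 P.2)).re = 1 := by
    rw [hPz, inv_mul_cancel₀ hz, Complex.one_re]
  have hev : ∀ᶠ w in nhds P, (1 / 2 : ℝ) < ((f z)⁻¹ * f (pt w.1 w.2)).re ∧ 0 < w.2 := by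
    refine Filter.Eventually.and (hcont.eventually_const_lt ?_) (hopen.mem_nhds hPm)
    simp only [hval]
    norm_num
  obtain ⟨δ, hδ, hball⟩ := Metric.eventually_nhds_iff_ball.1 hev
  let bx : ContDiffBump z.re := ⟨δ / 4, δ / 2, by positivity, by linarith⟩
  let yb : ContDiffBump z.im := ⟨δ / 4, δ / 2, by positivity, by linarith⟩
  have hmem : ∀ x y : ℝ, x ∈ Metric.closedBall z.re (δ / 2) →
      y ∈ Metric.closedBall z.im (δ / 2) → (x, y) ∈ Metric.ball P δ := by
    intro x y hx hy
    rw [Metric.mem_ball, Prod.dist_eq]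
    exact max_lt (lt_of_le_of_lt hx (by linarith)) (lt_of_le_of_lt hy (by linarith))
  have hyt : IsTest fun y => (yb y : ℂ) := by
    refine ofReal_isTest yb.contDiff yb.hasCompactSupport ?_
    rw [yb.tsupport_eq]
    intro y hy
    exact (hball _ (hmem z.re y (Metric.mem_closedBall_self (by positivity)) hy)).2
  have hbC : HasCompactSupport fun x => (bx x : ℂ) :=
    bx.hasCompactSupport.comp_left Complex.ofReal_zero
  have hbS : ContDiff ℝ ∞ fun x => (bx x : ℂ) := Complex.ofRealCLM.contDiff.comp bx.contDiff
  obtain ⟨u, hu⟩ := exists_fourierR_eq (hbC.toSchwartzMap hbS)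
  have hu' : ∀ x, fourierR u x = (bx x : ℂ) := hu
  obtain ⟨h1, h2⟩ := h u _ hyt
  obtain ⟨ℓ, hℓ⟩ := exists_pairing (p := p) (lam := lam) hl hyt
  have h3 : ∫ ξ : ℝ, (∫ y in Ioi (0 : ℝ), ((0 : MixedLp lam p q) ξ : ℝ → ℂ) y * (yb y : ℂ)) * u ξ
      = 0 := by
    refine integral_eq_zero_of_ae ?_
    filter_upwards [Lp.coeFn_zero (VertLp lam p) q (volume : Measure ℝ)] with ξ hξ
    rw [← hℓ, hξ]
    simp
  rw [h3] at h2
  set m : Measure (ℝ × ℝ) := (volume : Measure ℝ).prod (volume.restrict (Ioi 0)) with hm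
  simp only [hu'] at h1 h2
  have h4 := h1.const_mul (f z)⁻¹
  have h5 : ∫ w : ℝ × ℝ, ((f z)⁻¹ * (f (pt w.1 w.2) * ((bx w.1 : ℂ) * (yb w.2 : ℂ)))).re ∂m
      = 0 := by
    have := integral_re h4
    simp only [RCLike.re_eq_complex_re] at this
    rw [this, integral_const_mul, h2]
    simp
  have hb1 : Integrable (fun x : ℝ => bx x) volume := bx.integrable
  have hb2 : Integrable (fun y : ℝ => yb y) (volume.restrict (Ioi 0)) := yb.integrable.restrict
  have h6 : Integrable (fun w : ℝ × ℝ => bx w.1 * yb w.2) m := hb1.mul_prod hb2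
  have h7 : ∫ w : ℝ × ℝ, (1 / 2) * (bx w.1 * yb w.2) ∂m ≤ 0 := by
    rw [← h5]
    refine integral_mono (h6.const_mul _) h4.re fun w => ?_
    have e : ((f z)⁻¹ * (f (pt w.1 w.2) * ((bx w.1 : ℂ) * (yb w.2 : ℂ)))).re =
        ((f z)⁻¹ * f (pt w.1 w.2)).re * (bx w.1 * yb w.2) := by
      rw [← Complex.re_mul_ofReal]
      push_cast
      ring_nf
    simp only [e]
    by_cases hx : w.1 ∈ Metric.closedBall z.re (δ / 2)
    · by_cases hy : w.2 ∈ Metric.closedBall z.im (δ / 2)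
      · exact mul_le_mul_of_nonneg_right (hball _ (hmem _ _ hx hy)).1.le
          (mul_nonneg bx.nonneg yb.nonneg)
      · have : yb w.2 = 0 := yb.zero_of_le_dist (not_le.1 hy).le
        simp [this]
    · have : bx w.1 = 0 := bx.zero_of_le_dist (not_le.1 hx).le
      simp [this]
  have h8 : ∫ y in Ioi (0 : ℝ), yb y = ∫ y, yb y := by
    refine setIntegral_eq_integral_of_forall_compl_eq_zero fun y hy => ?_
    refine yb.zero_of_le_dist (le_of_not_ge fun h' => hy ?_)
    exact (hball _ (hmem z.re y (Metric.mem_closedBall_self (by positivity)) h')).2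
  rw [integral_const_mul, integral_prod_mul (fun x => bx x) (fun y => yb y), h8] at h7
  have := mul_pos (bx.integral_pos (μ := volume)) (yb.integral_pos (μ := volume))
  linarith

end Aux
/-- The mixed Fourier norm space of analytic functions
`A^{q,p}_λ(Π) = Hol(Π) ∩ 𝓛^{q,p}_λ(Π)`, as a space of functions on the upper half-plane. -/
def bergmanSubmodule (lam : ℝ) (p q : ℝ≥0∞) [Fact (-1 < lam)] [Fact (1 ≤ p)] [Fact (1 ≤ q)] :
    Submodule ℂ (ℍ → ℂ) where
  carrier := {f | IsHol f ∧ ∃ φ : MixedLp lam p q, IsPartialFourier f φ}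
  add_mem' := by
    rintro f g ⟨hf, φ, hφ⟩ ⟨hg, ψ, hψ⟩
    exact ⟨DifferentiableOn.add hf hg, φ + ψ, hφ.add Fact.out hψ⟩
  zero_mem' := ⟨differentiableOn_const 0, 0, isPartialFourier_zero Fact.out⟩
  smul_mem' := by
    rintro c f ⟨hf, φ, hφ⟩
    exact ⟨DifferentiableOn.const_smul hf c, c • φ, hφ.smul Fact.out c⟩

/-- The type of elements of `A^{q,p}_λ(Π)`. It is a separate definition so that it carries the
topology of its norm below and not the one of pointwise convergence. -/
def BergmanSpace (lam : ℝ) (p q : ℝ≥0∞) [Fact (-1 < lam)] [Fact (1 ≤ p)] [Fact (1 ≤ q)] : Type :=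
  ↥(bergmanSubmodule lam p q)

section Space

variable (lam : ℝ) (p q : ℝ≥0∞) [Fact (-1 < lam)] [Fact (1 ≤ p)] [Fact (1 ≤ q)]

instance : AddCommGroup (BergmanSpace lam p q) :=
  inferInstanceAs (AddCommGroup ↥(bergmanSubmodule lam p q))

instance : Module ℂ (BergmanSpace lam p q) :=
  inferInstanceAs (Module ℂ ↥(bergmanSubmodule lam p q))

variable {lam p q}

/-- The underlying holomorphic function, as a linear map. -/
def toFunₗ : BergmanSpace lam p q →ₗ[ℂ] (ℍ → ℂ) := (bergmanSubmodule lam p q).subtype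

theorem toFunₗ_injective :
    Function.Injective (toFunₗ : BergmanSpace lam p q →ₗ[ℂ] (ℍ → ℂ)) :=
  Subtype.val_injective

theorem existsUnique_partialFourier (f : BergmanSpace lam p q) :
    ∃! φ : MixedLp lam p q, IsPartialFourier (toFunₗ f) φ := by
  have hl : -1 < lam := Fact.out
  obtain ⟨φ, hφ⟩ := f.2.2
  refine ⟨φ, hφ, fun ψ hψ => ?_⟩
  have h := IsPartialFourier.add hl hψ (IsPartialFourier.smul hl (-1) hφ)
  have e : toFunₗ f + (-1 : ℂ) • (f.1 : ℍ → ℂ) = 0 := by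
    rw [neg_one_smul]
    exact add_neg_cancel _
  rw [e, neg_one_smul, ← sub_eq_add_neg] at h
  exact sub_eq_zero.1 (IsPartialFourier.eq_zero hl h)

/-- The Fourier transform in the first variable of an element of `A^{q,p}_λ(Π)`. -/
def partialFourier (f : BergmanSpace lam p q) : MixedLp lam p q :=
  (existsUnique_partialFourier f).choose

theorem partialFourier_spec (f : BergmanSpace lam p q) :
    IsPartialFourier (toFunₗ f) (partialFourier f) :=
  (existsUnique_partialFourier f).choose_spec.1

theorem partialFourier_eq {f : BergmanSpace lam p q} {φ : MixedLp lam p q}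
    (h : IsPartialFourier (toFunₗ f) φ) : partialFourier f = φ :=
  ((existsUnique_partialFourier f).choose_spec.2 φ h).symm

variable (lam p q)

/-- The operator `U₁ f = π^{-1/2} f̂`, where `f̂` is the Fourier transform in the first variable. -/
def U₁ : BergmanSpace lam p q →ₗ[ℂ] MixedLp lam p q where
  toFun f := ((Real.sqrt Real.pi : ℝ) : ℂ)⁻¹ • partialFourier f
  map_add' f g := by
    rw [← smul_add]
    congr 1
    refine partialFourier_eq ?_
    rw [map_add]
    exact IsPartialFourier.add Fact.out (partialFourier_spec f) (partialFourier_spec g)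
  map_smul' c f := by
    rw [RingHom.id_apply, smul_comm c]
    congr 1
    refine partialFourier_eq ?_
    rw [map_smul]
    exact IsPartialFourier.smul Fact.out c (partialFourier_spec f)

theorem U₁_injective : Function.Injective (U₁ lam p q) := by
  rw [← LinearMap.ker_eq_bot, LinearMap.ker_eq_bot']
  intro f hf
  have hs : ((Real.sqrt Real.pi : ℝ) : ℂ)⁻¹ ≠ 0 :=
    inv_ne_zero (Complex.ofReal_ne_zero.2 (Real.sqrt_ne_zero'.2 Real.pi_pos))
  have h0 : partialFourier f = 0 := (smul_eq_zero.1 hf).resolve_left hs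
  have h1 := partialFourier_spec f
  rw [h0] at h1
  exact toFunₗ_injective ((h1.eq_zero_of_zero Fact.out f.2.1).trans (map_zero toFunₗ).symm)

/-- The norm `‖f‖ = ‖π^{-1/2} f̂‖` of `L^q(ℝ; L^p(ℝ₊, ν_λ))`. -/
instance : NormedAddCommGroup (BergmanSpace lam p q) :=
  NormedAddCommGroup.induced _ _ (U₁ lam p q) (U₁_injective lam p q)

instance : NormedSpace ℂ (BergmanSpace lam p q) where
  norm_smul_le c f := by
    change ‖U₁ lam p q (c • f)‖ ≤ ‖c‖ * ‖U₁ lam p q f‖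
    rw [map_smul]
    exact norm_smul_le c _

theorem norm_eq (f : BergmanSpace lam p q) : ‖f‖ = ‖U₁ lam p q f‖ := rfl

end Space

/-- The measure `dμ_λ(x + i y) = π⁻¹ (λ + 1) (2 y) ^ λ dx dy` on `Π`, in the coordinates
`(x, y)`. -/
def mu (lam : ℝ) : Measure (ℝ × ℝ) :=
  ENNReal.ofReal Real.pi⁻¹ • (volume : Measure ℝ).prod (nu lam)

/-- The weighted Bergman kernel `K_λ(z, w) = - i ^ λ (z - w̄) ^ {-(2 + λ)}` (principal branches). -/
def kernelK (lam : ℝ) (z w : ℍ) : ℂ :=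
  -(Complex.I ^ (lam : ℂ)) * (1 / ((z : ℂ) - conj (w : ℂ)) ^ (2 + lam : ℂ))

/-- The integrand of the Bergman projection. -/
def bergmanIntegrand (lam : ℝ) (g : ℍ → ℂ) (z : ℍ) (w : ℝ × ℝ) : ℂ :=
  g (pt w.1 w.2) * kernelK lam z (pt w.1 w.2)

/-- The Bergman projection `(B g)(z) = ∫ g(w) K_λ(z, w) dμ_λ(w)`. -/
def bergmanProj (lam : ℝ) (g : ℍ → ℂ) (z : ℍ) : ℂ :=
  ∫ w, bergmanIntegrand lam g z w ∂(mu lam)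

theorem bergmanIntegrand_add (lam : ℝ) (f g : ℍ → ℂ) (z : ℍ) :
    bergmanIntegrand lam (f + g) z = bergmanIntegrand lam f z + bergmanIntegrand lam g z := by
  ext w
  simp [bergmanIntegrand, add_mul]

theorem bergmanIntegrand_smul (lam : ℝ) (c : ℂ) (f : ℍ → ℂ) (z : ℍ) :
    bergmanIntegrand lam (c • f) z = c • bergmanIntegrand lam f z := by
  ext w
  simp [bergmanIntegrand, mul_assoc]

theorem bergmanProj_add (lam : ℝ) {f g : ℍ → ℂ} (hf : ∀ z, Integrable (bergmanIntegrand lam f z) (mu lam))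
    (hg : ∀ z, Integrable (bergmanIntegrand lam g z) (mu lam)) :
    bergmanProj lam (f + g) = bergmanProj lam f + bergmanProj lam g := by
  ext z
  simp only [bergmanProj, bergmanIntegrand_add, Pi.add_apply]
  exact integral_add (hf z) (hg z)

theorem bergmanProj_smul (lam : ℝ) (c : ℂ) (f : ℍ → ℂ) :
    bergmanProj lam (c • f) = c • bergmanProj lam f := by
  ext z
  simp only [bergmanProj, bergmanIntegrand_smul, Pi.smul_apply]
  exact integral_smul c _

section Toeplitz

variable (lam : ℝ) (p q : ℝ≥0∞) [Fact (-1 < lam)] [Fact (1 ≤ p)] [Fact (1 ≤ q)] (a : ℝ → ℂ)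

/-- Multiplication of functions on `Π` by the vertical symbol `a(y)`, `y = Im w`. -/
def symbolMul : (ℍ → ℂ) →ₗ[ℂ] (ℍ → ℂ) where
  toFun f w := a w.im * f w
  map_add' f g := by
    ext w
    simp [mul_add]
  map_smul' c f := by
    ext w
    simp [mul_left_comm]

/-- The natural domain of the Toeplitz operator: all `f ∈ A^{q,p}_λ(Π)` for which the integral
`B(a f)(z)` converges absolutely for every `z ∈ Π` and `B(a f)` belongs to `A^{q,p}_λ(Π)`. -/
def toeplitzDomain : Submodule ℂ (BergmanSpace lam p q) where
  carrier := {f | (∀ z, Integrable (bergmanIntegrand lam (symbolMul a (toFunₗ f)) z) (mu lam)) ∧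
    bergmanProj lam (symbolMul a (toFunₗ f)) ∈ bergmanSubmodule lam p q}
  add_mem' := by
    rintro f g ⟨hf1, hf2⟩ ⟨hg1, hg2⟩
    simp only [mem_ofPred_eq, map_add]
    refine ⟨fun z => ?_, ?_⟩
    · rw [bergmanIntegrand_add]
      exact (hf1 z).add (hg1 z)
    · rw [bergmanProj_add lam hf1 hg1]
      exact add_mem hf2 hg2
  zero_mem' := by
    have h : bergmanProj lam 0 = 0 := by
      simpa using bergmanProj_smul lam 0 0
    simp only [mem_ofPred_eq, map_zero, h, zero_mem, and_true]
    intro z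
    have : bergmanIntegrand lam 0 z = 0 := by
      simpa using bergmanIntegrand_smul lam 0 0 z
    rw [this]
    exact integrable_zero _ _ _
  smul_mem' := by
    rintro c f ⟨hf1, hf2⟩
    simp only [mem_ofPred_eq, map_smul]
    refine ⟨fun z => ?_, ?_⟩
    · rw [bergmanIntegrand_smul]
      exact (hf1 z).smul c
    · rw [bergmanProj_smul]
      exact Submodule.smul_mem _ c hf2

/-- The Toeplitz operator `T_a f = B(a f)` with vertical symbol `a = a(y)`, as a (possibly
unbounded) operator in `A^{q,p}_λ(Π)`. -/
def toeplitz : BergmanSpace lam p q →ₗ.[ℂ] BergmanSpace lam p q where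
  domain := toeplitzDomain lam p q a
  toFun :=
    { toFun := fun f => (⟨bergmanProj lam (symbolMul a (toFunₗ f.1)), f.2.2⟩ :
        ↥(bergmanSubmodule lam p q))
      map_add' := fun f g => by
        refine Subtype.ext ?_
        change bergmanProj lam (symbolMul a (toFunₗ (f.1 + g.1))) = _
        rw [map_add, map_add, bergmanProj_add lam f.2.1 g.2.1]
        rfl
      map_smul' := fun c f => by
        refine Subtype.ext ?_
        change bergmanProj lam (symbolMul a (toFunₗ (c • f.1))) = _
        rw [map_smul, map_smul, bergmanProj_smul]
        rfl }

/-- A densely defined linear operator is bounded if it is bounded on its domain; if the space is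
complete, it then extends uniquely to a bounded operator on the whole space. -/
def IsBoundedOp {E : Type*} [NormedAddCommGroup E] [NormedSpace ℂ E] (T : E →ₗ.[ℂ] E) : Prop :=
  ∃ C : ℝ, ∀ f : T.domain, ‖T f‖ ≤ C * ‖(f : E)‖

/-- Admissible vertical symbols: `a(y) e^{-ε y} ∈ L¹(ℝ₊)` for every `ε > 0`, and, if `λ < 0`,
`a(y) y ^ λ` is integrable near zero. -/
structure IsVerticalSymbol : Prop where
  exp_integrable : ∀ ε : ℝ, 0 < ε →
    IntegrableOn (fun y : ℝ => a y * (Real.exp (-(ε * y)) : ℂ)) (Ioi 0)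
  near_zero : lam < 0 → ∃ δ : ℝ, 0 < δ ∧
    IntegrableOn (fun y : ℝ => a y * ((y ^ lam : ℝ) : ℂ)) (Ioc 0 δ)

/-- `γ_{a,λ}(x) = x^{λ+1} / Γ(λ+1) ∫₀^∞ a(t/p) e^{-t x} t^λ dt`, for `x > 0`. -/
def gammaFn (p : ℝ) (x : ℝ) : ℂ :=
  ((x ^ (lam + 1) / Real.Gamma (lam + 1) : ℝ) : ℂ) *
    ∫ t in Ioi (0 : ℝ), a (t / p) * ((Real.exp (-(t * x)) * t ^ lam : ℝ) : ℂ)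

end Toeplitz

end ToeplitzHalfPlane

end

open ToeplitzHalfPlane

/-!
The Fourier transform in `x` diagonalizes all the Toeplitz operators with vertical symbols at once.

*The space.* Let `f ∈ A^{q,p}_λ(Π)`. In the Fourier transform `φ(ξ, y)` of `f(x + i y)`, the
Cauchy–Riemann equation becomes `∂_y φ = - ξ φ`, so `φ(ξ, ·)` is a multiple `h(ξ) e^{-ξ y}` of an
exponential, and `h(ξ) = 0` for `ξ ≤ 0`, as then the exponential is not in `L^p(ν_λ)`. As `φ` is
known only through its pairings with Schwartz and test functions, this is carried out weakly
(`IsHol.integral_dbar`, `exists_ae_eq_of_weak_ode`, `IsPartialFourier.exists_symbol`). Conversely,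
if `h(ξ) e^{-ξ y}` is in the mixed norm space, then Hölder's inequality makes the integral
`(2π)^{-1/2} ∫₀^∞ h(ξ) e^{i ξ z} dξ` converge absolutely, and it is an element with symbol `h`
(`isLaplace_of_memLp`, `isPartialFourier_synth`). Hence the space is a weighted `L^q` space of
symbols `h` on the half-line. In particular a bounded continuous function `m` acts on it by
multiplication, and the spectrum of this operator is the closure of the range of `m`
(`spectrum_mulOperator`).

*The operator.* The Bergman kernel is the Fourier–Laplace integral of `t^{1+λ} / Γ(2+λ)`
(`laplaceInt_rpow`). Hence, formally, `T_a` multiplies symbols by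
`m(ξ) = 2 ξ^{1+λ} / Γ(2+λ) ∫ a(y) e^{-2ξy} dν_λ(y)`, and the substitution `t = p y` shows that `m`
and `γ_{a,λ}` are reparametrizations of each other (`image_gammaFn`). The interchange of the
integrals in `y` and `ξ` is legitimate when the symbol is supported in a compact subset of the
open half-line (`IsLaplace.bergmanProj_synth`); such elements are in the domain of `T_a`,
and they are dense, as `q < ∞` (`dense_toeplitzDomain`). For an arbitrary `f` in the domain,
`∫ |a(y)| e^{-2ξy} dν_λ(y)` may grow too fast as `ξ → 0` for this, and the identity is proved
weakly instead: `T_a f` is paired, on the line `Im z = 1`, with the Fourier transform of a test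
function on the half-line (`integral_fourierR_mul_bergmanProj`,
`IsSymbol.toeplitz`).

*Conclusion.* `T_a` is the restriction of the multiplication by `m` to a dense domain that contains
all elements with compactly supported symbol. So it is bounded exactly when `m` is bounded
(`isBoundedOp_toeplitz_iff`), its extension is the multiplication by `m`, and the spectrum is the
closure of the range of `m`, which is that of `γ_{a,λ}`.
-/

noncomputable section

namespace ToeplitzHalfPlane

/-! ### The exponentials in `L^p(ℝ₊, ν_λ)` -/

section Exponentials

variable {lam : ℝ} {p : ℝ≥0∞}

theorem ae_nu (hl : -1 < lam) : ae (nu lam) = ae (volume.restrict (Ioi (0 : ℝ))) := by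
  refine le_antisymm (withDensity_absolutelyContinuous _ _).ae_le ?_
  refine (withDensity_absolutelyContinuous' measurable_dens.ennreal_ofReal.aemeasurable ?_).ae_le
  refine (ae_restrict_iff' measurableSet_Ioi).2 (ae_of_all _ fun y hy => ?_)
  simpa using dens_pos hl hy

theorem integrable_nu_iff {E : Type*} [NormedAddCommGroup E] [NormedSpace ℝ E] (hl : -1 < lam)
    (g : ℝ → E) :
    Integrable g (nu lam) ↔ IntegrableOn (fun y => dens lam y • g y) (Ioi 0) := by
  rw [nu, integrable_withDensity_iff_integrable_smul' measurable_dens.ennreal_ofReal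
    (ae_of_all _ fun _ => ENNReal.ofReal_lt_top)]
  refine integrableOn_congr_fun (fun y hy => ?_) measurableSet_Ioi
  simp only [ENNReal.toReal_ofReal (dens_pos hl hy).le]

theorem integral_nu {E : Type*} [NormedAddCommGroup E] [NormedSpace ℝ E] (hl : -1 < lam)
    (g : ℝ → E) : ∫ y, g y ∂(nu lam) = ∫ y in Ioi (0 : ℝ), dens lam y • g y := by
  rw [nu, integral_withDensity_eq_integral_toReal_smul₀
    (measurable_dens.ennreal_ofReal.aemeasurable) (ae_of_all _ fun _ => ENNReal.ofReal_lt_top)]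
  refine setIntegral_congr_fun measurableSet_Ioi fun y hy => ?_
  simp only [ENNReal.toReal_ofReal (dens_pos hl hy).le]

theorem dens_eq {y : ℝ} (hy : 0 < y) : dens lam y = (lam + 1) * 2 ^ lam * y ^ lam := by
  rw [dens, Real.mul_rpow (by norm_num) hy.le, mul_assoc]

instance : SFinite (nu lam) := by unfold nu; infer_instance

theorem integrableOn_rpow_mul_exp {s r : ℝ} (hs : -1 < s) (hr : 0 < r) :
    IntegrableOn (fun t : ℝ => t ^ s * Real.exp (-(r * t))) (Ioi 0) := by
  have := integrableOn_rpow_mul_exp_neg_mul_rpow (p := 1) (b := r) hs zero_lt_one hr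
  simpa [neg_mul] using this

theorem integrable_exp_nu (hl : -1 < lam) {r : ℝ} (hr : 0 < r) :
    Integrable (fun y => Real.exp (-(r * y))) (nu lam) := by
  rw [integrable_nu_iff hl]
  refine IntegrableOn.congr_fun (Integrable.const_mul (integrableOn_rpow_mul_exp hl hr)
    ((lam + 1) * 2 ^ lam)) (fun y hy => ?_) measurableSet_Ioi
  simp only [smul_eq_mul, dens_eq (show 0 < y from hy)]
  ring

theorem integral_exp_nu (hl : -1 < lam) {r : ℝ} (hr : 0 < r) :
    ∫ y, Real.exp (-(r * y)) ∂(nu lam) =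
      (∫ y, Real.exp (-y) ∂(nu lam)) * r ^ (-(lam + 1)) := by
  have key : ∀ {r : ℝ}, 0 < r → ∫ y, Real.exp (-(r * y)) ∂(nu lam) =
      (lam + 1) * 2 ^ lam * Real.Gamma (lam + 1) * r ^ (-(lam + 1)) := by
    intro r hr
    have h := Real.integral_rpow_mul_exp_neg_mul_Ioi (a := lam + 1) (r := r) (by linarith) hr
    rw [integral_nu hl, Real.rpow_neg hr.le, ← Real.inv_rpow hr.le, ← one_div, mul_assoc,
      mul_comm (Real.Gamma _), ← h, ← integral_const_mul]
    refine setIntegral_congr_fun measurableSet_Ioi fun y hy => ?_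
    simp only [smul_eq_mul, dens_eq (show 0 < y from hy), add_sub_cancel_right]
    ring
  have h1 := key one_pos
  simp only [one_mul, Real.one_rpow, mul_one] at h1
  rw [key hr, h1]

/-- The function `y ↦ e^{-ξ y}`. -/
def expFn (ξ y : ℝ) : ℂ := ((Real.exp (-(ξ * y)) : ℝ) : ℂ)

theorem norm_expFn (ξ y : ℝ) : ‖expFn ξ y‖ = Real.exp (-(ξ * y)) := by
  rw [expFn, Complex.norm_real, Real.norm_eq_abs, abs_of_pos (Real.exp_pos _)]

theorem continuous_expFn : Continuous fun w : ℝ × ℝ => expFn w.1 w.2 := by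
  unfold expFn
  fun_prop

theorem continuous_expFn_right (ξ : ℝ) : Continuous (expFn ξ) :=
  continuous_expFn.comp (by fun_prop : Continuous fun y : ℝ => (ξ, y))

theorem expFn_mul (ξ y z : ℝ) : expFn ξ y * expFn ξ z = expFn ξ (y + z) := by
  simp only [expFn, ← Complex.ofReal_mul, ← Real.exp_add]
  congr 2
  ring

theorem norm_expFn_rpow (ξ y r : ℝ) : ‖expFn ξ y‖ ^ r = Real.exp (-(r * ξ * y)) := by
  rw [norm_expFn, ← Real.exp_mul]
  congr 1
  ring

theorem toReal_pos_of_fact [Fact (1 ≤ p)] (hp : p ≠ ⊤) : 0 < p.toReal :=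
  ENNReal.toReal_pos (zero_lt_one.trans_le Fact.out).ne' hp

theorem memLp_expFn [Fact (1 ≤ p)] (hl : -1 < lam) (hp : p ≠ ⊤) {ξ : ℝ} (hξ : 0 < ξ) :
    MemLp (expFn ξ) p (nu lam) := by
  have hP := toReal_pos_of_fact hp
  rw [← integrable_norm_rpow_iff (continuous_expFn_right ξ).aestronglyMeasurable
    (zero_lt_one.trans_le Fact.out).ne' hp]
  simp only [norm_expFn_rpow]
  exact integrable_exp_nu hl (mul_pos hP hξ)

/-- As `λ > -1`, the measure `ν_λ` is infinite near infinity. -/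
theorem not_memLp_expFn [Fact (1 ≤ p)] (hl : -1 < lam) (hp : p ≠ ⊤) {ξ : ℝ} (hξ : ξ ≤ 0) :
    ¬ MemLp (expFn ξ) p (nu lam) := by
  intro h
  have hP := toReal_pos_of_fact hp
  rw [← integrable_norm_rpow_iff (continuous_expFn_right ξ).aestronglyMeasurable
    (zero_lt_one.trans_le Fact.out).ne' hp, integrable_nu_iff hl] at h
  simp only [norm_expFn_rpow] at h
  have h1 : IntegrableOn (fun y : ℝ => y ^ lam) (Ioi 1) := by
    have h2 := (h.mono_set (Ioi_subset_Ioi zero_le_one)).const_mul ((lam + 1) * 2 ^ lam)⁻¹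
    refine Integrable.mono' h2 (by fun_prop) ((ae_restrict_iff' measurableSet_Ioi).2
      (ae_of_all _ fun y hy => ?_))
    have hy0 : 0 < y := zero_lt_one.trans hy
    have hc : 0 < (lam + 1) * 2 ^ lam := mul_pos (by linarith) (by positivity)
    have he : 1 ≤ Real.exp (-(p.toReal * ξ * y)) := by
      rw [Real.one_le_exp_iff]
      have : p.toReal * ξ ≤ 0 := mul_nonpos_of_nonneg_of_nonpos hP.le hξ
      nlinarith
    rw [dens_eq hy0, smul_eq_mul, Real.norm_of_nonneg (by positivity), mul_assoc,
      inv_mul_cancel_left₀ hc.ne']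
    exact le_mul_of_one_le_right (by positivity) he
  rw [integrableOn_Ioi_rpow_iff zero_lt_one] at h1
  linarith

variable (lam p) in
/-- The exponential `y ↦ e^{-ξ y}` as an element of `L^p(ℝ₊, ν_λ)`; it is zero when the exponential
is not in this space, which is the case exactly for `ξ ≤ 0`. -/
def expLp (ξ : ℝ) : VertLp lam p :=
  open Classical in if h : MemLp (expFn ξ) p (nu lam) then h.toLp else 0

theorem coeFn_expLp [Fact (1 ≤ p)] (hl : -1 < lam) (hp : p ≠ ⊤) {ξ : ℝ} (hξ : 0 < ξ) :
    expLp lam p ξ =ᵐ[nu lam] expFn ξ := by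
  rw [expLp, dif_pos (memLp_expFn hl hp hξ)]
  exact MemLp.coeFn_toLp _

theorem expLp_of_nonpos [Fact (1 ≤ p)] (hl : -1 < lam) (hp : p ≠ ⊤) {ξ : ℝ} (hξ : ξ ≤ 0) :
    expLp lam p ξ = 0 := by
  rw [expLp, dif_neg (not_memLp_expFn hl hp hξ)]

theorem norm_expLp [Fact (1 ≤ p)] (hl : -1 < lam) (hp : p ≠ ⊤) {ξ : ℝ} (hξ : 0 < ξ) :
    ‖expLp lam p ξ‖ = ‖expLp lam p 1‖ * ξ ^ (-((lam + 1) / p.toReal)) := by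
  have hP := toReal_pos_of_fact hp
  have hint : 0 ≤ ∫ y, Real.exp (-y) ∂(nu lam) := integral_nonneg fun y => (Real.exp_pos _).le
  have key : ∀ {ξ : ℝ}, 0 < ξ → ‖expLp lam p ξ‖ =
      ((∫ y, Real.exp (-y) ∂(nu lam)) * (p.toReal * ξ) ^ (-(lam + 1))) ^ (p.toReal)⁻¹ := by
    intro ξ hξ
    have hm := memLp_expFn (p := p) hl hp hξ
    rw [expLp, dif_pos hm, Lp.norm_toLp, hm.eLpNorm_eq_integral_rpow_norm
      (zero_lt_one.trans_le Fact.out).ne' hp, ENNReal.toReal_ofReal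
      (Real.rpow_nonneg (integral_nonneg fun y => by positivity) _)]
    simp only [norm_expFn_rpow]
    rw [integral_exp_nu hl (mul_pos hP hξ)]
  rw [key hξ, key one_pos, mul_one, Real.mul_rpow hP.le hξ.le, ← mul_assoc,
    Real.mul_rpow (mul_nonneg hint (by positivity)) (by positivity), ← Real.rpow_mul hξ.le]
  congr 2
  field_simp

theorem expLp_ne_zero [Fact (1 ≤ p)] (hl : -1 < lam) (hp : p ≠ ⊤) {ξ : ℝ} (hξ : 0 < ξ) :
    expLp lam p ξ ≠ 0 := by
  intro h
  rw [Lp.eq_zero_iff_ae_eq_zero] at h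
  have h1 : ∀ᵐ y ∂(nu lam), False := by
    filter_upwards [h, coeFn_expLp (p := p) hl hp hξ] with y h1 h2
    rw [h1] at h2
    have := norm_expFn ξ y
    rw [← h2] at this
    simp only [Pi.zero_apply, norm_zero] at this
    exact (Real.exp_pos _).ne this
  rw [Filter.eventually_false_iff_eq_bot, ae_nu hl, ae_eq_bot, Measure.restrict_eq_zero] at h1
  simp at h1

theorem continuousOn_expLp [Fact (1 ≤ p)] (hl : -1 < lam) (hp : p ≠ ⊤) :
    ContinuousOn (expLp lam p) (Ioi 0) := by
  -- For `ξ, η > m` the exponentials differ by at most `|ξ - η| y e^{-m y}`, and half of the decay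
  -- absorbs the factor `y`.
  have key : ∀ m > 0, ∀ ξ > m, ∀ η > m,
      ‖expLp lam p ξ - expLp lam p η‖ ≤ (2 / m * |ξ - η|) * ‖expLp lam p (m / 2)‖ := by
    intro m hm
    have hle : ∀ ξ > m, ∀ η > m, ξ ≤ η → ∀ y > 0, ‖expFn ξ y - expFn η y‖ ≤
        (2 / m * |ξ - η|) * ‖expFn (m / 2) y‖ := by
      intro ξ hξ η hη hle y hy
      have e1 : Real.exp (-(η * y)) ≤ Real.exp (-(ξ * y)) :=
        Real.exp_le_exp.2 (by nlinarith)
      have e2 : Real.exp (-(η * y)) = Real.exp (-(ξ * y)) * Real.exp (-((η - ξ) * y)) := by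
        rw [← Real.exp_add]
        congr 1
        ring
      have e3 := Real.add_one_le_exp (-((η - ξ) * y))
      have e4 : m / 2 * y ≤ Real.exp (m / 2 * y) := by
        have := Real.add_one_le_exp (m / 2 * y)
        linarith
      have e5 : Real.exp (-(ξ * y)) ≤ Real.exp (-(m * y)) :=
        Real.exp_le_exp.2 (by nlinarith)
      have e6 : Real.exp (-(m * y)) * Real.exp (m / 2 * y) = Real.exp (-(m / 2 * y)) := by
        rw [← Real.exp_add]
        congr 1
        ring
      rw [norm_expFn, expFn, expFn, ← Complex.ofReal_sub, Complex.norm_real, Real.norm_eq_abs,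
        abs_of_nonneg (by linarith), abs_of_nonpos (by linarith), e2]
      calc Real.exp (-(ξ * y)) - Real.exp (-(ξ * y)) * Real.exp (-((η - ξ) * y))
          = Real.exp (-(ξ * y)) * (1 - Real.exp (-((η - ξ) * y))) := by ring
        _ ≤ Real.exp (-(ξ * y)) * ((η - ξ) * y) := by
            gcongr
            linarith
        _ ≤ Real.exp (-(m * y)) * ((η - ξ) * y) := by
            have : 0 ≤ η - ξ := by linarith
            gcongr
        _ = 2 / m * (η - ξ) * (Real.exp (-(m * y)) * (m / 2 * y)) := by
            field_simp
        _ ≤ 2 / m * (η - ξ) * (Real.exp (-(m * y)) * Real.exp (m / 2 * y)) := by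
            have : 0 ≤ η - ξ := by linarith
            gcongr
        _ = 2 / m * -(ξ - η) * Real.exp (-(m / 2 * y)) := by
            rw [e6]
            ring
    have hle' : ∀ ξ > m, ∀ η > m, ∀ y > 0, ‖expFn ξ y - expFn η y‖ ≤
        (2 / m * |ξ - η|) * ‖expFn (m / 2) y‖ := by
      intro ξ hξ η hη y hy
      rcases le_total ξ η with h | h
      · exact hle ξ hξ η hη h y hy
      · rw [norm_sub_rev, abs_sub_comm]
        exact hle η hη ξ hξ h y hy
    intro ξ hξ η hη
    refine Lp.norm_le_mul_norm_of_ae_le_mul ?_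
    have hy : ∀ᵐ y ∂(nu lam), 0 < y := by
      rw [ae_nu hl]
      exact ae_restrict_mem measurableSet_Ioi
    filter_upwards [hy, Lp.coeFn_sub (expLp lam p ξ) (expLp lam p η),
      coeFn_expLp (p := p) hl hp (hm.trans hξ), coeFn_expLp (p := p) hl hp (hm.trans hη),
      coeFn_expLp (p := p) hl hp (half_pos hm)] with y h0 h1 h2 h3 h4
    rw [h1, Pi.sub_apply, h2, h3, h4]
    exact hle' ξ hξ η hη y h0
  intro ξ hξ
  have hξ0 : 0 < ξ := hξ
  refine ContinuousAt.continuousWithinAt ?_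
  rw [ContinuousAt, tendsto_iff_norm_sub_tendsto_zero]
  have hlim : Filter.Tendsto (fun η : ℝ => (2 / (ξ / 2) * |η - ξ|) * ‖expLp lam p (ξ / 2 / 2)‖)
      (nhds ξ) (nhds 0) := by
    have : Continuous fun η : ℝ => (2 / (ξ / 2) * |η - ξ|) * ‖expLp lam p (ξ / 2 / 2)‖ := by
      fun_prop
    have h := this.tendsto ξ
    simpa using h
  refine squeeze_zero' (Filter.Eventually.of_forall fun _ => norm_nonneg _) ?_ hlim
  filter_upwards [lt_mem_nhds (half_lt_self hξ0)] with η hη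
  exact key (ξ / 2) (half_pos hξ0) η hη ξ (half_lt_self hξ0)

theorem aestronglyMeasurable_expLp [Fact (1 ≤ p)] (hl : -1 < lam) (hp : p ≠ ⊤) :
    AEStronglyMeasurable (expLp lam p) (volume : Measure ℝ) := by
  have h : (Ioi (0 : ℝ)).indicator (expLp lam p) = expLp lam p := by
    ext1 ξ
    by_cases hξ : ξ ∈ Ioi (0 : ℝ)
    · simp [hξ]
    · rw [indicator_of_notMem hξ, expLp_of_nonpos hl hp (not_lt.1 hξ)]
  rw [← h, aestronglyMeasurable_indicator_iff measurableSet_Ioi]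
  exact (continuousOn_expLp hl hp).aestronglyMeasurable measurableSet_Ioi

end Exponentials

/-! ### The unitary Fourier transform of Schwartz functions -/

section Fourier

theorem fourierR_eq_fourier (g : ℝ → ℂ) (x : ℝ) :
    fourierR g x = ((Real.sqrt (2 * Real.pi) : ℝ) : ℂ)⁻¹ *
      FourierTransform.fourier g (x / (2 * Real.pi)) := by
  rw [fourierR, Real.fourier_real_eq_integral_exp_smul]
  congr 1
  refine integral_congr_ae (ae_of_all _ fun t => ?_)
  simp only [smul_eq_mul]
  congr 2
  push_cast
  have : (Real.pi : ℂ) ≠ 0 := Complex.ofReal_ne_zero.2 Real.pi_ne_zero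
  field_simp

theorem exists_schwartz_fourierR (u : 𝓢(ℝ, ℂ)) : ∃ w : 𝓢(ℝ, ℂ), ∀ x, fourierR u x = w x := by
  have hpi : (2 * Real.pi)⁻¹ ≠ 0 := by positivity
  let e : ℝ ≃L[ℝ] ℝ := ContinuousLinearEquiv.unitsEquivAut ℝ (Units.mk0 _ hpi)
  refine ⟨((Real.sqrt (2 * Real.pi) : ℝ) : ℂ)⁻¹ •
    SchwartzMap.compCLMOfContinuousLinearEquiv ℂ e (FourierTransform.fourier u), fun x => ?_⟩
  rw [fourierR_eq_fourier, ← SchwartzMap.fourier_coe, div_eq_mul_inv]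
  rfl

/-- Fourier inversion in the unitary normalization. -/
theorem integral_fourierR_mul_exp_of_integrable {u : ℝ → ℂ} (hc : Continuous u)
    (hi : Integrable u) (hF : Integrable (fourierR u)) (ξ : ℝ) :
    ∫ x : ℝ, fourierR u x * Complex.exp (Complex.I * ξ * x) =
      ((Real.sqrt (2 * Real.pi) : ℝ) : ℂ) * u ξ := by
  have hF' : Integrable (FourierTransform.fourier u) := by
    have h0 : Real.sqrt (2 * Real.pi) ≠ 0 := Real.sqrt_ne_zero'.2 (by positivity)
    have h1 := (hF.comp_mul_left' (R := 2 * Real.pi) (by positivity)).const_mul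
      ((Real.sqrt (2 * Real.pi) : ℝ) : ℂ)
    refine h1.congr (ae_of_all _ fun v => ?_)
    simp only [fourierR_eq_fourier]
    rw [mul_inv_cancel_left₀ (Complex.ofReal_ne_zero.2 h0), mul_div_cancel_left₀ v (by positivity)]
  have h1 : FourierTransform.fourierInv (FourierTransform.fourier u) ξ = u ξ :=
    congrFun (hc.fourierInv_fourier_eq hi hF') ξ
  rw [Real.fourierInv_eq'] at h1
  have hpi : (Real.pi : ℂ) ≠ 0 := Complex.ofReal_ne_zero.2 Real.pi_ne_zero
  have hs : ((Real.sqrt (2 * Real.pi) : ℝ) : ℂ) ≠ 0 :=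
    Complex.ofReal_ne_zero.2 (Real.sqrt_ne_zero'.2 (by positivity))
  have hs2 : ((Real.sqrt (2 * Real.pi) : ℝ) : ℂ) * ((Real.sqrt (2 * Real.pi) : ℝ) : ℂ) =
      2 * Real.pi := by
    rw [← Complex.ofReal_mul, Real.mul_self_sqrt (by positivity)]
    push_cast
    rfl
  have h2 := Measure.integral_comp_div (fun v : ℝ =>
    Complex.exp (((2 * Real.pi * inner ℝ v ξ : ℝ) : ℂ) * Complex.I) •
      FourierTransform.fourier (u : ℝ → ℂ) v) (2 * Real.pi)
  rw [h1, abs_of_pos (by positivity)] at h2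
  rw [← h1, h1]
  have h3 : ∀ x : ℝ, fourierR u x * Complex.exp (Complex.I * ξ * x) =
      ((Real.sqrt (2 * Real.pi) : ℝ) : ℂ)⁻¹ *
      (Complex.exp (((2 * Real.pi * inner ℝ (x / (2 * Real.pi)) ξ : ℝ) : ℂ) * Complex.I) •
      FourierTransform.fourier (u : ℝ → ℂ) (x / (2 * Real.pi))) := by
    intro x
    have e : ((2 * Real.pi * inner ℝ (x / (2 * Real.pi)) ξ : ℝ) : ℂ) * Complex.I =
        Complex.I * ξ * x := by
      simp only [RCLike.inner_apply, conj_trivial]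
      push_cast
      field_simp
    rw [e, fourierR_eq_fourier, smul_eq_mul]
    ring
  simp only [h3]
  rw [integral_const_mul, h2, inv_mul_eq_iff_eq_mul₀ hs, ← mul_assoc, hs2, Complex.real_smul]
  push_cast
  rfl

theorem integral_fourierR_mul_exp (u : 𝓢(ℝ, ℂ)) (ξ : ℝ) :
    ∫ x : ℝ, fourierR u x * Complex.exp (Complex.I * ξ * x) =
      ((Real.sqrt (2 * Real.pi) : ℝ) : ℂ) * u ξ := by
  obtain ⟨w, hw⟩ := exists_schwartz_fourierR u
  exact integral_fourierR_mul_exp_of_integrable u.continuous u.integrable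
    (w.integrable.congr (ae_of_all _ fun x => (hw x).symm)) ξ

theorem norm_exp_I_mul (ξ : ℝ) (z : ℂ) :
    ‖Complex.exp (Complex.I * ξ * z)‖ = Real.exp (-(ξ * z.im)) := by
  rw [Complex.norm_exp]
  congr 1
  simp [mul_assoc]

theorem norm_exp_I_mul_real (ξ x : ℝ) : ‖Complex.exp (Complex.I * ξ * x)‖ = 1 := by
  simp [norm_exp_I_mul]

theorem exp_I_mul_add (ξ y : ℝ) (w : ℂ) :
    Complex.exp (Complex.I * ξ * (w + y * Complex.I)) =
      expFn ξ y * Complex.exp (Complex.I * ξ * w) := by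
  rw [expFn, Complex.ofReal_exp, ← Complex.exp_add]
  congr 1
  push_cast
  linear_combination (ξ : ℂ) * y * Complex.I_sq

/-- The multiplication formula for the Fourier transform of a Schwartz function and the inverse
Fourier transform of an integrable function. -/
theorem integral_fourierR_mul_inverse {ψ : ℝ → ℂ} (hψ : Integrable ψ) (u : 𝓢(ℝ, ℂ)) :
    ∫ x : ℝ, fourierR u x * ∫ ξ : ℝ, ψ ξ * Complex.exp (Complex.I * ξ * x) =
      ((Real.sqrt (2 * Real.pi) : ℝ) : ℂ) * ∫ ξ : ℝ, ψ ξ * u ξ := by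
  obtain ⟨w, hw⟩ := exists_schwartz_fourierR u
  have hprod : Integrable (fun s : ℝ × ℝ => fourierR u s.1 *
      (ψ s.2 * Complex.exp (Complex.I * s.2 * s.1))) (volume.prod volume) := by
    have h1 : Integrable (fun s : ℝ × ℝ => w s.1 * ψ s.2) (volume.prod volume) :=
      w.integrable.mul_prod hψ
    refine (h1.mul_bdd (c := 1)
      (g := fun s : ℝ × ℝ => Complex.exp (Complex.I * s.2 * s.1)) (by fun_prop)
      (ae_of_all _ fun s => (norm_exp_I_mul_real _ _).le)).congr (ae_of_all _ fun s => ?_)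
    simp only [hw]
    ring
  simp only [← integral_const_mul]
  rw [integral_integral_swap hprod]
  refine integral_congr_ae (ae_of_all _ fun ξ => ?_)
  have e : ∀ x : ℝ, fourierR u x * (ψ ξ * Complex.exp (Complex.I * ξ * x)) =
      ψ ξ * (fourierR u x * Complex.exp (Complex.I * ξ * x)) := fun x => by ring
  simp only [e, integral_const_mul, integral_fourierR_mul_exp]
  ring

end Fourier

/-! ### Fourier–Laplace integrals on the half-line -/

section Laplace

/-- All exponentially damped versions of `h` are integrable on the half-line. -/
structure IsLaplace (h : ℝ → ℂ) : Prop where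
  integrableOn : ∀ y : ℝ, 0 < y → IntegrableOn (fun ξ => h ξ * expFn ξ y) (Ioi 0)

/-- The function `z ↦ ∫₀^∞ h(ξ) e^{i ξ z} dξ` on the upper half-plane. -/
def laplaceInt (h : ℝ → ℂ) (z : ℂ) : ℂ :=
  ∫ ξ in Ioi (0 : ℝ), h ξ * Complex.exp (Complex.I * ξ * z)

theorem expFn_ne_zero (ξ y : ℝ) : expFn ξ y ≠ 0 :=
  Complex.ofReal_ne_zero.2 (Real.exp_pos _).ne'

variable {h : ℝ → ℂ}

theorem IsLaplace.aestronglyMeasurable (hh : IsLaplace h) :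
    AEStronglyMeasurable h (volume.restrict (Ioi 0)) := by
  have h1 := (hh.integrableOn 1 one_pos).aestronglyMeasurable
  have h2 : Continuous fun ξ : ℝ => (expFn ξ 1)⁻¹ :=
    (continuous_expFn.comp (by fun_prop : Continuous fun ξ : ℝ => (ξ, (1 : ℝ)))).inv₀
      fun ξ => expFn_ne_zero ξ 1
  refine (h1.mul h2.aestronglyMeasurable).congr (ae_of_all _ fun ξ => ?_)
  simp only [Pi.mul_apply]
  rw [mul_assoc, mul_inv_cancel₀ (expFn_ne_zero ξ 1), mul_one]

theorem IsLaplace.integrableOn_exp (hh : IsLaplace h) {z : ℂ} (hz : 0 < z.im) :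
    IntegrableOn (fun ξ : ℝ => h ξ * Complex.exp (Complex.I * ξ * z)) (Ioi 0) := by
  refine Integrable.mono (hh.integrableOn z.im hz)
    (hh.aestronglyMeasurable.mul (by fun_prop)) (ae_of_all _ fun ξ => ?_)
  rw [norm_mul, norm_mul, norm_exp_I_mul, norm_expFn]

theorem norm_laplaceInt_le (h : ℝ → ℂ) (z : ℂ) :
    ‖laplaceInt h z‖ ≤ ∫ ξ in Ioi (0 : ℝ), ‖h ξ * expFn ξ z.im‖ := by
  refine (norm_integral_le_integral_norm _).trans_eq ?_
  refine integral_congr_ae (ae_of_all _ fun ξ => ?_)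
  simp only [norm_mul, norm_exp_I_mul, norm_expFn]

theorem IsLaplace.norm_laplaceInt_le_of_le (hh : IsLaplace h) {z : ℂ} {δ : ℝ} (hδ : 0 < δ)
    (hz : δ ≤ z.im) : ‖laplaceInt h z‖ ≤ ∫ ξ in Ioi (0 : ℝ), ‖h ξ * expFn ξ δ‖ := by
  refine (norm_laplaceInt_le h z).trans (setIntegral_mono_on
    (hh.integrableOn _ (hδ.trans_le hz)).norm (hh.integrableOn δ hδ).norm measurableSet_Ioi
    fun ξ hξ => ?_)
  simp only [norm_mul, norm_expFn]
  have : (0 : ℝ) < ξ := hξ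
  gcongr

theorem IsLaplace.differentiableOn (hh : IsLaplace h) :
    DifferentiableOn ℂ (laplaceInt h) {z | 0 < z.im} := by
  intro z hz
  have hz0 : 0 < z.im := hz
  have hopen : IsOpen {w : ℂ | z.im / 2 < w.im} := isOpen_lt continuous_const Complex.continuous_im
  have hδ : 0 < z.im / 2 := half_pos hz0
  -- Near `z` the derivative of the integrand is at most `|h(ξ)| ξ e^{-ξ Im z / 2}`, and half of the
  -- decay absorbs the factor `ξ`.
  refine DifferentiableAt.differentiableWithinAt (HasDerivAt.differentiableAt
    (hasDerivAt_integral_of_dominated_loc_of_deriv_le (μ := volume.restrict (Ioi (0 : ℝ)))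
      (F := fun w ξ => h ξ * Complex.exp (Complex.I * ξ * w))
      (F' := fun w ξ => h ξ * (Complex.exp (Complex.I * ξ * w) * (Complex.I * ξ)))
      (bound := fun ξ => 4 / z.im * ‖h ξ * expFn ξ (z.im / 4)‖)
      (hopen.mem_nhds (half_lt_self hz0)) ?_ (hh.integrableOn_exp hz0) ?_ ?_ ?_ ?_).2)
  · filter_upwards [hopen.mem_nhds (half_lt_self hz0)] with w hw
    exact (hh.integrableOn_exp (hδ.trans hw)).aestronglyMeasurable
  · exact hh.aestronglyMeasurable.mul (by fun_prop)
  · refine (ae_restrict_iff' measurableSet_Ioi).2 (ae_of_all _ fun ξ hξ w hw => ?_)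
    have hξ0 : 0 < ξ := hξ
    have hw' : z.im / 2 < w.im := hw
    have h1 : z.im / 4 * ξ ≤ Real.exp (z.im / 4 * ξ) := by
      have := Real.add_one_le_exp (z.im / 4 * ξ)
      linarith
    have h2 : Real.exp (-(ξ * w.im)) ≤ Real.exp (-(ξ * (z.im / 2))) :=
      Real.exp_le_exp.2 (by nlinarith)
    have h3 : Real.exp (-(ξ * (z.im / 2))) * Real.exp (z.im / 4 * ξ) =
        Real.exp (-(ξ * (z.im / 4))) := by
      rw [← Real.exp_add]
      congr 1
      ring
    simp only [norm_mul, norm_exp_I_mul, norm_expFn, Complex.norm_I, one_mul, Complex.norm_real,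
      Real.norm_eq_abs, abs_of_pos hξ0]
    calc ‖h ξ‖ * (Real.exp (-(ξ * w.im)) * ξ)
        ≤ ‖h ξ‖ * (Real.exp (-(ξ * (z.im / 2))) * ξ) := by gcongr
      _ = 4 / z.im * (‖h ξ‖ * (Real.exp (-(ξ * (z.im / 2))) * (z.im / 4 * ξ))) := by
          field_simp
      _ ≤ 4 / z.im * (‖h ξ‖ * (Real.exp (-(ξ * (z.im / 2))) * Real.exp (z.im / 4 * ξ))) := by
          gcongr
      _ = 4 / z.im * (‖h ξ‖ * Real.exp (-(ξ * (z.im / 4)))) := by rw [h3]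
  · exact (hh.integrableOn _ (by positivity)).norm.const_mul _
  · refine ae_of_all _ fun ξ w _ => ?_
    have h1 : HasDerivAt (fun w : ℂ => Complex.I * ξ * w) (Complex.I * ξ) w := by
      simpa using (hasDerivAt_id w).const_mul (Complex.I * (ξ : ℂ))
    exact (h1.cexp).const_mul (h ξ)

/-- The pairing of a Fourier–Laplace integral, restricted to a horizontal line, with the Fourier
transform of a Schwartz function. -/
theorem IsLaplace.integral_fourierR_mul (hh : IsLaplace h) (u : 𝓢(ℝ, ℂ)) {y : ℝ} (hy : 0 < y) :
    ∫ x : ℝ, fourierR u x * laplaceInt h (x + y * Complex.I) =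
      ((Real.sqrt (2 * Real.pi) : ℝ) : ℂ) * ∫ ξ in Ioi (0 : ℝ), h ξ * expFn ξ y * u ξ := by
  have h1 : Integrable ((Ioi (0 : ℝ)).indicator fun ξ => h ξ * expFn ξ y) :=
    (integrable_indicator_iff measurableSet_Ioi).2 (hh.integrableOn y hy)
  have h2 := integral_fourierR_mul_inverse h1 u
  have e1 : ∫ ξ : ℝ, (Ioi (0 : ℝ)).indicator (fun ξ => h ξ * expFn ξ y) ξ * u ξ =
      ∫ ξ in Ioi (0 : ℝ), h ξ * expFn ξ y * u ξ := by
    rw [← integral_indicator measurableSet_Ioi]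
    refine integral_congr_ae (ae_of_all _ fun ξ => ?_)
    simp only [indicator_mul_left]
  rw [e1] at h2
  rw [← h2]
  refine integral_congr_ae (ae_of_all _ fun x => ?_)
  simp only
  congr 1
  rw [laplaceInt, ← integral_indicator measurableSet_Ioi]
  refine integral_congr_ae (ae_of_all _ fun ξ => ?_)
  simp only
  by_cases hξ : ξ ∈ Ioi (0 : ℝ)
  · rw [indicator_of_mem hξ, indicator_of_mem hξ, exp_I_mul_add]
    ring
  · rw [indicator_of_notMem hξ, indicator_of_notMem hξ, zero_mul]

end Laplace

/-! ### Synthesis: functions of `A^{q,p}_λ(Π)` from their symbols -/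

section Synthesis

variable {lam : ℝ} {p q : ℝ≥0∞}

theorem coe_pt (x : ℝ) {y : ℝ} (hy : 0 < y) : (pt x y : ℂ) = x + y * Complex.I := by
  rw [pt, UpperHalfPlane.ofComplex_apply_of_im_pos (by simpa using hy)]

theorem im_pt (x : ℝ) {y : ℝ} (hy : 0 < y) : (pt x y).im = y := by
  have := coe_pt x hy
  rw [← UpperHalfPlane.coe_im, this]
  simp

theorem rpow_mul_exp_le {α y : ℝ} (hα : 0 ≤ α) (hy : 0 < y) :
    ∃ C : ℝ, ∀ ξ : ℝ, 0 < ξ → ξ ^ α * Real.exp (-(y * ξ)) ≤ C := by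
  obtain ⟨n, hn⟩ := exists_nat_ge α
  refine ⟨1 + n.factorial / y ^ n, fun ξ hξ => ?_⟩
  have h1 : ξ ^ α ≤ 1 + ξ ^ n := by
    rcases le_total ξ 1 with h | h
    · have := Real.rpow_le_one hξ.le h hα
      have : 0 ≤ ξ ^ n := by positivity
      linarith
    · have := Real.rpow_le_rpow_of_exponent_le h hn
      rw [Real.rpow_natCast] at this
      linarith
  have h2 : ξ ^ n ≤ n.factorial / y ^ n * Real.exp (y * ξ) := by
    have := Real.pow_div_factorial_le_exp (y * ξ) (by positivity) n
    rw [mul_pow, div_le_iff₀ (by positivity)] at this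
    rw [div_mul_eq_mul_div, le_div_iff₀ (by positivity)]
    linarith
  have h3 : Real.exp (y * ξ) * Real.exp (-(y * ξ)) = 1 := by
    rw [← Real.exp_add, add_neg_cancel, Real.exp_zero]
  have h4 : Real.exp (-(y * ξ)) ≤ 1 := by
    rw [Real.exp_le_one_iff]
    have := mul_pos hy hξ
    linarith
  calc ξ ^ α * Real.exp (-(y * ξ))
      ≤ (1 + n.factorial / y ^ n * Real.exp (y * ξ)) * Real.exp (-(y * ξ)) := by
        gcongr
        linarith
    _ = Real.exp (-(y * ξ)) + n.factorial / y ^ n * (Real.exp (y * ξ) * Real.exp (-(y * ξ))) := by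
        ring
    _ ≤ 1 + n.factorial / y ^ n := by
        rw [h3, mul_one]
        linarith

theorem memLp_rpow_mul_exp {α y : ℝ} (hα : 0 ≤ α) (hy : 0 < y) {r : ℝ≥0∞} (hr : 1 ≤ r) :
    MemLp (fun ξ : ℝ => ξ ^ α * Real.exp (-(y * ξ))) r (volume.restrict (Ioi 0)) := by
  have hm : AEStronglyMeasurable (fun ξ : ℝ => ξ ^ α * Real.exp (-(y * ξ)))
      (volume.restrict (Ioi 0)) := by fun_prop
  rcases eq_or_ne r ⊤ with rfl | hr'
  · obtain ⟨C, hC⟩ := rpow_mul_exp_le hα hy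
    refine memLp_top_of_bound hm C ((ae_restrict_iff' measurableSet_Ioi).2
      (ae_of_all _ fun ξ hξ => ?_))
    have hξ0 : 0 < ξ := hξ
    rw [Real.norm_of_nonneg (by positivity)]
    exact hC ξ hξ0
  · have hr0 : 0 < r.toReal := ENNReal.toReal_pos (zero_lt_one.trans_le hr).ne' hr'
    rw [← integrable_norm_rpow_iff hm (zero_lt_one.trans_le hr).ne' hr']
    have h : IntegrableOn (fun t : ℝ => t ^ (α * r.toReal) * Real.exp (-((y * r.toReal) * t)))
        (Ioi 0) :=
      integrableOn_rpow_mul_exp (by have := mul_nonneg hα hr0.le; linarith) (mul_pos hy hr0)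
    refine IntegrableOn.congr_fun h (fun ξ hξ => ?_) measurableSet_Ioi
    have hξ0 : 0 < ξ := hξ
    rw [Real.norm_of_nonneg (by positivity), Real.mul_rpow (by positivity) (by positivity),
      ← Real.rpow_mul hξ0.le, ← Real.exp_mul]
    congr 2
    ring

/-- A symbol `h` with `h(ξ) e^{-ξ y}` in the mixed norm space is exponentially integrable: by
Hölder's inequality, as `‖e^{-ξ ·}‖⁻¹` is a multiple of a nonnegative power of `ξ`. -/
theorem isLaplace_of_memLp [Fact (1 ≤ p)] [Fact (1 ≤ q)] (hl : -1 < lam) (hp : p ≠ ⊤)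
    {h : ℝ → ℂ} (hm : AEStronglyMeasurable h (volume.restrict (Ioi 0)))
    (hh : MemLp (fun ξ => h ξ • expLp lam p ξ) q volume) : IsLaplace h := by
  refine ⟨fun y hy => ?_⟩
  have hP := toReal_pos_of_fact hp
  set α := (lam + 1) / p.toReal with hα
  have hα0 : 0 ≤ α := div_nonneg (by linarith) hP.le
  have hpq : q.HolderConjugate (ENNReal.conjExponent q) :=
    ENNReal.HolderConjugate.conjExponent Fact.out
  have h1 := (hh.restrict (Ioi 0)).norm
  have h2 := memLp_rpow_mul_exp hα0 hy hpq.symm.one_le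
  have h3 := (h1.integrable_mul h2).const_mul ‖expLp lam p 1‖⁻¹
  refine Integrable.mono' h3 (hm.mul (continuous_expFn.comp
    (by fun_prop : Continuous fun ξ : ℝ => (ξ, y))).aestronglyMeasurable)
    ((ae_restrict_iff' measurableSet_Ioi).2 (ae_of_all _ fun ξ hξ => ?_))
  have hξ0 : 0 < ξ := hξ
  have hne : ‖expLp lam p 1‖ ≠ 0 := norm_ne_zero_iff.2 (expLp_ne_zero hl hp one_pos)
  have hne' : ξ ^ α ≠ 0 := (Real.rpow_pos_of_pos hξ0 _).ne'
  simp only [Pi.mul_apply, norm_mul, norm_expFn, norm_smul]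
  rw [norm_expLp hl hp hξ0, ← hα, Real.rpow_neg hξ0.le]
  apply le_of_eq
  field_simp

theorem IsTest.exists_pos {v : ℝ → ℂ} (hv : IsTest v) : ∃ δ > 0, ∀ y < δ, v y = 0 := by
  have h0 : (tsupport v)ᶜ ∈ nhds (0 : ℝ) :=
    (isClosed_tsupport v).isOpen_compl.mem_nhds fun h => lt_irrefl (0 : ℝ) (hv.supp h)
  obtain ⟨δ, hδ, hb⟩ := Metric.mem_nhds_iff.1 h0
  refine ⟨δ, hδ, fun y hy => image_eq_zero_of_notMem_tsupport ?_⟩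
  rcases le_or_gt y 0 with h | h
  · exact fun h' => (not_lt.2 h) (hv.supp h')
  · exact hb (by rw [Metric.mem_ball, Real.dist_eq, sub_zero, abs_of_pos h]; exact hy)

theorem IsTest.integrable {v : ℝ → ℂ} (hv : IsTest v) : Integrable v :=
  hv.smooth.continuous.integrable_of_hasCompactSupport hv.compact

/-- The function on the upper half-plane with symbol `h`: its Fourier transform in the first
variable is `h(ξ) e^{-ξ y}`. -/
def synth (h : ℝ → ℂ) (z : ℍ) : ℂ :=
  ((Real.sqrt (2 * Real.pi) : ℝ) : ℂ)⁻¹ * laplaceInt h z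

theorem sqrt_two_pi_ne_zero : ((Real.sqrt (2 * Real.pi) : ℝ) : ℂ) ≠ 0 :=
  Complex.ofReal_ne_zero.2 (Real.sqrt_ne_zero'.2 (by positivity))

theorem isHol_synth {h : ℝ → ℂ} (hh : IsLaplace h) : IsHol (synth h) := by
  refine ((hh.differentiableOn).const_mul ((Real.sqrt (2 * Real.pi) : ℝ) : ℂ)⁻¹).congr
    fun z hz => ?_
  rw [synth, UpperHalfPlane.ofComplex_apply_of_im_pos hz]

theorem aestronglyMeasurable_pt {f : ℍ → ℂ} (hf : IsHol f) :
    AEStronglyMeasurable (fun w : ℝ × ℝ => f (pt w.1 w.2))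
      ((volume : Measure ℝ).prod (volume.restrict (Ioi 0))) := by
  have h := (continuousOn_pt hf).aestronglyMeasurable (μ := (volume : Measure (ℝ × ℝ)))
    (isOpen_lt continuous_const continuous_snd).measurableSet
  have e : (volume : Measure ℝ).prod (volume.restrict (Ioi 0)) =
      (volume : Measure (ℝ × ℝ)).restrict {w | 0 < w.2} := by
    have h1 : {w : ℝ × ℝ | 0 < w.2} = univ ×ˢ Ioi 0 := by
      ext w
      simp
    rw [h1, Measure.volume_eq_prod, ← Measure.prod_restrict, Measure.restrict_univ]
  rwa [e]

theorem ae_prod_restrict_Ioi (m : Measure ℝ) [SFinite m] :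
    ∀ᵐ s ∂(m.prod (volume.restrict (Ioi (0 : ℝ)))), 0 < s.2 :=
  Measure.quasiMeasurePreserving_snd.ae (ae_restrict_mem measurableSet_Ioi)

theorem integrable_laplace_pairing {h : ℝ → ℂ} (hh : IsLaplace h) (u : 𝓢(ℝ, ℂ)) {v : ℝ → ℂ}
    (hv : IsTest v) :
    Integrable (fun s : ℝ × ℝ => h s.2 * expFn s.2 s.1 * u s.2 * v s.1)
      ((volume.restrict (Ioi 0)).prod (volume.restrict (Ioi 0))) := by
  obtain ⟨δ, hδ, hvδ⟩ := hv.exists_pos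
  have h1 : Integrable (fun s : ℝ × ℝ => v s.1 * (h s.2 * expFn s.2 δ * u s.2))
      ((volume.restrict (Ioi 0)).prod (volume.restrict (Ioi 0))) := by
    have h0 : Integrable (fun ξ => h ξ * expFn ξ δ * u ξ) (volume.restrict (Ioi 0)) :=
      Integrable.mul_bdd (c := SchwartzMap.seminorm ℂ 0 0 u) (hh.integrableOn δ hδ)
        u.continuous.aestronglyMeasurable
        (ae_of_all _ fun ξ => SchwartzMap.norm_le_seminorm ℂ u ξ)
    exact hv.integrable.restrict.mul_prod h0
  refine Integrable.mono h1 ?_ ?_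
  · have m1 : AEStronglyMeasurable (fun s : ℝ × ℝ => h s.2)
        ((volume.restrict (Ioi 0)).prod (volume.restrict (Ioi 0))) :=
      hh.aestronglyMeasurable.comp_snd
    have m2 : Continuous fun s : ℝ × ℝ => expFn s.2 s.1 := continuous_expFn.comp continuous_swap
    have m3 : Continuous fun s : ℝ × ℝ => u s.2 := u.continuous.comp continuous_snd
    have m4 : Continuous fun s : ℝ × ℝ => v s.1 := hv.smooth.continuous.comp continuous_fst
    exact ((m1.mul m2.aestronglyMeasurable).mul m3.aestronglyMeasurable).mul
      m4.aestronglyMeasurable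
  · filter_upwards [ae_prod_restrict_Ioi (volume.restrict (Ioi 0))]
    rintro ⟨y, ξ⟩ hξ0
    simp only at hξ0
    simp only [norm_mul, norm_expFn]
    rcases lt_or_ge y δ with hyδ | hyδ
    · simp [hvδ y hyδ]
    · have : Real.exp (-(ξ * y)) ≤ Real.exp (-(ξ * δ)) := Real.exp_le_exp.2 (by nlinarith)
      calc ‖h ξ‖ * Real.exp (-(ξ * y)) * ‖u ξ‖ * ‖v y‖
          ≤ ‖h ξ‖ * Real.exp (-(ξ * δ)) * ‖u ξ‖ * ‖v y‖ := by gcongr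
        _ = _ := by ring

/-- The Fourier–Laplace integral with symbol `h` has the expected Fourier transform in the first
variable, provided that the latter is in the mixed norm space. -/
theorem isPartialFourier_synth [Fact (1 ≤ p)] (hl : -1 < lam) (hp : p ≠ ⊤)
    {h : ℝ → ℂ} (hh : IsLaplace h) {φ : MixedLp lam p q}
    (hφ : φ =ᵐ[volume] fun ξ => h ξ • expLp lam p ξ) : IsPartialFourier (synth h) φ := by
  intro u v hv
  obtain ⟨w, hw⟩ := exists_schwartz_fourierR u
  obtain ⟨δ, hδ, hvδ⟩ := hv.exists_pos
  obtain ⟨ℓ, hℓ⟩ := exists_pairing (p := p) (lam := lam) hl hv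
  set c := ((Real.sqrt (2 * Real.pi) : ℝ) : ℂ)⁻¹ with hc
  -- On the support of `v` the height is at least `δ`, so the Fourier–Laplace integral is bounded.
  have hint : Integrable (fun s : ℝ × ℝ => synth h (pt s.1 s.2) * (fourierR u s.1 * v s.2))
      ((volume : Measure ℝ).prod (volume.restrict (Ioi 0))) := by
    have h1 : Integrable (fun s : ℝ × ℝ =>
        ((‖c‖ * ∫ ξ in Ioi (0 : ℝ), ‖h ξ * expFn ξ δ‖ : ℝ) : ℂ) * (w s.1 * v s.2))
        ((volume : Measure ℝ).prod (volume.restrict (Ioi 0))) :=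
      (w.integrable.mul_prod hv.integrable.restrict).const_mul _
    simp only [hw]
    refine Integrable.mono h1 ((aestronglyMeasurable_pt (isHol_synth hh)).mul ?_) ?_
    · exact ((w.continuous.comp continuous_fst).mul
        (hv.smooth.continuous.comp continuous_snd)).aestronglyMeasurable
    · filter_upwards [ae_prod_restrict_Ioi volume]
      rintro ⟨x, y⟩ hy0
      simp only at hy0
      rw [norm_mul, norm_mul (((_ : ℝ) : ℂ))]
      rcases lt_or_ge y δ with hyδ | hyδ
      · simp [hvδ y hyδ]
      · gcongr
        rw [synth, norm_mul, Complex.norm_real, Real.norm_of_nonneg (by positivity), coe_pt x hy0]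
        gcongr
        exact hh.norm_laplaceInt_le_of_le (z := x + y * Complex.I) hδ (by simpa using hyδ)
  refine ⟨hint, ?_⟩
  rw [integral_prod_symm _ hint]
  have e1 : ∀ y ∈ Ioi (0 : ℝ), ∫ x : ℝ, synth h (pt x y) * (fourierR u x * v y) =
      ∫ ξ in Ioi (0 : ℝ), h ξ * expFn ξ y * u ξ * v y := by
    intro y hy
    have hy0 : 0 < y := hy
    have h2 := hh.integral_fourierR_mul u hy0
    have h3 : ∀ x : ℝ, synth h (pt x y) * (fourierR u x * v y) =
        c * v y * (fourierR u x * laplaceInt h (x + y * Complex.I)) := by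
      intro x
      rw [synth, coe_pt x hy0]
      ring
    simp only [h3]
    rw [integral_const_mul, h2, integral_mul_const, hc]
    field_simp [sqrt_two_pi_ne_zero]
  rw [setIntegral_congr_fun measurableSet_Ioi e1,
    integral_integral_swap (integrable_laplace_pairing hh u hv)]
  have e2 : ∫ ξ : ℝ, (∫ y in Ioi (0 : ℝ), (φ ξ : ℝ → ℂ) y * v y) * u ξ =
      ∫ ξ : ℝ, h ξ * ℓ (expLp lam p ξ) * u ξ := by
    refine integral_congr_ae ?_
    filter_upwards [hφ] with ξ hξ
    rw [← hℓ, hξ, map_smul, smul_eq_mul]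
  have e3 : ∫ ξ in Ioi (0 : ℝ), h ξ * ℓ (expLp lam p ξ) * u ξ =
      ∫ ξ : ℝ, h ξ * ℓ (expLp lam p ξ) * u ξ := by
    refine setIntegral_eq_integral_of_forall_compl_eq_zero fun ξ hξ => ?_
    rw [expLp_of_nonpos hl hp (not_lt.1 hξ)]
    simp
  rw [e2, ← e3]
  refine setIntegral_congr_fun measurableSet_Ioi fun ξ hξ => ?_
  have e4 : ℓ (expLp lam p ξ) = ∫ y in Ioi (0 : ℝ), expFn ξ y * v y := by
    rw [hℓ]
    refine integral_congr_ae ?_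
    have := coeFn_expLp (p := p) hl hp (show 0 < ξ from hξ)
    rw [Filter.EventuallyEq, ae_nu hl] at this
    filter_upwards [this] with y hy
    rw [hy]
  rw [e4, mul_right_comm, ← integral_const_mul]
  refine integral_congr_ae (ae_of_all _ fun y => ?_)
  simp only
  ring

end Synthesis

/-! ### Analysis: the Fourier transform of a holomorphic function is a multiple of `e^{-ξ y}` -/

section CauchyRiemann

variable {lam : ℝ} {p q : ℝ≥0∞}

theorem IsTest.isTest_deriv {v : ℝ → ℂ} (hv : IsTest v) : IsTest (deriv v) :=
  ⟨(contDiff_infty_iff_deriv.1 hv.smooth).2, hv.compact.deriv,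
    (closure_minimal support_deriv_subset (isClosed_tsupport v)).trans hv.supp⟩

theorem IsTest.setIntegral_Ioi {v : ℝ → ℂ} (hv : IsTest v) (g : ℝ → ℂ) :
    ∫ y in Ioi (0 : ℝ), g y * v y = ∫ y, g y * v y := by
  obtain ⟨δ, hδ, hvδ⟩ := hv.exists_pos
  refine setIntegral_eq_integral_of_forall_compl_eq_zero fun y hy => ?_
  rw [hvδ y ((not_lt.1 hy).trans_lt hδ), mul_zero]

theorem integrable_mul_of_compact {g : ℝ × ℝ → ℂ} (hg : ContinuousOn g {s | 0 < s.2})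
    {w v : ℝ → ℂ} (hw : Continuous w) (hwc : HasCompactSupport w) (hv : IsTest v) :
    Integrable (fun s : ℝ × ℝ => g s * (w s.1 * v s.2))
      ((volume : Measure ℝ).prod (volume.restrict (Ioi 0))) := by
  have hK : IsCompact (tsupport w ×ˢ tsupport v) := hwc.isCompact.prod hv.compact.isCompact
  have h1 : IntegrableOn (fun s : ℝ × ℝ => g s * (w s.1 * v s.2)) (tsupport w ×ˢ tsupport v)
      (volume.prod volume) := by
    refine ContinuousOn.integrableOn_compact hK ?_
    refine (hg.mono fun s hs => hv.supp hs.2).mul ?_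
    exact ((hw.comp continuous_fst).mul (hv.smooth.continuous.comp continuous_snd)).continuousOn
  rw [integrableOn_iff_integrable_of_support_subset] at h1
  · have e : (volume : Measure ℝ).prod (volume.restrict (Ioi (0 : ℝ))) =
        ((volume : Measure ℝ).prod volume).restrict (univ ×ˢ Ioi 0) := by
      rw [← Measure.prod_restrict, Measure.restrict_univ]
    rw [e]
    exact h1.integrableOn
  · intro s hs
    simp only [Function.mem_support, ne_eq, mul_eq_zero, not_or] at hs
    exact ⟨subset_tsupport _ hs.2.1, subset_tsupport _ hs.2.2⟩

theorem continuous_mul_of_tsupport_subset {g v : ℝ → ℂ} (hv : Continuous v)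
    (hg : ∀ y ∈ tsupport v, ContinuousAt g y) : Continuous fun y => g y * v y := by
  rw [continuous_iff_continuousAt]
  intro y
  by_cases hy : y ∈ tsupport v
  · exact (hg y hy).mul hv.continuousAt
  · have h0 : (fun y => g y * v y) =ᶠ[nhds y] fun _ => 0 := by
      filter_upwards [(isClosed_tsupport v).isOpen_compl.mem_nhds hy] with z hz
      rw [image_eq_zero_of_notMem_tsupport hz, mul_zero]
    exact continuousAt_const.congr h0.symm

/-- Integration by parts against a compactly supported function, needing regularity of the other
factor only on the support. -/
theorem integral_mul_deriv_of_tsupport {g g' v : ℝ → ℂ} (hv : ContDiff ℝ ∞ v)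
    (hc : HasCompactSupport v) (hg : ∀ y ∈ tsupport v, HasDerivAt g (g' y) y)
    (hg' : ∀ y ∈ tsupport v, ContinuousAt g' y) :
    ∫ y, g y * deriv v y = - ∫ y, g' y * v y := by
  have hd : ∀ y, HasDerivAt v (deriv v y) y := fun y =>
    (hv.differentiable (by simp) y).hasDerivAt
  have hsub : tsupport (deriv v) ⊆ tsupport v :=
    closure_minimal support_deriv_subset (isClosed_tsupport v)
  have hv' : Continuous (deriv v) := (contDiff_infty_iff_deriv.1 hv).2.continuous
  have c1 : Continuous fun y => g y * deriv v y :=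
    continuous_mul_of_tsupport_subset hv' fun y hy => (hg y (hsub hy)).continuousAt
  have c2 : Continuous fun y => g' y * v y :=
    continuous_mul_of_tsupport_subset hv.continuous hg'
  have c3 : Continuous fun y => g y * v y :=
    continuous_mul_of_tsupport_subset hv.continuous fun y hy => (hg y hy).continuousAt
  have i1 := c1.integrable_of_hasCompactSupport (μ := volume) hc.deriv.mul_left
  have i2 := c2.integrable_of_hasCompactSupport (μ := volume) hc.mul_left
  have i3 := c3.integrable_of_hasCompactSupport (μ := volume) hc.mul_left
  have hder : ∀ y, HasDerivAt (fun y => g y * v y) (g' y * v y + g y * deriv v y) y := by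
    intro y
    by_cases hy : y ∈ tsupport v
    · exact (hg y hy).mul (hd y)
    · have hy' : y ∉ tsupport (deriv v) := fun h => hy (hsub h)
      rw [image_eq_zero_of_notMem_tsupport hy, image_eq_zero_of_notMem_tsupport hy', mul_zero,
        mul_zero, add_zero]
      have h0 : (fun y => g y * v y) =ᶠ[nhds y] fun _ => 0 := by
        filter_upwards [(isClosed_tsupport v).isOpen_compl.mem_nhds hy] with z hz
        rw [image_eq_zero_of_notMem_tsupport hz, mul_zero]
      exact (hasDerivAt_const y (0 : ℂ)).congr_of_eventuallyEq h0
  have h := integral_eq_zero_of_hasDerivAt_of_integrable hder (i2.add i1) i3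
  rw [integral_add i2 i1] at h
  exact eq_neg_of_add_eq_zero_right h

/-- The Cauchy–Riemann equation in the weak form, for test functions with compact support. -/
theorem IsHol.integral_dbar_of_compact {f : ℍ → ℂ} (hf : IsHol f) {w v : ℝ → ℂ}
    (hw : ContDiff ℝ ∞ w) (hwc : HasCompactSupport w) (hv : IsTest v) :
    ∫ s : ℝ × ℝ, f (pt s.1 s.2) *
        (deriv w s.1 * v s.2 + Complex.I * (w s.1 * deriv v s.2))
      ∂((volume : Measure ℝ).prod (volume.restrict (Ioi 0))) = 0 := by
  set g : ℂ → ℂ := fun z => f (UpperHalfPlane.ofComplex z) with hg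
  have hopen : IsOpen {z : ℂ | 0 < z.im} := isOpen_lt continuous_const Complex.continuous_im
  have hgd : ∀ z : ℂ, 0 < z.im → HasDerivAt g (deriv g z) z := fun z hz =>
    ((hf z hz).differentiableAt (hopen.mem_nhds hz)).hasDerivAt
  have hgc : ContinuousOn (deriv g) {z : ℂ | 0 < z.im} :=
    (DifferentiableOn.deriv hf hopen).continuousOn
  have hgc' : ∀ z : ℂ, 0 < z.im → ContinuousAt (deriv g) z := fun z hz =>
    hgc.continuousAt (hopen.mem_nhds hz)
  set F : ℝ × ℝ → ℂ := fun s => f (pt s.1 s.2) with hF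
  set F' : ℝ × ℝ → ℂ := fun s => deriv g ((s.1 : ℂ) + (s.2 : ℂ) * Complex.I) with hF'
  have hFc : ContinuousOn F {s | 0 < s.2} := continuousOn_pt hf
  have hFc' : ContinuousOn F' {s | 0 < s.2} := by
    refine ContinuousOn.comp (g := deriv g)
      (f := fun w : ℝ × ℝ => (w.1 : ℂ) + (w.2 : ℂ) * Complex.I) hgc (by fun_prop) ?_
    intro w hw
    simpa using hw
  have hw' : Continuous (deriv w) := (contDiff_infty_iff_deriv.1 hw).2.continuous
  have i1 := integrable_mul_of_compact hFc hw' hwc.deriv hv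
  have i2 := integrable_mul_of_compact hFc hw.continuous hwc hv.isTest_deriv
  have i3 := integrable_mul_of_compact hFc' hw.continuous hwc hv
  -- Integration by parts in `x` and in `y` gives the same integral of `F' = ∂_x F`, up to the
  -- factor `i` from `∂_y F = i F'`.
  have e1 : ∫ s : ℝ × ℝ, F s * (deriv w s.1 * v s.2)
        ∂((volume : Measure ℝ).prod (volume.restrict (Ioi 0))) =
      - ∫ s : ℝ × ℝ, F' s * (w s.1 * v s.2)
        ∂((volume : Measure ℝ).prod (volume.restrict (Ioi 0))) := by
    rw [integral_prod_symm _ i1, integral_prod_symm _ i3, ← integral_neg]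
    refine setIntegral_congr_fun measurableSet_Ioi fun y hy => ?_
    have hy0 : 0 < y := hy
    simp only [← mul_assoc, integral_mul_const]
    rw [integral_mul_deriv_of_tsupport (g' := fun x => F' (x, y)) hw hwc, neg_mul]
    · intro x _
      have h1 : HasDerivAt (fun x : ℝ => (x : ℂ) + (y : ℂ) * Complex.I) 1 x :=
        (Complex.ofRealCLM.hasDerivAt (x := x)).add_const _
      have h2 := (hgd (x + y * Complex.I) (by simpa using hy0)).comp x h1
      simpa [hF', hF, pt, hg, Function.comp_def] using h2
    · intro x _
      refine (hgc' (x + y * Complex.I) (by simpa using hy0)).comp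
        (f := fun x : ℝ => (x : ℂ) + (y : ℂ) * Complex.I) ?_
      fun_prop
  have e2 : ∫ s : ℝ × ℝ, F s * (w s.1 * deriv v s.2)
        ∂((volume : Measure ℝ).prod (volume.restrict (Ioi 0))) =
      - (Complex.I * ∫ s : ℝ × ℝ, F' s * (w s.1 * v s.2)
        ∂((volume : Measure ℝ).prod (volume.restrict (Ioi 0)))) := by
    rw [integral_prod _ i2, integral_prod _ i3, ← integral_const_mul, ← integral_neg]
    refine integral_congr_ae (ae_of_all _ fun x => ?_)
    have a1 : ∀ y, F (x, y) * (w x * deriv v y) = w x * (F (x, y) * deriv v y) :=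
      fun y => by ring
    have a2 : ∀ y, F' (x, y) * (w x * v y) = w x * (F' (x, y) * v y) := fun y => by ring
    simp only [a1, a2, integral_const_mul]
    rw [hv.isTest_deriv.setIntegral_Ioi (fun y => F (x, y)),
      hv.setIntegral_Ioi (fun y => F' (x, y)),
      integral_mul_deriv_of_tsupport (g' := fun y => Complex.I * F' (x, y)) hv.smooth hv.compact]
    · simp only [mul_assoc, integral_const_mul]
      ring
    · intro y hy
      have hy0 : 0 < y := hv.supp hy
      have h1 : HasDerivAt (fun y : ℝ => (x : ℂ) + (y : ℂ) * Complex.I) Complex.I y := by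
        simpa using ((Complex.ofRealCLM.hasDerivAt (x := y)).mul_const Complex.I).const_add (x : ℂ)
      have h2 := (hgd (x + y * Complex.I) (by simpa using hy0)).comp y h1
      simpa [hF', hF, pt, hg, Function.comp_def, mul_comm] using h2
    · intro y hy
      have hy0 : 0 < y := hv.supp hy
      refine continuousAt_const.mul ((hgc' (x + y * Complex.I) (by simpa using hy0)).comp
        (f := fun y : ℝ => (x : ℂ) + (y : ℂ) * Complex.I) ?_)
      fun_prop
  have e3 : ∀ s : ℝ × ℝ, f (pt s.1 s.2) *
        (deriv w s.1 * v s.2 + Complex.I * (w s.1 * deriv v s.2)) =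
      F s * (deriv w s.1 * v s.2) + Complex.I * (F s * (w s.1 * deriv v s.2)) := by
    intro s
    simp only [hF]
    ring
  simp only [e3]
  rw [integral_add i1 (i2.const_mul _), integral_const_mul, e1, e2]
  ring_nf
  rw [Complex.I_sq]
  ring

/-- The Cauchy–Riemann equation in the weak form, for products of a Schwartz function in `x` and a
test function in `y`. -/
theorem IsHol.integral_dbar [Fact (1 ≤ p)] {f : ℍ → ℂ} (hf : IsHol f) {φ : MixedLp lam p q}
    (hφ : IsPartialFourier f φ) (w : 𝓢(ℝ, ℂ)) {v : ℝ → ℂ} (hv : IsTest v) :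
    ∫ s : ℝ × ℝ, f (pt s.1 s.2) *
        (deriv w s.1 * v s.2 + Complex.I * (w s.1 * deriv v s.2))
      ∂((volume : Measure ℝ).prod (volume.restrict (Ioi 0))) = 0 := by
  have hi : ∀ (w : 𝓢(ℝ, ℂ)) {v : ℝ → ℂ}, IsTest v →
      Integrable (fun s : ℝ × ℝ => f (pt s.1 s.2) * (w s.1 * v s.2))
        ((volume : Measure ℝ).prod (volume.restrict (Ioi 0))) := by
    intro w v hv
    obtain ⟨u, hu⟩ := exists_fourierR_eq w
    simpa only [hu] using (hφ u v hv).1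
  have j1 := hi (SchwartzMap.derivCLM ℂ ℂ w) hv
  simp only [SchwartzMap.derivCLM_apply] at j1
  have j2 := hi w hv.isTest_deriv
  have j3 := hi w hv
  let b : ContDiffBump (0 : ℝ) := ⟨1, 2, by norm_num, by norm_num⟩
  set χ : ℝ → ℂ := fun x => (b x : ℂ) with hχ
  have hχs : ContDiff ℝ ∞ χ := Complex.ofRealCLM.contDiff.comp b.contDiff
  have hχc : HasCompactSupport χ := b.hasCompactSupport.comp_left Complex.ofReal_zero
  have hχ1 : ∀ x, ‖χ x‖ ≤ 1 := fun x => by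
    rw [hχ, Complex.norm_real, Real.norm_of_nonneg b.nonneg]
    exact b.le_one
  have hχ'c : Continuous (deriv χ) := (contDiff_infty_iff_deriv.1 hχs).2.continuous
  obtain ⟨C, hC⟩ := hχ'c.bounded_above_of_compact_support hχc.deriv
  have hC0 : 0 ≤ C := (norm_nonneg _).trans (hC 0)
  have hχd : ∀ x, HasDerivAt χ (deriv χ x) x := fun x =>
    (hχs.differentiable (by simp) x).hasDerivAt
  -- The Schwartz function is cut off to `χ(r x) w(x)` with `r = 1 / (n + 1)`; the extra term in the
  -- derivative carries a factor `r`.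
  set r : ℕ → ℝ := fun n => ((n : ℝ) + 1)⁻¹ with hr
  have hr0 : ∀ n, 0 < r n := fun n => by positivity
  have hr1 : ∀ n, r n ≤ 1 := fun n => inv_le_one_of_one_le₀ (by
    have : (0 : ℝ) ≤ n := n.cast_nonneg
    linarith)
  have hrt : Filter.Tendsto r Filter.atTop (nhds 0) := by
    simpa [hr, one_div] using tendsto_one_div_add_atTop_nhds_zero_nat (𝕜 := ℝ)
  have hd : ∀ n x, HasDerivAt (fun x => χ (r n * x) * w x)
      (r n * deriv χ (r n * x) * w x + χ (r n * x) * deriv w x) x := by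
    intro n x
    have h1 : HasDerivAt (fun x : ℝ => r n * x) (r n) x := by
      simpa using (hasDerivAt_id x).const_mul (r n)
    have h2 := (hχd (r n * x)).scomp x h1
    have h3 : HasDerivAt (fun x => χ (r n * x) * w x) _ x := h2.mul (w.hasDerivAt x)
    convert h3 using 1
    simp
  have key : ∀ n : ℕ, ∫ s : ℝ × ℝ, (f (pt s.1 s.2) *
        (deriv w s.1 * v s.2 + Complex.I * (w s.1 * deriv v s.2))) * χ (r n * s.1) +
        (f (pt s.1 s.2) * (w s.1 * v s.2)) * (r n * deriv χ (r n * s.1))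
      ∂((volume : Measure ℝ).prod (volume.restrict (Ioi 0))) = 0 := by
    intro n
    have hs : ContDiff ℝ ∞ fun x => χ (r n * x) * w x :=
      (hχs.comp (contDiff_const.mul contDiff_id)).mul (w.smooth ⊤)
    have hsc : HasCompactSupport fun x => χ (r n * x) * w x :=
      (hχc.comp_homeomorph (Homeomorph.mulLeft₀ (r n) (hr0 n).ne')).mul_right
    rw [← hf.integral_dbar_of_compact hs hsc hv]
    refine integral_congr_ae (ae_of_all _ fun s => ?_)
    simp only [(hd n s.1).deriv]
    ring
  have hlim := tendsto_integral_of_dominated_convergence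
    (μ := (volume : Measure ℝ).prod (volume.restrict (Ioi 0)))
    (F := fun n (s : ℝ × ℝ) => (f (pt s.1 s.2) *
        (deriv w s.1 * v s.2 + Complex.I * (w s.1 * deriv v s.2))) * χ (r n * s.1) +
        (f (pt s.1 s.2) * (w s.1 * v s.2)) * (r n * deriv χ (r n * s.1)))
    (f := fun s => f (pt s.1 s.2) *
        (deriv w s.1 * v s.2 + Complex.I * (w s.1 * deriv v s.2)))
    (fun s => ‖f (pt s.1 s.2) *
        (deriv w s.1 * v s.2 + Complex.I * (w s.1 * deriv v s.2))‖ +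
        ‖f (pt s.1 s.2) * (w s.1 * v s.2)‖ * C) ?_ ?_ ?_ ?_
  · simp only [key] at hlim
    exact (tendsto_nhds_unique hlim tendsto_const_nhds)
  · intro n
    have e3 : ∀ s : ℝ × ℝ, f (pt s.1 s.2) *
        (deriv w s.1 * v s.2 + Complex.I * (w s.1 * deriv v s.2)) =
      f (pt s.1 s.2) * (deriv w s.1 * v s.2) +
        Complex.I * (f (pt s.1 s.2) * (w s.1 * deriv v s.2)) := fun s => by ring
    simp only [e3]
    have m1 : Continuous fun s : ℝ × ℝ => χ (r n * s.1) := hχs.continuous.comp (by fun_prop)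
    have m2 : Continuous fun s : ℝ × ℝ => (r n : ℂ) * deriv χ (r n * s.1) :=
      continuous_const.mul (hχ'c.comp (by fun_prop))
    exact ((j1.add (j2.const_mul _)).aestronglyMeasurable.mul m1.aestronglyMeasurable).add
      (j3.aestronglyMeasurable.mul m2.aestronglyMeasurable)
  · have e3 : ∀ s : ℝ × ℝ, f (pt s.1 s.2) *
        (deriv w s.1 * v s.2 + Complex.I * (w s.1 * deriv v s.2)) =
      f (pt s.1 s.2) * (deriv w s.1 * v s.2) +
        Complex.I * (f (pt s.1 s.2) * (w s.1 * deriv v s.2)) := fun s => by ring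
    simp only [e3]
    exact (j1.add (j2.const_mul _)).norm.add (j3.norm.mul_const C)
  · intro n
    refine ae_of_all _ fun s => (norm_add_le _ _).trans ?_
    rw [norm_mul _ (χ _), norm_mul _ ((r n : ℂ) * _)]
    gcongr
    · exact mul_le_of_le_one_right (norm_nonneg _) (hχ1 _)
    · rw [norm_mul, Complex.norm_real, Real.norm_of_nonneg (hr0 n).le]
      calc r n * ‖deriv χ (r n * s.1)‖ ≤ 1 * C := by
            gcongr
            · exact hr1 n
            · exact hC _
        _ = C := one_mul C
  · refine ae_of_all _ fun s => ?_
    have h0 : Filter.Tendsto (fun n => r n * s.1) Filter.atTop (nhds 0) := by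
      simpa using hrt.mul_const s.1
    have hχ0 : χ 0 = 1 := by
      have : b 0 = 1 := b.one_of_mem_closedBall (Metric.mem_closedBall_self (by norm_num))
      simp [hχ, this]
    have h1 : Filter.Tendsto (fun n => χ (r n * s.1)) Filter.atTop (nhds 1) := by
      rw [← hχ0]
      exact (hχs.continuous.tendsto 0).comp h0
    have h2 : Filter.Tendsto (fun n => deriv χ (r n * s.1)) Filter.atTop (nhds (deriv χ 0)) :=
      (hχ'c.tendsto 0).comp h0
    have h3 : Filter.Tendsto (fun n => (r n : ℂ)) Filter.atTop (nhds ((0 : ℝ) : ℂ)) :=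
      (Complex.continuous_ofReal.tendsto 0).comp hrt
    have h4 := (h1.const_mul (f (pt s.1 s.2) *
        (deriv w s.1 * v s.2 + Complex.I * (w s.1 * deriv v s.2)))).add
        ((h3.mul h2).const_mul (f (pt s.1 s.2) * (w s.1 * v s.2)))
    simpa using h4

end CauchyRiemann

section Analysis

variable {lam : ℝ} {p q : ℝ≥0∞}

theorem locallyIntegrableOn_vertLp [Fact (1 ≤ p)] (hl : -1 < lam) (g : VertLp lam p) :
    LocallyIntegrableOn (g : ℝ → ℂ) (Ioi 0) volume := by
  rw [locallyIntegrableOn_iff isOpen_Ioi.isLocallyClosed]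
  intro K hK0 hK
  have hfin : IsFiniteMeasure ((nu lam).restrict K) :=
    ⟨by simpa using nu_compact_lt_top hK hK0⟩
  have h1 : IntegrableOn (g : ℝ → ℂ) K (nu lam) := ((Lp.memLp g).restrict K).integrable Fact.out
  rw [← integrable_indicator_iff hK.measurableSet, integrable_nu_iff hl] at h1
  have h2 : IntegrableOn (fun y => (dens lam y)⁻¹ • (dens lam y • K.indicator g y)) K volume :=
    (h1.mono_set hK0).continuousOn_smul
      ((continuousOn_dens.mono hK0).inv₀ fun y hy => (dens_pos hl (hK0 hy)).ne') hK
  refine h2.congr_fun (fun y hy => ?_) hK.measurableSet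
  simp only [smul_smul, inv_mul_cancel₀ (dens_pos hl (hK0 hy)).ne', one_smul,
    indicator_of_mem hy]

/-- For almost every `ξ`, the function `φ(ξ)` is a weak solution of `∂_y φ(ξ) = - ξ φ(ξ)`; here the
exceptional null set depends on the test function. -/
theorem IsPartialFourier.ae_pairing_deriv [Fact (1 ≤ p)] [Fact (1 ≤ q)] (hl : -1 < lam)
    {f : ℍ → ℂ} (hf : IsHol f) {φ : MixedLp lam p q} (hφ : IsPartialFourier f φ) {v : ℝ → ℂ}
    (hv : IsTest v) :
    ∀ᵐ ξ : ℝ, ∫ y in Ioi (0 : ℝ), (φ ξ : ℝ → ℂ) y * deriv v y =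
      ξ * ∫ y in Ioi (0 : ℝ), (φ ξ : ℝ → ℂ) y * v y := by
  obtain ⟨ℓ, hℓ⟩ := exists_pairing (p := p) (lam := lam) hl hv
  obtain ⟨ℓ', hℓ'⟩ := exists_pairing (p := p) (lam := lam) hl hv.isTest_deriv
  have key : ∀ u : 𝓢(ℝ, ℂ), ∫ ξ : ℝ, (ℓ' (φ ξ) - ξ * ℓ (φ ξ)) * u ξ = 0 := by
    intro u
    obtain ⟨w, hw⟩ := exists_schwartz_fourierR u
    obtain ⟨u₂, hu₂⟩ := exists_fourierR_eq (SchwartzMap.derivCLM ℂ ℂ w)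
    simp only [SchwartzMap.derivCLM_apply] at hu₂
    -- `u₂` is the function with Fourier transform `(û)'`.
    have hmul : ∀ ξ, u₂ ξ = -(Complex.I * ξ * u ξ) := by
      intro ξ
      have h1 := integral_fourierR_mul_exp u₂ ξ
      have h2 := integral_fourierR_mul_exp u ξ
      simp only [hu₂, hw] at h1 h2
      have hd : ∀ x : ℝ, HasDerivAt (fun x : ℝ => w x * Complex.exp (Complex.I * ξ * x))
          (deriv w x * Complex.exp (Complex.I * ξ * x) +
            Complex.I * ξ * (w x * Complex.exp (Complex.I * ξ * x))) x := by
        intro x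
        have h3 : HasDerivAt (fun x : ℝ => Complex.I * ξ * (x : ℂ)) (Complex.I * ξ) x := by
          simpa using (Complex.ofRealCLM.hasDerivAt (x := x)).const_mul (Complex.I * (ξ : ℂ))
        have h4 : HasDerivAt (fun x : ℝ => w x * Complex.exp (Complex.I * ξ * x)) _ x :=
          (w.hasDerivAt x).mul h3.cexp
        convert h4 using 1
        ring
      have hexp : AEStronglyMeasurable (fun x : ℝ => Complex.exp (Complex.I * ξ * x)) volume := by
        fun_prop
      have i1 : Integrable (fun x : ℝ => w x * Complex.exp (Complex.I * ξ * x)) :=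
        w.integrable.mul_bdd (c := 1) hexp (ae_of_all _ fun x => (norm_exp_I_mul_real ξ x).le)
      have i2 : Integrable (fun x : ℝ => deriv w x * Complex.exp (Complex.I * ξ * x)) :=
        (SchwartzMap.derivCLM ℂ ℂ w).integrable.mul_bdd (c := 1) hexp
          (ae_of_all _ fun x => (norm_exp_I_mul_real ξ x).le)
      have h5 := integral_eq_zero_of_hasDerivAt_of_integrable hd (i2.add (i1.const_mul _)) i1
      rw [integral_add i2 (i1.const_mul _), integral_const_mul, h1, h2] at h5
      refine mul_left_cancel₀ sqrt_two_pi_ne_zero ?_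
      linear_combination h5
    obtain ⟨a1, a2⟩ := hφ u₂ v hv
    obtain ⟨b1, b2⟩ := hφ u (deriv v) hv.isTest_deriv
    have hcr := hf.integral_dbar hφ w hv
    simp only [hu₂] at a1 a2
    simp only [hw] at b1 b2
    have e3 : ∀ s : ℝ × ℝ, f (pt s.1 s.2) *
        (deriv w s.1 * v s.2 + Complex.I * (w s.1 * deriv v s.2)) =
      f (pt s.1 s.2) * (deriv w s.1 * v s.2) +
        Complex.I * (f (pt s.1 s.2) * (w s.1 * deriv v s.2)) := fun s => by ring
    simp only [e3] at hcr
    rw [integral_add a1 (b1.const_mul _), integral_const_mul, a2, b2, ← integral_const_mul,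
      ← integral_add (integrable_pairing hl hv φ u₂)
        ((integrable_pairing hl hv.isTest_deriv φ u).const_mul _)] at hcr
    have e4 : ∀ ξ : ℝ, (ℓ' (φ ξ) - ξ * ℓ (φ ξ)) * u ξ = -Complex.I *
        ((∫ y in Ioi (0 : ℝ), (φ ξ : ℝ → ℂ) y * v y) * u₂ ξ +
        Complex.I * ((∫ y in Ioi (0 : ℝ), (φ ξ : ℝ → ℂ) y * deriv v y) * u ξ)) := by
      intro ξ
      rw [hmul, hℓ, hℓ']
      ring_nf
      rw [Complex.I_sq]
      ring
    simp only [e4]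
    rw [integral_const_mul, hcr, mul_zero]
  have hl1 : LocallyIntegrable (fun ξ : ℝ => ℓ (φ ξ)) volume :=
    (ℓ.comp_memLp' (Lp.memLp φ)).locallyIntegrable Fact.out
  have hl2 : LocallyIntegrable (fun ξ : ℝ => ℓ' (φ ξ)) volume :=
    (ℓ'.comp_memLp' (Lp.memLp φ)).locallyIntegrable Fact.out
  have hl3 : LocallyIntegrable (fun ξ : ℝ => (ξ : ℂ) * ℓ (φ ξ)) volume := by
    simpa using LocallyIntegrable.continuous_smul Complex.continuous_ofReal hl1
  have h := ae_eq_zero_of_integral_contDiff_smul_eq_zero (hl2.sub hl3) (fun g hg hgc => ?_)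
  · filter_upwards [h] with ξ hξ
    rw [← hℓ, ← hℓ']
    exact sub_eq_zero.1 hξ
  · have hgC : HasCompactSupport fun ξ => (g ξ : ℂ) := hgc.comp_left Complex.ofReal_zero
    have hgS : ContDiff ℝ ∞ fun ξ => (g ξ : ℂ) := Complex.ofRealCLM.contDiff.comp hg
    obtain ⟨G, hG⟩ : ∃ G : 𝓢(ℝ, ℂ), ∀ ξ, G ξ = (g ξ : ℂ) :=
      ⟨hgC.toSchwartzMap hgS, fun _ => rfl⟩
    rw [← key G]
    refine integral_congr_ae (ae_of_all _ fun ξ => ?_)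
    simp only [hG, Pi.sub_apply, Complex.real_smul]
    ring

/-- Integration against an integrable function over a compact set is continuous for locally uniform
convergence. -/
theorem continuous_setIntegral_mul {g : ℝ → ℂ} {K : Set ℝ} (hK : IsCompact K)
    (hg : IntegrableOn g K) : Continuous fun k : C(ℝ, ℂ) => ∫ y in K, g y * k y := by
  rw [continuous_iff_continuousAt]
  intro k₀
  obtain ⟨M, hM⟩ := hK.exists_bound_of_continuousOn k₀.continuous.continuousOn
  refine continuousAt_of_dominated (bound := fun y => ‖g y‖ * (M + 1)) ?_ ?_ ?_ ?_
  · exact Filter.Eventually.of_forall fun k =>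
      hg.aestronglyMeasurable.mul k.continuous.aestronglyMeasurable
  · have hU : {k : C(ℝ, ℂ) | MapsTo k K (Metric.ball 0 (M + 1))} ∈ nhds k₀ := by
      refine (ContinuousMap.isOpen_setOfPred_mapsTo hK Metric.isOpen_ball).mem_nhds fun y hy => ?_
      rw [mem_ball_zero_iff]
      linarith [hM y hy]
    filter_upwards [hU] with k hk
    refine (ae_restrict_iff' hK.measurableSet).2 (ae_of_all _ fun y hy => ?_)
    rw [norm_mul]
    gcongr
    exact (mem_ball_zero_iff.1 (hk hy)).le
  · exact hg.norm.mul_const _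
  · exact ae_of_all _ fun y => continuousAt_const.mul
      (ContinuousEvalConst.continuous_eval_const y).continuousAt

/-- There are countably many test functions such that the weak equation `∂_y g = - ξ g` need only be
tested against them: the pairs `(v, v')` form a separable space, as `C(ℝ, ℂ)` is second
countable. -/
theorem exists_countable_tests [Fact (1 ≤ p)] (hl : -1 < lam) :
    ∃ D : Set (ℝ → ℂ), D.Countable ∧ (∀ v ∈ D, IsTest v) ∧
      ∀ (ξ : ℝ) (g : VertLp lam p),
        (∀ v ∈ D, ∫ y in Ioi (0 : ℝ), (g : ℝ → ℂ) y * deriv v y =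
          ξ * ∫ y in Ioi (0 : ℝ), (g : ℝ → ℂ) y * v y) →
        ∀ v, IsTest v → ∫ y in Ioi (0 : ℝ), (g : ℝ → ℂ) y * deriv v y =
          ξ * ∫ y in Ioi (0 : ℝ), (g : ℝ → ℂ) y * v y := by
  -- The test functions are sorted by their supports: for those supported in a fixed compact set,
  -- the equation is a closed condition on `(v, v')`.
  set K : ℕ → Set ℝ := fun n => Icc ((n : ℝ) + 1)⁻¹ (n + 1) with hK
  have hKc : ∀ n, IsCompact (K n) := fun n => isCompact_Icc
  have hK0 : ∀ n, K n ⊆ Ioi 0 := fun n y hy =>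
    (show (0 : ℝ) < ((n : ℝ) + 1)⁻¹ by positivity).trans_le hy.1
  let S : ℕ → Set (ℝ → ℂ) := fun n => {v | IsTest v ∧ tsupport v ⊆ K n}
  let j : ∀ n, S n → C(ℝ, ℂ) × C(ℝ, ℂ) := fun n v =>
    (⟨v.1, v.2.1.smooth.continuous⟩, ⟨deriv v.1, v.2.1.isTest_deriv.smooth.continuous⟩)
  have hsep : ∀ n, ∃ D : Set (S n), D.Countable ∧ range (j n) ⊆ closure (j n '' D) := by
    intro n
    obtain ⟨t, ht, hd⟩ := TopologicalSpace.exists_countable_dense (range (j n))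
    choose pre hpre using fun x : range (j n) => x.2
    refine ⟨pre '' t, ht.image _, ?_⟩
    have e : j n '' (pre '' t) = Subtype.val '' t := by
      rw [image_image]
      exact image_congr fun x _ => hpre x
    rw [e]
    exact fun x hx => closure_subtype.1 (hd ⟨x, hx⟩)
  choose D hDc hD using hsep
  refine ⟨⋃ n, Subtype.val '' D n, countable_iUnion fun n => (hDc n).image _, ?_, ?_⟩
  · intro v hv
    obtain ⟨n, w, -, rfl⟩ := mem_iUnion.1 hv
    exact w.2.1
  · intro ξ g hg v hv
    obtain ⟨n, hn⟩ : ∃ n, tsupport v ⊆ K n := by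
      obtain ⟨δ, hδ, hvδ⟩ := hv.exists_pos
      obtain ⟨R, hR⟩ := hv.compact.isCompact.isBounded.subset_closedBall 0
      obtain ⟨n, hn⟩ := exists_nat_ge (max R δ⁻¹)
      refine ⟨n, fun y hy => ⟨?_, ?_⟩⟩
      · have h1 : δ ≤ y := by
          have : closure (Function.support v) ⊆ Ici δ :=
            closure_minimal (fun z hz => not_lt.1 fun h => hz (hvδ z h)) isClosed_Ici
          exact this hy
        refine le_trans ?_ h1
        rw [inv_le_comm₀ (by positivity) hδ]
        linarith [le_max_right R δ⁻¹]
      · have h1 := hR hy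
        rw [mem_closedBall_zero_iff, Real.norm_eq_abs] at h1
        linarith [le_abs_self y, le_max_left R δ⁻¹]
    have hgi : IntegrableOn (g : ℝ → ℂ) (K n) :=
      (locallyIntegrableOn_iff isOpen_Ioi.isLocallyClosed).1
        (locallyIntegrableOn_vertLp hl g) (K n) (hK0 n) (hKc n)
    have hset : ∀ k : ℝ → ℂ, tsupport k ⊆ K n →
        ∫ y in Ioi (0 : ℝ), (g : ℝ → ℂ) y * k y = ∫ y in K n, (g : ℝ → ℂ) y * k y := by
      intro k hk
      refine setIntegral_eq_of_subset_of_forall_sdiff_eq_zero measurableSet_Ioi (hK0 n)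
        fun y hy => ?_
      rw [image_eq_zero_of_notMem_tsupport fun h => hy.2 (hk h), mul_zero]
    have hsub : ∀ w : ℝ → ℂ, tsupport w ⊆ K n → tsupport (deriv w) ⊆ K n := fun w hw =>
      (closure_minimal support_deriv_subset (isClosed_tsupport w)).trans hw
    set Z : Set (C(ℝ, ℂ) × C(ℝ, ℂ)) := {k | ∫ y in K n, (g : ℝ → ℂ) y * k.2 y =
      ξ * ∫ y in K n, (g : ℝ → ℂ) y * k.1 y} with hZ
    have hZc : IsClosed Z := by
      refine isClosed_eq ?_ ?_
      · exact (continuous_setIntegral_mul (hKc n) hgi).comp continuous_snd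
      · exact continuous_const.mul ((continuous_setIntegral_mul (hKc n) hgi).comp continuous_fst)
    have hDZ : j n '' D n ⊆ Z := by
      rintro _ ⟨w, hw, rfl⟩
      have h1 := hg w.1 (mem_iUnion.2 ⟨n, w, hw, rfl⟩)
      rwa [hset _ w.2.2, hset _ (hsub _ w.2.2)] at h1
    have h2 : j n ⟨v, hv, hn⟩ ∈ Z := closure_minimal hDZ hZc (hD n ⟨_, rfl⟩)
    rw [hset _ hn, hset _ (hsub _ hn)]
    exact h2

theorem integrableOn_mul_test {g : ℝ → ℂ} (hg : LocallyIntegrableOn g (Ioi 0)) {v : ℝ → ℂ}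
    (hv : IsTest v) : IntegrableOn (fun y => g y * v y) (Ioi 0) := by
  have hK := hv.compact.isCompact
  have h1 : IntegrableOn g (tsupport v) :=
    (locallyIntegrableOn_iff isOpen_Ioi.isLocallyClosed).1 hg _ hv.supp hK
  have h2 : IntegrableOn (fun y => g y * v y) (tsupport v) :=
    IntegrableOn.mul_continuousOn h1 hv.smooth.continuous.continuousOn hK
  rw [integrableOn_iff_integrable_of_support_subset] at h2
  · exact h2.integrableOn
  · intro y hy
    refine subset_tsupport _ fun h => hy ?_
    simp only [h, mul_zero]

theorem ae_eq_zero_of_forall_isTest {g : ℝ → ℂ} (hg : LocallyIntegrableOn g (Ioi 0))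
    (h : ∀ v, IsTest v → ∫ y in Ioi (0 : ℝ), g y * v y = 0) :
    ∀ᵐ y ∂(volume.restrict (Ioi (0 : ℝ))), g y = 0 := by
  rw [ae_restrict_iff' measurableSet_Ioi]
  refine isOpen_Ioi.ae_eq_zero_of_integral_contDiff_smul_eq_zero hg fun k hk hkc hks => ?_
  have hkt := ofReal_isTest hk hkc hks
  rw [← h _ hkt, hkt.setIntegral_Ioi]
  refine integral_congr_ae (ae_of_all _ fun y => ?_)
  simp [mul_comm]

theorem IsTest.add_smul {v w : ℝ → ℂ} (hv : IsTest v) (hw : IsTest w) (c : ℂ) :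
    IsTest fun y => v y + c * w y := by
  refine ⟨hv.smooth.add (contDiff_const.mul hw.smooth), ?_, ?_⟩
  · exact hv.compact.add hw.compact.mul_left
  · refine (closure_minimal ?_ ((isClosed_tsupport v).union (isClosed_tsupport w))).trans
      (union_subset hv.supp hw.supp)
    intro y hy
    by_contra h
    rw [mem_union, not_or] at h
    refine hy ?_
    simp only [image_eq_zero_of_notMem_tsupport h.1, image_eq_zero_of_notMem_tsupport h.2,
      mul_zero, add_zero]

theorem contDiff_expFn (ξ : ℝ) : ContDiff ℝ ∞ (expFn ξ) :=
  Complex.ofRealCLM.contDiff.comp (Real.contDiff_exp.comp (by fun_prop))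

theorem hasDerivAt_expFn (ξ y : ℝ) : HasDerivAt (expFn ξ) (-ξ * expFn ξ y) y := by
  have h1 : HasDerivAt (fun y : ℝ => -(ξ * y)) (-(ξ * 1)) y :=
    ((hasDerivAt_id y).const_mul ξ).neg
  have h2 : HasDerivAt (expFn ξ) _ y := h1.exp.ofReal_comp
  convert h2 using 1
  simp only [expFn]
  push_cast
  ring

/-- A test function orthogonal to `e^{-ξ y}` is of the form `v' - ξ v` for a test function `v`. -/
theorem IsTest.exists_deriv_sub {k : ℝ → ℂ} (hk : IsTest k) {ξ : ℝ}
    (h0 : ∫ y in Ioi (0 : ℝ), expFn ξ y * k y = 0) :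
    ∃ v, IsTest v ∧ ∀ y, deriv v y = ξ * v y + k y := by
  obtain ⟨δ, hδ, hkδ⟩ := hk.exists_pos
  obtain ⟨R, hR⟩ := hk.compact.isCompact.isBounded.subset_closedBall 0
  have hkR : ∀ y, R < y → k y = 0 := by
    intro y hy
    refine image_eq_zero_of_notMem_tsupport fun h => ?_
    have := hR h
    rw [mem_closedBall_zero_iff, Real.norm_eq_abs] at this
    linarith [le_abs_self y]
  set e : ℝ → ℂ := fun y => expFn ξ y * k y with he
  have hec : Continuous e := (continuous_expFn_right ξ).mul hk.smooth.continuous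
  -- The solution `v = e^{ξ y} ∫₀^y e^{-ξ t} k(t) dt` vanishes to the right of the support of `k`
  -- because of the orthogonality.
  set F : ℝ → ℂ := fun y => ∫ t in (0 : ℝ)..y, e t with hF
  have hFd : ∀ y, HasDerivAt F (e y) y := fun y => hec.integral_hasStrictDerivAt 0 y |>.hasDerivAt
  have hFs : ContDiff ℝ ∞ F := by
    rw [contDiff_infty_iff_deriv]
    refine ⟨fun y => (hFd y).differentiableAt, ?_⟩
    have : deriv F = e := funext fun y => (hFd y).deriv
    rw [this]
    exact (contDiff_expFn ξ).mul hk.smooth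
  have hFδ : ∀ y < δ, F y = 0 := by
    intro y hy
    refine intervalIntegral.integral_zero_ae (ae_of_all _ fun t ht => ?_)
    have : t < δ := by
      rcases le_total 0 y with h | h
      · rw [uIoc_of_le h] at ht
        exact ht.2.trans_lt hy
      · rw [uIoc_of_ge h] at ht
        exact ht.2.trans_lt hδ
    simp only [he, hkδ t this, mul_zero]
  have hFR : ∀ y, max R 0 < y → F y = 0 := by
    intro y hy
    rw [hF, ← h0]
    simp only
    rw [intervalIntegral.integral_of_le ((le_max_right R 0).trans hy.le)]
    symm
    refine setIntegral_eq_of_subset_of_forall_sdiff_eq_zero measurableSet_Ioi Ioc_subset_Ioi_self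
      fun t ht => ?_
    have : R < t := by
      have h1 : ¬ t ≤ y := fun h => ht.2 ⟨ht.1, h⟩
      exact (le_max_left R 0).trans_lt (hy.trans (not_le.1 h1))
    simp only [hkR t this, mul_zero]
  have hsupp : tsupport (fun y => expFn (-ξ) y * F y) ⊆ Icc δ (max R 0) := by
    refine closure_minimal (fun y hy => ⟨?_, ?_⟩) isClosed_Icc
    · exact not_lt.1 fun h => hy (by simp only [hFδ y h, mul_zero])
    · exact not_lt.1 fun h => hy (by simp only [hFR y h, mul_zero])
  refine ⟨fun y => expFn (-ξ) y * F y, ⟨(contDiff_expFn _).mul hFs, ?_, ?_⟩, fun y => ?_⟩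
  · exact isCompact_Icc.of_isClosed_subset (isClosed_tsupport _) hsupp
  · exact hsupp.trans fun y hy => hδ.trans_le hy.1
  · have h1 : HasDerivAt (fun y => expFn (-ξ) y * F y) _ y :=
      (hasDerivAt_expFn (-ξ) y).mul (hFd y)
    rw [h1.deriv]
    have h2 : expFn (-ξ) y * expFn ξ y = 1 := by
      rw [expFn, expFn, ← Complex.ofReal_mul, ← Real.exp_add]
      simp
    simp only [he]
    push_cast
    linear_combination k y * h2

/-- There is a test function that is not orthogonal to any of the exponentials, namely a nonnegative
one. -/
theorem exists_isTest_pos : ∃ v : ℝ → ℂ, IsTest v ∧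
    ∀ ξ : ℝ, ∫ y in Ioi (0 : ℝ), expFn ξ y * v y ≠ 0 := by
  let b : ContDiffBump (1 : ℝ) := ⟨1 / 4, 1 / 2, by norm_num, by norm_num⟩
  have hb : IsTest fun y => (b y : ℂ) := by
    refine ofReal_isTest b.contDiff b.hasCompactSupport ?_
    rw [b.tsupport_eq]
    intro y hy
    have h1 : |y - 1| ≤ 1 / 2 := hy
    rw [abs_le] at h1
    exact show 0 < y by linarith
  refine ⟨_, hb, fun ξ => ?_⟩
  rw [hb.setIntegral_Ioi]
  have e : ∀ y, expFn ξ y * (b y : ℂ) = ((Real.exp (-(ξ * y)) * b y : ℝ) : ℂ) := fun y => by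
    simp [expFn]
  simp only [e]
  rw [integral_complex_ofReal, Complex.ofReal_ne_zero]
  have hc : Continuous fun y : ℝ => Real.exp (-(ξ * y)) * b y :=
    (by fun_prop : Continuous fun y : ℝ => Real.exp (-(ξ * y))).mul b.continuous
  refine (hc.integral_pos_of_hasCompactSupport_nonneg_nonzero b.hasCompactSupport.mul_left
    (fun y => mul_nonneg (Real.exp_pos _).le b.nonneg) (x := 1) ?_).ne'
  have : b 1 = 1 := b.one_of_mem_closedBall (Metric.mem_closedBall_self (by norm_num))
  rw [this, mul_one]
  exact (Real.exp_pos _).ne'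

/-- A weak solution of `∂_y g = - ξ g` on the half-line is a multiple of `e^{-ξ y}`. -/
theorem exists_ae_eq_of_weak_ode [Fact (1 ≤ p)] (hl : -1 < lam) {ξ : ℝ} {g : VertLp lam p}
    (h : ∀ v, IsTest v → ∫ y in Ioi (0 : ℝ), (g : ℝ → ℂ) y * deriv v y =
      ξ * ∫ y in Ioi (0 : ℝ), (g : ℝ → ℂ) y * v y) :
    ∃ c : ℂ, (g : ℝ → ℂ) =ᵐ[nu lam] fun y => c * expFn ξ y := by
  obtain ⟨v₀, hv₀, hpos⟩ := exists_isTest_pos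
  have hgl := locallyIntegrableOn_vertLp hl g
  have hel : LocallyIntegrableOn (expFn ξ) (Ioi 0) volume :=
    (continuous_expFn_right ξ).locallyIntegrable.locallyIntegrableOn _
  set m₀ := ∫ y in Ioi (0 : ℝ), expFn ξ y * v₀ y with hm₀
  have hm₀' : m₀ ≠ 0 := hpos ξ
  set c := (∫ y in Ioi (0 : ℝ), (g : ℝ → ℂ) y * v₀ y) / m₀ with hc
  refine ⟨c, ?_⟩
  rw [Filter.EventuallyEq, ae_nu hl]
  have hcl : LocallyIntegrableOn (fun y => c * expFn ξ y) (Ioi 0) volume :=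
    (continuous_const.mul (continuous_expFn_right ξ)).locallyIntegrable.locallyIntegrableOn _
  have h0 := ae_eq_zero_of_forall_isTest (g := fun y => (g : ℝ → ℂ) y - c * expFn ξ y)
    (hgl.sub hcl) fun w hw => ?_
  · filter_upwards [h0] with y hy
    exact sub_eq_zero.1 hy
  have i1 := integrableOn_mul_test hgl hw
  have i2 := integrableOn_mul_test hel hw
  have i3 := integrableOn_mul_test hgl hv₀
  have i4 := integrableOn_mul_test hel hv₀
  -- Subtracting a multiple of `v₀` makes `w` orthogonal to `e^{-ξ y}`, hence of the form
  -- `v' - ξ v`, on which `g` vanishes.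
  set m := ∫ y in Ioi (0 : ℝ), expFn ξ y * w y with hm
  obtain ⟨v, hv, hvd⟩ := (hw.add_smul hv₀ (-(m / m₀))).exists_deriv_sub (ξ := ξ) (by
    have e : ∀ y, expFn ξ y * (w y + -(m / m₀) * v₀ y) =
        expFn ξ y * w y + -(m / m₀) * (expFn ξ y * v₀ y) := fun y => by ring
    simp only [e]
    rw [integral_add i2 (i4.const_mul _), integral_const_mul, ← hm, ← hm₀]
    field_simp
    ring)
  have h1 := h v hv
  simp only [hvd] at h1
  have e1 : ∀ y, (g : ℝ → ℂ) y * (ξ * v y + (w y + -(m / m₀) * v₀ y)) =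
      ξ * ((g : ℝ → ℂ) y * v y) + ((g : ℝ → ℂ) y * w y + -(m / m₀) * ((g : ℝ → ℂ) y * v₀ y)) :=
    fun y => by ring
  have i5 : IntegrableOn (fun y => (g : ℝ → ℂ) y * w y + -(m / m₀) * ((g : ℝ → ℂ) y * v₀ y))
      (Ioi 0) := i1.add (i3.const_mul _)
  simp only [e1] at h1
  rw [integral_add ((integrableOn_mul_test hgl hv).const_mul _) i5,
    integral_const_mul, integral_add i1 (i3.const_mul _), integral_const_mul] at h1
  have e2 : ∀ y, ((g : ℝ → ℂ) y - c * expFn ξ y) * w y =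
      (g : ℝ → ℂ) y * w y - c * (expFn ξ y * w y) := fun y => by ring
  simp only [e2]
  rw [integral_sub i1 (i2.const_mul _), integral_const_mul, ← hm, hc]
  field_simp
  field_simp at h1
  linear_combination h1

/-- The Fourier transform in the first variable of a holomorphic function is
`h(ξ) e^{-ξ y}` for some function `h`, and it vanishes for `ξ ≤ 0`. -/
theorem IsPartialFourier.exists_symbol [Fact (1 ≤ p)] [Fact (1 ≤ q)] (hl : -1 < lam) (hp : p ≠ ⊤)
    {f : ℍ → ℂ} (hf : IsHol f) {φ : MixedLp lam p q} (hφ : IsPartialFourier f φ) :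
    ∃ h : ℝ → ℂ, AEStronglyMeasurable h volume ∧
      φ =ᵐ[volume] fun ξ => h ξ • expLp lam p ξ := by
  obtain ⟨D, hDc, hDt, hD⟩ := exists_countable_tests (p := p) hl
  obtain ⟨v₀, hv₀, hpos⟩ := exists_isTest_pos
  obtain ⟨ℓ, hℓ⟩ := exists_pairing (p := p) (lam := lam) hl hv₀
  -- Testing against `v₀` recovers the coefficient, which makes it measurable in `ξ`.
  refine ⟨fun ξ => ℓ (φ ξ) / ∫ y in Ioi (0 : ℝ), expFn ξ y * v₀ y, ?_, ?_⟩
  · have h1 : AEStronglyMeasurable (fun ξ => ℓ (φ ξ)) volume :=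
      ℓ.continuous.comp_aestronglyMeasurable (Lp.aestronglyMeasurable φ)
    have h2 : StronglyMeasurable fun ξ : ℝ => ∫ y in Ioi (0 : ℝ), expFn ξ y * v₀ y :=
      StronglyMeasurable.integral_prod_right'
        (f := fun s : ℝ × ℝ => expFn s.1 s.2 * v₀ s.2) (continuous_expFn.mul
        (hv₀.smooth.continuous.comp continuous_snd)).stronglyMeasurable
    exact (h1.aemeasurable.div h2.measurable.aemeasurable).aestronglyMeasurable
  · have hae : ∀ᵐ ξ : ℝ, ∀ v ∈ D, ∫ y in Ioi (0 : ℝ), (φ ξ : ℝ → ℂ) y * deriv v y =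
        ξ * ∫ y in Ioi (0 : ℝ), (φ ξ : ℝ → ℂ) y * v y :=
      (ae_ball_iff hDc).2 fun v hv => hφ.ae_pairing_deriv hl hf (hDt v hv)
    filter_upwards [hae] with ξ hξ
    obtain ⟨c, hc⟩ := exists_ae_eq_of_weak_ode hl (hD ξ (φ ξ) hξ)
    have hval : φ ξ = c • expLp lam p ξ := by
      rcases eq_or_ne c 0 with rfl | hc0
      · rw [zero_smul, Lp.eq_zero_iff_ae_eq_zero]
        filter_upwards [hc] with y hy
        simpa using hy
      · have hm : MemLp (expFn ξ) p (nu lam) := by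
          refine ((Lp.memLp (φ ξ)).const_mul c⁻¹).ae_eq ?_
          filter_upwards [hc] with y hy
          rw [hy, inv_mul_cancel_left₀ hc0]
        refine Lp.ext ?_
        rw [expLp, dif_pos hm]
        filter_upwards [hc, Lp.coeFn_smul c (hm.toLp), hm.coeFn_toLp] with y h1 h2 h3
        rw [h1, h2, Pi.smul_apply, h3, smul_eq_mul]
    rcases le_or_gt ξ 0 with h0 | h0
    · rw [hval, expLp_of_nonpos hl hp h0, smul_zero, smul_zero]
    · have e4 : ℓ (expLp lam p ξ) = ∫ y in Ioi (0 : ℝ), expFn ξ y * v₀ y := by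
        rw [hℓ]
        refine integral_congr_ae ?_
        have := coeFn_expLp (p := p) hl hp h0
        rw [Filter.EventuallyEq, ae_nu hl] at this
        filter_upwards [this] with y hy
        rw [hy]
      rw [hval, map_smul, e4, smul_eq_mul, mul_div_cancel_right₀ _ (hpos ξ)]

end Analysis

/-! ### The symbol of an element of `A^{q,p}_λ(Π)` and multiplication operators -/

section Symbol

variable {lam : ℝ} {p q : ℝ≥0∞} [Fact (-1 < lam)] [Fact (1 ≤ p)] [Fact (1 ≤ q)]

/-- `h` is the symbol of `f`: the Fourier transform of `f` in the first variable is
`h(ξ) e^{-ξ y}` for `ξ > 0` (and vanishes for `ξ ≤ 0`). Only the values of `h` on the half-line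
matter. -/
structure IsSymbol (f : BergmanSpace lam p q) (h : ℝ → ℂ) : Prop where
  aestronglyMeasurable : AEStronglyMeasurable h (volume.restrict (Ioi 0))
  ae_eq : partialFourier f =ᵐ[volume] fun ξ => h ξ • expLp lam p ξ

theorem exists_isSymbol (hp : p ≠ ⊤) (f : BergmanSpace lam p q) : ∃ h, IsSymbol f h := by
  obtain ⟨h, h1, h2⟩ := (partialFourier_spec f).exists_symbol Fact.out hp f.2.1
  exact ⟨h, h1.restrict, h2⟩

theorem aestronglyMeasurable_smul_expLp (hp : p ≠ ⊤) {h : ℝ → ℂ}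
    (hm : AEStronglyMeasurable h (volume.restrict (Ioi 0))) :
    AEStronglyMeasurable (fun ξ => h ξ • expLp lam p ξ) (volume : Measure ℝ) := by
  have hl : -1 < lam := Fact.out
  have e : (Ioi (0 : ℝ)).indicator (fun ξ => h ξ • expLp lam p ξ) =
      fun ξ => h ξ • expLp lam p ξ := by
    ext1 ξ
    by_cases hξ : ξ ∈ Ioi (0 : ℝ)
    · rw [indicator_of_mem hξ]
    · rw [indicator_of_notMem hξ, expLp_of_nonpos hl hp (not_lt.1 hξ), smul_zero]
  rw [← e, aestronglyMeasurable_indicator_iff measurableSet_Ioi]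
  exact hm.smul (aestronglyMeasurable_expLp hl hp).restrict

theorem exists_bergmanSpace (hp : p ≠ ⊤) {h : ℝ → ℂ}
    (hm : AEStronglyMeasurable h (volume.restrict (Ioi 0)))
    (hh : MemLp (fun ξ => h ξ • expLp lam p ξ) q volume) :
    ∃ f : BergmanSpace lam p q, IsSymbol f h ∧ toFunₗ f = synth h := by
  have hl : -1 < lam := Fact.out
  have hL := isLaplace_of_memLp hl hp hm hh
  have hF := isPartialFourier_synth hl hp hL hh.coeFn_toLp
  let f : BergmanSpace lam p q :=
    (⟨synth h, isHol_synth hL, hh.toLp, hF⟩ : ↥(bergmanSubmodule lam p q))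
  have hf : toFunₗ f = synth h := rfl
  refine ⟨f, ⟨hm, ?_⟩, hf⟩
  rw [partialFourier_eq (f := f) (φ := hh.toLp) hF]
  exact hh.coeFn_toLp

variable {f g : BergmanSpace lam p q} {h k : ℝ → ℂ}

theorem IsSymbol.memLp (hf : IsSymbol f h) : MemLp (fun ξ => h ξ • expLp lam p ξ) q volume :=
  (Lp.memLp (partialFourier f)).ae_eq hf.ae_eq

theorem IsSymbol.isLaplace (hf : IsSymbol f h) (hp : p ≠ ⊤) : IsLaplace h :=
  isLaplace_of_memLp Fact.out hp hf.aestronglyMeasurable hf.memLp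

theorem ae_of_ae_restrict_Ioi {P : ℝ → Prop} (h0 : ∀ ξ ≤ 0, P ξ)
    (h : ∀ᵐ ξ ∂(volume.restrict (Ioi (0 : ℝ))), P ξ) : ∀ᵐ ξ : ℝ, P ξ := by
  rw [ae_restrict_iff' measurableSet_Ioi] at h
  filter_upwards [h] with ξ hξ
  rcases le_or_gt ξ 0 with h1 | h1
  · exact h0 ξ h1
  · exact hξ h1

/-- Comparison of norms through the symbols. -/
theorem IsSymbol.norm_le (hp : p ≠ ⊤) (hf : IsSymbol f h) (hg : IsSymbol g k) {C : ℝ}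
    (hC : ∀ᵐ ξ ∂(volume.restrict (Ioi (0 : ℝ))), ‖k ξ‖ ≤ C * ‖h ξ‖) : ‖g‖ ≤ C * ‖f‖ := by
  have hl : -1 < lam := Fact.out
  have h1 : ‖partialFourier g‖ ≤ C * ‖partialFourier f‖ := by
    refine Lp.norm_le_mul_norm_of_ae_le_mul ?_
    have h2 : ∀ᵐ ξ : ℝ, ‖k ξ • expLp lam p ξ‖ ≤ C * ‖h ξ • expLp lam p ξ‖ := by
      refine ae_of_ae_restrict_Ioi (fun ξ hξ => ?_) ?_
      · simp [expLp_of_nonpos (p := p) hl hp hξ]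
      · filter_upwards [hC] with ξ hξ
        rw [norm_smul, norm_smul, ← mul_assoc]
        gcongr
    filter_upwards [hf.ae_eq, hg.ae_eq, h2] with ξ e1 e2 e3
    rw [e1, e2]
    exact e3
  rw [norm_eq, norm_eq]
  change ‖((Real.sqrt Real.pi : ℝ) : ℂ)⁻¹ • partialFourier g‖ ≤
    C * ‖((Real.sqrt Real.pi : ℝ) : ℂ)⁻¹ • partialFourier f‖
  rw [norm_smul, norm_smul, mul_left_comm]
  gcongr

theorem partialFourier_add (f g : BergmanSpace lam p q) :
    partialFourier (f + g) = partialFourier f + partialFourier g := by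
  refine partialFourier_eq ?_
  rw [map_add]
  exact IsPartialFourier.add Fact.out (partialFourier_spec f) (partialFourier_spec g)

theorem partialFourier_smul (c : ℂ) (f : BergmanSpace lam p q) :
    partialFourier (c • f) = c • partialFourier f := by
  refine partialFourier_eq ?_
  rw [map_smul]
  exact IsPartialFourier.smul Fact.out c (partialFourier_spec f)

theorem IsSymbol.add (hf : IsSymbol f h) (hg : IsSymbol g k) :
    IsSymbol (f + g) fun ξ => h ξ + k ξ := by
  refine ⟨hf.aestronglyMeasurable.add hg.aestronglyMeasurable, ?_⟩
  rw [partialFourier_add]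
  filter_upwards [Lp.coeFn_add (partialFourier f) (partialFourier g), hf.ae_eq, hg.ae_eq]
    with ξ h1 h2 h3
  rw [h1, Pi.add_apply, h2, h3, add_smul]

theorem IsSymbol.smul (c : ℂ) (hf : IsSymbol f h) : IsSymbol (c • f) fun ξ => c * h ξ := by
  refine ⟨hf.aestronglyMeasurable.const_mul c, ?_⟩
  rw [partialFourier_smul]
  filter_upwards [Lp.coeFn_smul c (partialFourier f), hf.ae_eq] with ξ h1 h2
  rw [h1, Pi.smul_apply, h2, smul_smul]

theorem IsSymbol.sub (hf : IsSymbol f h) (hg : IsSymbol g k) :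
    IsSymbol (f - g) fun ξ => h ξ - k ξ := by
  have h1 := hf.add (hg.smul (-1))
  simpa [sub_eq_add_neg] using h1

theorem IsSymbol.eq_of_ae_eq (hp : p ≠ ⊤) (hf : IsSymbol f h) (hg : IsSymbol g k)
    (he : ∀ᵐ ξ ∂(volume.restrict (Ioi (0 : ℝ))), h ξ = k ξ) : f = g := by
  have h1 := hf.norm_le hp (hf.sub hg) (C := 0) (by
    filter_upwards [he] with ξ hξ
    simp [hξ])
  rw [zero_mul] at h1
  exact sub_eq_zero.1 (norm_le_zero_iff.1 h1)

theorem IsSymbol.congr (hp : p ≠ ⊤) (hf : IsSymbol f h)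
    (he : ∀ᵐ ξ ∂(volume.restrict (Ioi (0 : ℝ))), h ξ = k ξ) : IsSymbol f k := by
  have hl : -1 < lam := Fact.out
  refine ⟨hf.aestronglyMeasurable.congr he, ?_⟩
  have h2 : ∀ᵐ ξ : ℝ, h ξ • expLp lam p ξ = k ξ • expLp lam p ξ := by
    refine ae_of_ae_restrict_Ioi (fun ξ hξ => ?_) ?_
    · simp [expLp_of_nonpos (p := p) hl hp hξ]
    · filter_upwards [he] with ξ hξ
      rw [hξ]
  filter_upwards [hf.ae_eq, h2] with ξ e1 e2
  rw [e1, e2]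

theorem IsSymbol.ae_eq_of_isSymbol (hp : p ≠ ⊤) (hf : IsSymbol f h) (hk : IsSymbol f k) :
    ∀ᵐ ξ ∂(volume.restrict (Ioi (0 : ℝ))), h ξ = k ξ := by
  have hl : -1 < lam := Fact.out
  rw [ae_restrict_iff' measurableSet_Ioi]
  filter_upwards [hf.ae_eq, hk.ae_eq] with ξ e1 e2 hξ
  rw [e1] at e2
  exact smul_left_injective ℂ (expLp_ne_zero (p := p) hl hp hξ) e2

theorem IsSymbol.toFun_eq (hp : p ≠ ⊤) (hf : IsSymbol f h) : toFunₗ f = synth h := by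
  obtain ⟨g, hg, hgs⟩ := exists_bergmanSpace (q := q) hp hf.aestronglyMeasurable hf.memLp
  rw [hf.eq_of_ae_eq hp hg (ae_of_all _ fun _ => rfl), hgs]

/-- The symbol may be multiplied by a bounded function. -/
theorem IsSymbol.exists_mul (hp : p ≠ ⊤) (hf : IsSymbol f h) {m : ℝ → ℂ}
    (hm : AEStronglyMeasurable m (volume.restrict (Ioi 0))) {C : ℝ}
    (hC : ∀ ξ > 0, ‖m ξ‖ ≤ C) : ∃ g : BergmanSpace lam p q, IsSymbol g fun ξ => m ξ * h ξ := by
  have hl : -1 < lam := Fact.out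
  have hmh := hm.mul hf.aestronglyMeasurable
  obtain ⟨g, hg, -⟩ := exists_bergmanSpace (lam := lam) (q := q) hp hmh (by
    refine hf.memLp.of_le_mul (c := C) (aestronglyMeasurable_smul_expLp hp hmh)
      (ae_of_all _ fun ξ => ?_)
    rcases le_or_gt ξ 0 with h1 | h1
    · simp [expLp_of_nonpos (p := p) hl hp h1]
    · rw [norm_smul, norm_smul, Pi.mul_apply, norm_mul, ← mul_assoc]
      gcongr
      exact hC ξ h1)
  exact ⟨g, hg⟩

/-- The operator of multiplication of the symbol by a bounded function. -/
theorem exists_mulOperator (hp : p ≠ ⊤) {m : ℝ → ℂ}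
    (hm : AEStronglyMeasurable m (volume.restrict (Ioi 0))) {C : ℝ}
    (hC : ∀ ξ > 0, ‖m ξ‖ ≤ C) :
    ∃ T : BergmanSpace lam p q →L[ℂ] BergmanSpace lam p q,
      ∀ f h, IsSymbol f h → IsSymbol (T f) fun ξ => m ξ * h ξ := by
  choose s hs using fun f : BergmanSpace lam p q => exists_isSymbol hp f
  choose T hT using fun f : BergmanSpace lam p q => (hs f).exists_mul hp hm hC
  have hT' : ∀ f h, IsSymbol f h → IsSymbol (T f) fun ξ => m ξ * h ξ := by
    intro f h hf
    refine (hT f).congr hp ?_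
    filter_upwards [(hs f).ae_eq_of_isSymbol hp hf] with ξ hξ
    rw [hξ]
  have hae : ∀ᵐ ξ ∂(volume.restrict (Ioi (0 : ℝ))), ‖m ξ‖ ≤ C :=
    (ae_restrict_iff' measurableSet_Ioi).2 (ae_of_all _ hC)
  let L : BergmanSpace lam p q →ₗ[ℂ] BergmanSpace lam p q :=
    { toFun := T
      map_add' := fun f g => by
        refine (hT' _ _ ((hs f).add (hs g))).eq_of_ae_eq hp ((hT f).add (hT g))
          (ae_of_all _ fun ξ => ?_)
        ring
      map_smul' := fun c f => by
        refine (hT' _ _ ((hs f).smul c)).eq_of_ae_eq hp ((hT f).smul c) (ae_of_all _ fun ξ => ?_)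
        ring }
  refine ⟨L.mkContinuous C fun f => (hs f).norm_le hp (hT f) ?_, hT'⟩
  filter_upwards [hae] with ξ hξ
  rw [norm_mul]
  gcongr

/-- Nonzero elements with symbol supported in a given neighbourhood of a point. -/
theorem exists_localized (lam : ℝ) (p q : ℝ≥0∞) [Fact (-1 < lam)] [Fact (1 ≤ p)] [Fact (1 ≤ q)]
    (hp : p ≠ ⊤) {ξ₀ : ℝ} (hξ₀ : 0 < ξ₀) {U : Set ℝ} (hU : U ∈ nhds ξ₀) :
    ∃ a b : ℝ, 0 < a ∧ Icc a b ⊆ U ∧ ∃ f : BergmanSpace lam p q, f ≠ 0 ∧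
      IsSymbol f ((Icc a b).indicator fun _ => 1) := by
  have hl : -1 < lam := Fact.out
  obtain ⟨δ, hδ, hball⟩ := Metric.nhds_basis_closedBall.mem_iff.1
    (Filter.inter_mem hU (Ioi_mem_nhds hξ₀))
  rw [Real.closedBall_eq_Icc] at hball
  have ha : 0 < ξ₀ - δ := (hball (left_mem_Icc.2 (by linarith))).2
  have hm : AEStronglyMeasurable ((Icc (ξ₀ - δ) (ξ₀ + δ)).indicator fun _ : ℝ => (1 : ℂ))
      (volume.restrict (Ioi 0)) :=
    aestronglyMeasurable_const.indicator measurableSet_Icc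
  have e : (fun ξ => (Icc (ξ₀ - δ) (ξ₀ + δ)).indicator (fun _ : ℝ => (1 : ℂ)) ξ • expLp lam p ξ) =
      (Icc (ξ₀ - δ) (ξ₀ + δ)).indicator (expLp lam p) := by
    ext1 ξ
    by_cases hξ : ξ ∈ Icc (ξ₀ - δ) (ξ₀ + δ)
    · rw [indicator_of_mem hξ, indicator_of_mem hξ, one_smul]
    · rw [indicator_of_notMem hξ, indicator_of_notMem hξ, zero_smul]
  obtain ⟨f, hf, -⟩ := exists_bergmanSpace (lam := lam) (p := p) (q := q) hp hm (by
    have hcont : ContinuousOn (expLp lam p) (Icc (ξ₀ - δ) (ξ₀ + δ)) :=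
      (continuousOn_expLp hl hp).mono fun ξ hξ => (hball hξ).2
    obtain ⟨C, hC⟩ := isCompact_Icc.exists_bound_of_continuousOn hcont
    rw [e, memLp_indicator_iff_restrict measurableSet_Icc]
    exact MemLp.of_bound (aestronglyMeasurable_expLp hl hp).restrict C
      ((ae_restrict_iff' measurableSet_Icc).2 (ae_of_all _ hC)))
  refine ⟨ξ₀ - δ, ξ₀ + δ, ha, fun ξ hξ => (hball hξ).1, f, ?_, hf⟩
  rintro rfl
  have h0 : IsSymbol (0 : BergmanSpace lam p q) fun _ => 0 := by simpa using hf.smul 0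
  have h1 := hf.ae_eq_of_isSymbol hp h0
  rw [ae_restrict_iff' measurableSet_Ioi] at h1
  have h2 : ∀ᵐ ξ : ℝ, ξ ∉ Icc (ξ₀ - δ) (ξ₀ + δ) := by
    filter_upwards [h1] with ξ hξ hmem
    have h3 := hξ (hball hmem).2
    rw [indicator_of_mem hmem] at h3
    exact one_ne_zero h3
  have h3 : volume (Icc (ξ₀ - δ) (ξ₀ + δ)) = 0 := measure_eq_zero_iff_ae_notMem.2 h2
  rw [Real.volume_Icc, ENNReal.ofReal_eq_zero] at h3
  linarith

/-- The spectrum of the operator of multiplication of the symbol by a bounded continuous function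
is the closure of the range of this function. -/
theorem spectrum_mulOperator (hp : p ≠ ⊤) {m : ℝ → ℂ} (hm : ContinuousOn m (Ioi 0))
    {T : BergmanSpace lam p q →L[ℂ] BergmanSpace lam p q}
    (hT : ∀ f h, IsSymbol f h → IsSymbol (T f) fun ξ => m ξ * h ξ) :
    spectrum ℂ T = closure (m '' Ioi 0) := by
  have hTμ : ∀ (μ : ℂ) f h, IsSymbol f h →
      IsSymbol ((algebraMap ℂ (BergmanSpace lam p q →L[ℂ] BergmanSpace lam p q) μ - T) f)
        fun ξ => (μ - m ξ) * h ξ := by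
    intro μ f h hf
    have h1 := (hf.smul μ).sub (hT f h hf)
    refine h1.congr hp (ae_of_all _ fun ξ => ?_)
    ring
  refine Subset.antisymm (fun μ hμ => ?_) (fun μ hμ => ?_)
  -- Away from the closure of the range, multiplication by `(μ - m)⁻¹` is a bounded inverse.
  · by_contra hcl
    refine spectrum.mem_iff.1 hμ ?_
    obtain ⟨r, hr, hball⟩ := Metric.isOpen_iff.1 isClosed_closure.isOpen_compl μ hcl
    have hge : ∀ ξ > 0, r ≤ ‖μ - m ξ‖ := by
      intro ξ hξ
      by_contra hlt
      refine hball (a := m ξ) ?_ (subset_closure ⟨ξ, hξ, rfl⟩)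
      rw [Metric.mem_ball, dist_comm, dist_eq_norm]
      exact not_le.1 hlt
    have hne : ∀ ξ > 0, μ - m ξ ≠ 0 := fun ξ hξ => norm_pos_iff.1 (hr.trans_le (hge ξ hξ))
    have hinv : ContinuousOn (fun ξ => (μ - m ξ)⁻¹) (Ioi 0) :=
      (continuousOn_const.sub hm).inv₀ hne
    obtain ⟨S, hS⟩ := exists_mulOperator (lam := lam) (q := q) hp
      (hinv.aestronglyMeasurable measurableSet_Ioi) (C := r⁻¹) (fun ξ hξ => by
        rw [norm_inv]
        exact inv_anti₀ hr (hge ξ hξ))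
    have hae : ∀ᵐ ξ ∂(volume.restrict (Ioi (0 : ℝ))), μ - m ξ ≠ 0 :=
      (ae_restrict_iff' measurableSet_Ioi).2 (ae_of_all _ hne)
    refine ⟨⟨_, S, ?_, ?_⟩, rfl⟩
    · ext1 f
      obtain ⟨h, hf⟩ := exists_isSymbol hp f
      refine IsSymbol.eq_of_ae_eq hp (hTμ μ _ _ (hS f h hf)) hf ?_
      filter_upwards [hae] with ξ hξ
      rw [mul_inv_cancel_left₀ hξ]
    · ext1 f
      obtain ⟨h, hf⟩ := exists_isSymbol hp f
      refine IsSymbol.eq_of_ae_eq hp (hS _ _ (hTμ μ f h hf)) hf ?_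
      filter_upwards [hae] with ξ hξ
      rw [inv_mul_cancel_left₀ hξ]
  -- Near a value of `m` close to `μ`, localized elements are almost annihilated by `μ - T`.
  · rw [spectrum.mem_iff]
    rintro ⟨V, hV⟩
    set S : BergmanSpace lam p q →L[ℂ] BergmanSpace lam p q := ↑V⁻¹ with hSdef
    have hS : ∀ f, S ((algebraMap ℂ (BergmanSpace lam p q →L[ℂ] BergmanSpace lam p q) μ - T) f) =
        f := by
      intro f
      rw [← hV]
      exact congrArg (fun A : BergmanSpace lam p q →L[ℂ] BergmanSpace lam p q => A f) V.inv_mul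
    set η := (‖S‖ + 1)⁻¹ with hη
    have hη0 : 0 < η := by positivity
    obtain ⟨_, ⟨ξ₀, hξ₀, rfl⟩, hd⟩ := Metric.mem_closure_iff.1 hμ η hη0
    have hξ₀' : 0 < ξ₀ := hξ₀
    rw [dist_eq_norm] at hd
    have hc : ContinuousAt (fun ξ => ‖μ - m ξ‖) ξ₀ :=
      (continuousAt_const.sub (hm.continuousAt (Ioi_mem_nhds hξ₀'))).norm
    obtain ⟨a, b, ha, hab, f, hf0, hf⟩ := exists_localized lam p q hp hξ₀'
      (hc.eventually_lt_const hd)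
    have h1 := hf.norm_le hp (hTμ μ f _ hf) (C := η) (ae_of_all _ fun ξ => by
      by_cases hξ : ξ ∈ Icc a b
      · rw [norm_mul]
        gcongr
        exact (hab hξ).le
      · rw [indicator_of_notMem hξ, mul_zero, norm_zero, mul_zero])
    have h2 := S.le_opNorm
      ((algebraMap ℂ (BergmanSpace lam p q →L[ℂ] BergmanSpace lam p q) μ - T) f)
    rw [hS] at h2
    have h3 : ‖f‖ ≤ ‖S‖ * (η * ‖f‖) := h2.trans (by gcongr)
    have h4 : 0 < ‖f‖ := norm_pos_iff.2 hf0
    have h5 : ‖S‖ * η < 1 := by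
      rw [hη, ← div_eq_mul_inv, div_lt_one (by positivity)]
      linarith
    nlinarith

end Symbol

/-! ### The Bergman kernel as a Fourier–Laplace integral -/

section Kernel

variable {lam : ℝ}

theorem isLaplace_rpow {s : ℝ} (hs : -1 < s) : IsLaplace fun t => ((t ^ s : ℝ) : ℂ) := by
  refine ⟨fun y hy => ?_⟩
  refine IntegrableOn.congr_fun (Integrable.ofReal (integrableOn_rpow_mul_exp hs hy) (𝕜 := ℂ))
    (fun t _ => ?_) measurableSet_Ioi
  simp only [expFn]
  rw [mul_comm t y]
  norm_cast

/-- The Fourier–Laplace integral of `t ^ (1 + λ)` is `Γ(2 + λ)` times the expression of the Bergman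
kernel. On the imaginary axis this is Euler's integral, and both sides are holomorphic on the
upper half-plane. -/
theorem laplaceInt_rpow (hl : -1 < lam) {ζ : ℂ} (hζ : 0 < ζ.im) :
    laplaceInt (fun t => ((t ^ (1 + lam) : ℝ) : ℂ)) ζ =
      (Real.Gamma (2 + lam) : ℂ) * (-(Complex.I ^ (lam : ℂ)) * (1 / ζ ^ (2 + lam : ℂ))) := by
  set U : Set ℂ := {z | 0 < z.im} with hU
  have hopen : IsOpen U := isOpen_lt continuous_const Complex.continuous_im
  have hconn : IsPreconnected U := (convex_halfSpace_im_gt 0).isPreconnected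
  have hA : AnalyticOnNhd ℂ (laplaceInt fun t => ((t ^ (1 + lam) : ℝ) : ℂ)) U :=
    (isLaplace_rpow (by linarith)).differentiableOn.analyticOnNhd hopen
  have hB : AnalyticOnNhd ℂ (fun ζ : ℂ =>
      (Real.Gamma (2 + lam) : ℂ) * (-(Complex.I ^ (lam : ℂ)) * (1 / ζ ^ (2 + lam : ℂ)))) U := by
    refine DifferentiableOn.analyticOnNhd (fun z hz => ?_) hopen
    have hz0 : 0 < z.im := hz
    have hslit : z ∈ Complex.slitPlane := Or.inr hz0.ne'
    refine DifferentiableAt.differentiableWithinAt ?_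
    refine (((differentiableAt_const _).div (differentiableAt_id.cpow_const hslit) ?_).const_mul
      _).const_mul _
    rw [Complex.cpow_ne_zero_iff]
    left
    rintro h
    simp only [id] at h
    rw [h] at hz0
    simp at hz0
  refine hA.eqOn_of_preconnected_of_frequently_eq hB hconn (z₀ := Complex.I)
    (by simp [hU]) ?_ hζ
  have hax : ∀ σ : ℝ, 0 < σ → laplaceInt (fun t => ((t ^ (1 + lam) : ℝ) : ℂ)) (σ * Complex.I) =
      (Real.Gamma (2 + lam) : ℂ) *
        (-(Complex.I ^ (lam : ℂ)) * (1 / (σ * Complex.I) ^ (2 + lam : ℂ))) := by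
    intro σ hσ
    have h1 := Real.integral_rpow_mul_exp_neg_mul_Ioi (a := 2 + lam) (r := σ) (by linarith) hσ
    have e1 : ∀ t : ℝ, ((t ^ (1 + lam) : ℝ) : ℂ) * Complex.exp (Complex.I * t * (σ * Complex.I)) =
        ((t ^ (2 + lam - 1) * Real.exp (-(σ * t)) : ℝ) : ℂ) := by
      intro t
      have e : Complex.I * t * (σ * Complex.I) = ((-(σ * t) : ℝ) : ℂ) := by
        push_cast
        linear_combination (t : ℂ) * σ * Complex.I_sq
      rw [e, ← Complex.ofReal_exp, ← Complex.ofReal_mul]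
      congr 3
      ring
    have hσ0 : (σ : ℂ) ≠ 0 := Complex.ofReal_ne_zero.2 hσ.ne'
    have e2 : -(Complex.I ^ (lam : ℂ)) * (1 / (σ * Complex.I) ^ (2 + lam : ℂ)) =
        (((1 / σ) ^ (2 + lam) : ℝ) : ℂ) := by
      rw [Complex.cpow_def_of_ne_zero Complex.I_ne_zero,
        Complex.cpow_def_of_ne_zero (mul_ne_zero hσ0 Complex.I_ne_zero),
        Complex.log_ofReal_mul hσ Complex.I_ne_zero, Complex.log_I,
        Real.rpow_def_of_pos (by positivity), one_div σ, Real.log_inv, one_div, ← Complex.exp_neg,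
        neg_mul, ← Complex.exp_add, Complex.ofReal_exp, ← neg_one_mul, ← Complex.exp_pi_mul_I,
        ← Complex.exp_add]
      congr 1
      push_cast
      ring
    rw [laplaceInt, e2]
    simp only [e1]
    rw [integral_complex_ofReal, h1, mul_comm]
    norm_cast
  have htend : Filter.Tendsto (fun σ : ℝ => (σ : ℂ) * Complex.I) (nhdsWithin 1 {1}ᶜ)
      (nhdsWithin Complex.I {Complex.I}ᶜ) := by
    refine tendsto_nhdsWithin_iff.2 ⟨?_, ?_⟩
    · have : Continuous fun σ : ℝ => (σ : ℂ) * Complex.I := by fun_prop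
      have h := this.tendsto 1
      simp only [Complex.ofReal_one, one_mul] at h
      exact h.mono_left nhdsWithin_le_nhds
    · filter_upwards [self_mem_nhdsWithin] with σ hσ h
      refine hσ ?_
      have h2 := congrArg Complex.im (show (σ : ℂ) * Complex.I = Complex.I from h)
      simpa using h2
  refine htend.frequently (Filter.Eventually.frequently ?_)
  filter_upwards [nhdsWithin_le_nhds (Ioi_mem_nhds (zero_lt_one' ℝ))] with σ hσ
  exact hax σ hσ

theorem im_sub_conj_pos (z w : ℍ) : 0 < ((z : ℂ) - conj (w : ℂ)).im := by
  have h1 := z.im_pos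
  have h2 := w.im_pos
  simp only [Complex.sub_im, Complex.conj_im, UpperHalfPlane.coe_im]
  linarith

theorem kernelK_eq (hl : -1 < lam) (z w : ℍ) :
    kernelK lam z w = (Real.Gamma (2 + lam) : ℂ)⁻¹ *
      laplaceInt (fun t => ((t ^ (1 + lam) : ℝ) : ℂ)) (z - conj (w : ℂ)) := by
  rw [laplaceInt_rpow hl (im_sub_conj_pos z w), inv_mul_cancel_left₀, kernelK]
  exact Complex.ofReal_ne_zero.2 (Real.Gamma_pos_of_pos (by linarith)).ne'

theorem norm_kernelK (lam : ℝ) (z w : ℍ) :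
    ‖kernelK lam z w‖ = ‖(z : ℂ) - conj (w : ℂ)‖ ^ (-(2 + lam)) := by
  have e : (2 + lam : ℂ) = ((2 + lam : ℝ) : ℂ) := by push_cast; rfl
  rw [kernelK, e, norm_mul, norm_neg, Complex.norm_cpow_real, Complex.norm_I, Real.one_rpow,
    one_mul, norm_div, norm_one, Complex.norm_cpow_real, Real.rpow_neg (norm_nonneg _), one_div]

theorem sub_conj_pt (z : ℍ) (x : ℝ) {y : ℝ} (hy : 0 < y) :
    (z : ℂ) - conj (pt x y : ℂ) = z - x + y * Complex.I := by
  rw [coe_pt x hy]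
  simp only [map_add, map_mul, Complex.conj_ofReal, Complex.conj_I]
  ring

/-- An integrable bound for the kernel, independent of the height of the second variable. -/
def kernelBound (lam : ℝ) (z : ℍ) (x : ℝ) : ℝ :=
  z.im ^ (-(2 + lam)) * (1 + ‖(x - z.re) / z.im‖ ^ 2) ^ (-(2 + lam) / 2)

theorem integrable_kernelBound (hl : -1 < lam) (z : ℍ) : Integrable (kernelBound lam z) := by
  have h1 : Integrable fun x : ℝ => (1 + ‖x‖ ^ 2) ^ (-(2 + lam) / 2) :=
    integrable_rpow_neg_one_add_norm_sq (by simp; linarith)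
  exact ((h1.comp_div z.im_pos.ne').comp_sub_right z.re).const_mul _

theorem norm_kernelK_le (hl : -1 < lam) (z : ℍ) (x : ℝ) {y : ℝ} (hy : 0 < y) :
    ‖kernelK lam z (pt x y)‖ ≤ kernelBound lam z x := by
  have hz := z.im_pos
  have hsq : z.im ^ 2 * (1 + ‖(x - z.re) / z.im‖ ^ 2) ≤ ‖(z : ℂ) - conj (pt x y : ℂ)‖ ^ 2 := by
    rw [sub_conj_pt z x hy, ← Complex.normSq_eq_norm_sq, Complex.normSq_apply, Real.norm_eq_abs,
      sq_abs]
    simp only [Complex.add_re, Complex.sub_re, Complex.add_im, Complex.sub_im, Complex.ofReal_re,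
      Complex.ofReal_im, Complex.mul_re, Complex.mul_im, Complex.I_re, Complex.I_im,
      UpperHalfPlane.coe_re, UpperHalfPlane.coe_im]
    field_simp
    nlinarith
  have hpos : 0 < z.im ^ 2 * (1 + ‖(x - z.re) / z.im‖ ^ 2) := by positivity
  rw [norm_kernelK, kernelBound]
  have e1 : ‖(z : ℂ) - conj (pt x y : ℂ)‖ ^ (-(2 + lam)) =
      (‖(z : ℂ) - conj (pt x y : ℂ)‖ ^ 2) ^ (-(2 + lam) / 2) := by
    rw [← Real.rpow_natCast, ← Real.rpow_mul (norm_nonneg _)]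
    congr 1
    push_cast
    ring
  have e2 : z.im ^ (-(2 + lam)) = (z.im ^ 2) ^ (-(2 + lam) / 2) := by
    rw [← Real.rpow_natCast, ← Real.rpow_mul hz.le]
    congr 1
    push_cast
    ring
  rw [e1, e2, ← Real.mul_rpow (by positivity) (by positivity)]
  exact Real.rpow_le_rpow_of_nonpos hpos hsq (by linarith)

/-- Moving the first variable horizontally changes the kernel by at most a polynomial factor. -/
theorem norm_kernelK_pt_le (hl : -1 < lam) (x : ℝ) (w : ℍ) :
    ‖kernelK lam (pt x 1) w‖ ≤ (1 + |x|) ^ (2 + lam) * ‖kernelK lam (pt 0 1) w‖ := by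
  rw [norm_kernelK, norm_kernelK]
  set A := (pt x 1 : ℂ) - conj (w : ℂ) with hA
  set B := (pt 0 1 : ℂ) - conj (w : ℂ) with hB
  have hA1 : 1 ≤ ‖A‖ := by
    have h1 : 1 ≤ A.im := by
      have h2 := w.im_pos
      rw [hA, coe_pt x one_pos]
      simp only [Complex.sub_im, Complex.conj_im, UpperHalfPlane.coe_im]
      simp
      linarith
    exact h1.trans ((le_abs_self _).trans (Complex.abs_im_le_norm A))
  have hB1 : 0 < ‖B‖ := norm_pos_iff.2 fun h => by
    have := im_sub_conj_pos (pt 0 1) w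
    rw [← hB, h] at this
    simp at this
  have hBA : ‖B‖ ≤ (1 + |x|) * ‖A‖ := by
    have e : B = A - x := by
      rw [hA, hB, coe_pt x one_pos, coe_pt 0 one_pos]
      push_cast
      ring
    calc ‖B‖ ≤ ‖A‖ + ‖(x : ℂ)‖ := by rw [e]; exact norm_sub_le _ _
      _ = ‖A‖ + |x| * 1 := by rw [Complex.norm_real, Real.norm_eq_abs, mul_one]
      _ ≤ ‖A‖ + |x| * ‖A‖ := by gcongr
      _ = (1 + |x|) * ‖A‖ := by ring
  have h3 := Real.rpow_le_rpow_of_nonpos (z := -(2 + lam)) hB1 hBA (by linarith)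
  rw [Real.mul_rpow (by positivity) (by positivity)] at h3
  have h4 : (1 + |x|) ^ (2 + lam) * (1 + |x|) ^ (-(2 + lam)) = 1 := by
    rw [← Real.rpow_add (by positivity), add_neg_cancel, Real.rpow_zero]
  calc ‖A‖ ^ (-(2 + lam))
      = (1 + |x|) ^ (2 + lam) * ((1 + |x|) ^ (-(2 + lam)) * ‖A‖ ^ (-(2 + lam))) := by
        rw [← mul_assoc, h4, one_mul]
    _ ≤ _ := by gcongr

/-- The kernel with both variables in coordinates. -/
theorem kernelK_pt (lam : ℝ) (z : ℍ) (x : ℝ) {y : ℝ} (hy : 0 < y) :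
    kernelK lam z (pt x y) =
      -(Complex.I ^ (lam : ℂ)) * (1 / ((z : ℂ) - x + y * Complex.I) ^ (2 + lam : ℂ)) := by
  rw [kernelK, sub_conj_pt z x hy]

theorem integrable_kernelK (hl : -1 < lam) (z : ℍ) {y : ℝ} (hy : 0 < y) :
    Integrable fun x : ℝ => kernelK lam z (pt x y) := by
  refine Integrable.mono' (integrable_kernelBound hl z) ?_
    (ae_of_all _ fun x => norm_kernelK_le hl z x hy)
  simp only [kernelK_pt lam z _ hy]
  exact Measurable.aestronglyMeasurable (by fun_prop)

/-- The Fourier transform of the kernel in its second variable, on a horizontal line. -/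
theorem integral_exp_mul_kernelK (hl : -1 < lam) (z : ℍ) {y : ℝ} (hy : 0 < y) {ξ : ℝ}
    (hξ : 0 < ξ) :
    ∫ x : ℝ, kernelK lam z (pt x y) * Complex.exp (Complex.I * ξ * x) =
      (Real.Gamma (2 + lam) : ℂ)⁻¹ * (2 * Real.pi) *
        (((ξ ^ (1 + lam) : ℝ) : ℂ) * (expFn ξ y * Complex.exp (Complex.I * ξ * z))) := by
  -- The kernel is the Fourier transform of `ψ`, extended by zero to a function that is continuous
  -- since `1 + λ > 0`; so Fourier inversion applies.
  set ψ : ℝ → ℂ := fun t => (((max t 0) ^ (1 + lam) : ℝ) : ℂ) *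
    Complex.exp (Complex.I * t * (z + y * Complex.I)) with hψ
  have hψc : Continuous ψ := by
    have h1 : Continuous fun t : ℝ => (max t 0) ^ (1 + lam) :=
      (continuous_id.max continuous_const).rpow_const fun t => Or.inr (by linarith)
    exact (Complex.continuous_ofReal.comp h1).mul (by fun_prop)
  have hψind : ψ = (Ioi (0 : ℝ)).indicator fun t => ((t ^ (1 + lam) : ℝ) : ℂ) *
      Complex.exp (Complex.I * t * (z + y * Complex.I)) := by
    ext1 t
    by_cases ht : t ∈ Ioi (0 : ℝ)
    · rw [indicator_of_mem ht]
      simp only [hψ, max_eq_left (le_of_lt (show 0 < t from ht))]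
    · have ht0 : t ≤ 0 := not_lt.1 ht
      rw [indicator_of_notMem ht]
      simp only [hψ, max_eq_right ht0, Real.zero_rpow (show 1 + lam ≠ 0 by linarith),
        Complex.ofReal_zero, zero_mul]
  have him : 0 < ((z : ℂ) + y * Complex.I).im := by
    have := z.im_pos
    simp only [Complex.add_im, UpperHalfPlane.coe_im, Complex.mul_im, Complex.ofReal_re,
      Complex.I_im, Complex.ofReal_im, Complex.I_re]
    linarith
  have hL : IsLaplace fun t : ℝ => ((t ^ (1 + lam) : ℝ) : ℂ) := isLaplace_rpow (by linarith)
  have hψi : Integrable ψ := by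
    rw [hψind, integrable_indicator_iff measurableSet_Ioi]
    exact hL.integrableOn_exp him
  have hΓ : (Real.Gamma (2 + lam) : ℂ) ≠ 0 :=
    Complex.ofReal_ne_zero.2 (Real.Gamma_pos_of_pos (by linarith)).ne'
  set s := ((Real.sqrt (2 * Real.pi) : ℝ) : ℂ) with hs
  have hs0 : s ≠ 0 := sqrt_two_pi_ne_zero
  have hF : ∀ x : ℝ, fourierR ψ x =
      s⁻¹ * ((Real.Gamma (2 + lam) : ℂ) * kernelK lam z (pt x y)) := by
    intro x
    rw [kernelK_eq hl, mul_inv_cancel_left₀ hΓ, sub_conj_pt z x hy, fourierR, laplaceInt,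
      ← integral_indicator measurableSet_Ioi]
    congr 1
    refine integral_congr_ae (ae_of_all _ fun t => ?_)
    simp only
    rw [hψind]
    by_cases ht : t ∈ Ioi (0 : ℝ)
    · rw [indicator_of_mem ht, indicator_of_mem ht, mul_left_comm, ← Complex.exp_add]
      congr 2
      ring
    · rw [indicator_of_notMem ht, indicator_of_notMem ht, mul_zero]
  have hFi : Integrable (fourierR ψ) := by
    rw [show fourierR ψ = _ from funext hF]
    exact ((integrable_kernelK hl z hy).const_mul _).const_mul _
  have hinv := integral_fourierR_mul_exp_of_integrable hψc hψi hFi ξ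
  have e1 : ∀ x : ℝ, kernelK lam z (pt x y) * Complex.exp (Complex.I * ξ * x) =
      (Real.Gamma (2 + lam) : ℂ)⁻¹ * s * (fourierR ψ x * Complex.exp (Complex.I * ξ * x)) := by
    intro x
    rw [hF]
    field_simp
  simp only [e1]
  have hs2 : s * s = 2 * Real.pi := by
    rw [hs, ← Complex.ofReal_mul, Real.mul_self_sqrt (by positivity)]
    push_cast
    rfl
  have hψξ : ψ ξ =
      ((ξ ^ (1 + lam) : ℝ) : ℂ) * (expFn ξ y * Complex.exp (Complex.I * ξ * z)) := by
    simp only [hψ, max_eq_left hξ.le, exp_I_mul_add]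
  rw [integral_const_mul, hinv, hψξ, ← hs2]
  ring

/-- The integral over a horizontal line of a Fourier–Laplace integral against the kernel. -/
theorem IsLaplace.integral_mul_kernelK (hl : -1 < lam) {h : ℝ → ℂ} (hh : IsLaplace h) (z : ℍ)
    {y : ℝ} (hy : 0 < y) :
    ∫ x : ℝ, laplaceInt h (pt x y) * kernelK lam z (pt x y) =
      (Real.Gamma (2 + lam) : ℂ)⁻¹ * (2 * Real.pi) *
        ∫ ξ in Ioi (0 : ℝ), h ξ * ((ξ ^ (1 + lam) : ℝ) : ℂ) * Complex.exp (Complex.I * ξ * z) *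
          expFn (2 * ξ) y := by
  have hprod : Integrable (fun s : ℝ × ℝ => kernelK lam z (pt s.1 y) *
      (h s.2 * expFn s.2 y * Complex.exp (Complex.I * s.2 * s.1)))
      (volume.prod (volume.restrict (Ioi 0))) := by
    have h1 : Integrable (fun s : ℝ × ℝ => kernelK lam z (pt s.1 y) * (h s.2 * expFn s.2 y))
        (volume.prod (volume.restrict (Ioi 0))) :=
      (integrable_kernelK hl z hy).mul_prod (hh.integrableOn y hy)
    refine (h1.mul_bdd (c := 1)
      (g := fun s : ℝ × ℝ => Complex.exp (Complex.I * s.2 * s.1)) (by fun_prop)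
      (ae_of_all _ fun s => (norm_exp_I_mul_real _ _).le)).congr (ae_of_all _ fun s => ?_)
    ring
  have e1 : ∀ x : ℝ, laplaceInt h (pt x y) * kernelK lam z (pt x y) =
      ∫ ξ in Ioi (0 : ℝ), kernelK lam z (pt x y) *
        (h ξ * expFn ξ y * Complex.exp (Complex.I * ξ * x)) := by
    intro x
    rw [integral_const_mul, mul_comm, laplaceInt]
    congr 1
    refine integral_congr_ae (ae_of_all _ fun ξ => ?_)
    simp only
    rw [coe_pt x hy, exp_I_mul_add]
    ring
  simp only [e1]
  rw [integral_integral_swap hprod, ← integral_const_mul]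
  refine setIntegral_congr_fun measurableSet_Ioi fun ξ hξ => ?_
  have e2 : ∀ x : ℝ, kernelK lam z (pt x y) *
      (h ξ * expFn ξ y * Complex.exp (Complex.I * ξ * x)) =
      h ξ * expFn ξ y * (kernelK lam z (pt x y) * Complex.exp (Complex.I * ξ * x)) :=
    fun x => by ring
  simp only [e2]
  rw [integral_const_mul, integral_exp_mul_kernelK hl z hy hξ]
  have e3 : expFn (2 * ξ) y = expFn ξ y * expFn ξ y := by
    rw [expFn_mul, expFn, expFn]
    congr 3
    ring
  rw [e3]
  ring

end Kernel

/-! ### The multiplier of a vertical symbol -/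

section Multiplier

variable {lam : ℝ} {a : ℝ → ℂ}

theorem IsVerticalSymbol.integrable_nu (hl : -1 < lam) (ha : IsVerticalSymbol lam a) {s : ℝ}
    (hs : 0 < s) : Integrable (fun y => a y * expFn s y) (nu lam) := by
  rw [integrable_nu_iff hl]
  have key : IntegrableOn (fun y : ℝ => a y * expFn s y * ((y ^ lam : ℝ) : ℂ)) (Ioi 0) := by
    rcases le_or_gt 0 lam with h0 | h0
    · obtain ⟨C, hC⟩ := rpow_mul_exp_le h0 (half_pos hs)
      have h1 : Integrable (fun y : ℝ => a y * expFn (s / 2) y *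
          ((y ^ lam * Real.exp (-(s / 2 * y)) : ℝ) : ℂ)) (volume.restrict (Ioi 0)) := by
        refine Integrable.mul_bdd (c := C) (ha.exp_integrable (s / 2) (half_pos hs))
          (Measurable.aestronglyMeasurable (by fun_prop))
          ((ae_restrict_iff' measurableSet_Ioi).2 (ae_of_all _ fun y hy => ?_))
        have hy0 : 0 < y := hy
        rw [Complex.norm_real, Real.norm_of_nonneg (by positivity)]
        exact hC y hy0
      refine IntegrableOn.congr_fun h1 (fun y _ => ?_) measurableSet_Ioi
      have e : expFn s y = expFn (s / 2) y * expFn (s / 2) y := by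
        rw [expFn_mul, expFn, expFn]
        congr 3
        ring
      simp only [e]
      simp only [expFn]
      push_cast
      ring
    · obtain ⟨δ, hδ, hi⟩ := ha.near_zero h0
      rw [← Ioc_union_Ioi_eq_Ioi hδ.le]
      refine IntegrableOn.union ?_ ?_
      · have h1 : Integrable (fun y : ℝ => a y * ((y ^ lam : ℝ) : ℂ) * expFn s y)
            (volume.restrict (Ioc 0 δ)) := by
          refine Integrable.mul_bdd (c := 1) hi
            (continuous_expFn_right s).aestronglyMeasurable
            ((ae_restrict_iff' measurableSet_Ioc).2 (ae_of_all _ fun y hy => ?_))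
          rw [norm_expFn, Real.exp_le_one_iff]
          have := mul_pos hs hy.1
          linarith
        refine IntegrableOn.congr_fun h1 (fun y _ => ?_) measurableSet_Ioc
        ring
      · refine Integrable.mul_bdd (c := δ ^ lam)
          ((ha.exp_integrable s hs).mono_set (Ioi_subset_Ioi hδ.le))
          (Measurable.aestronglyMeasurable (by fun_prop))
          ((ae_restrict_iff' measurableSet_Ioi).2 (ae_of_all _ fun y hy => ?_))
        have hy0 : δ < y := hy
        have hy1 : 0 < y := hδ.trans hy0
        rw [Complex.norm_real, Real.norm_of_nonneg (by positivity)]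
        exact Real.rpow_le_rpow_of_nonpos hδ hy0.le h0.le
  refine IntegrableOn.congr_fun (Integrable.const_mul key (((lam + 1) * 2 ^ lam : ℝ) : ℂ))
    (fun y hy => ?_) measurableSet_Ioi
  simp only [dens_eq (show 0 < y from hy), Complex.real_smul]
  push_cast
  ring

theorem ae_nu_pos (hl : -1 < lam) : ∀ᵐ y ∂(nu lam), 0 < y := by
  rw [ae_nu hl]
  exact ae_restrict_mem measurableSet_Ioi

theorem IsVerticalSymbol.aestronglyMeasurable (hl : -1 < lam) (ha : IsVerticalSymbol lam a) :
    AEStronglyMeasurable a (nu lam) := by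
  have h1 := (ha.integrable_nu hl one_pos).aestronglyMeasurable
  have h2 : Continuous fun y : ℝ => (expFn 1 y)⁻¹ :=
    (continuous_expFn_right 1).inv₀ fun y => expFn_ne_zero 1 y
  refine (h1.mul h2.aestronglyMeasurable).congr (ae_of_all _ fun y => ?_)
  simp only [Pi.mul_apply]
  rw [mul_assoc, mul_inv_cancel₀ (expFn_ne_zero 1 y), mul_one]

variable (lam a) in
/-- The function by which the Toeplitz operator with vertical symbol `a` multiplies the symbols:
`2 ξ^{1 + λ} / Γ(2 + λ) ∫ a(y) e^{-2 ξ y} dν_λ(y)`. -/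
def multiplier (ξ : ℝ) : ℂ :=
  ((2 * ξ ^ (1 + lam) / Real.Gamma (2 + lam) : ℝ) : ℂ) * ∫ y, a y * expFn (2 * ξ) y ∂(nu lam)

theorem continuousOn_multiplier (hl : -1 < lam) (ha : IsVerticalSymbol lam a) :
    ContinuousOn (multiplier lam a) (Ioi 0) := by
  intro ξ₀ hξ₀
  have h0 : 0 < ξ₀ := hξ₀
  refine ContinuousAt.continuousWithinAt ?_
  refine ContinuousAt.mul ?_ ?_
  · refine Complex.continuous_ofReal.continuousAt.comp (ContinuousAt.div_const ?_ _)
    exact continuousAt_const.mul (Real.continuousAt_rpow_const _ _ (Or.inl h0.ne'))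
  · refine continuousAt_of_dominated (bound := fun y => ‖a y * expFn ξ₀ y‖) ?_ ?_ ?_ ?_
    · exact Filter.Eventually.of_forall fun ξ =>
        (ha.aestronglyMeasurable hl).mul (continuous_expFn_right _).aestronglyMeasurable
    · filter_upwards [lt_mem_nhds (half_lt_self h0)] with ξ hξ
      filter_upwards [ae_nu_pos hl] with y hy
      rw [norm_mul, norm_mul, norm_expFn, norm_expFn]
      gcongr
      linarith
    · exact (ha.integrable_nu hl h0).norm
    · refine ae_of_all _ fun y => continuousAt_const.mul ?_
      exact (continuous_expFn.comp (by fun_prop : Continuous fun ξ : ℝ => (2 * ξ, y))).continuousAt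

theorem gammaFn_eq_multiplier (hl : -1 < lam) (a : ℝ → ℂ) {P x : ℝ} (hP : 0 < P) (hx : 0 < x) :
    gammaFn lam a P x = multiplier lam a (P * x / 2) := by
  set J := ∫ y in Ioi (0 : ℝ), a y * ((y ^ lam * Real.exp (-(P * x * y)) : ℝ) : ℂ) with hJ
  have h1 : ∫ t in Ioi (0 : ℝ), a (t / P) * ((Real.exp (-(t * x)) * t ^ lam : ℝ) : ℂ) =
      ((P * P ^ lam : ℝ) : ℂ) * J := by
    have h2 := integral_comp_mul_left_Ioi
      (fun t : ℝ => a (t / P) * ((Real.exp (-(t * x)) * t ^ lam : ℝ) : ℂ)) 0 hP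
    rw [mul_zero] at h2
    have h3 : ∫ y in Ioi (0 : ℝ), a (P * y / P) *
        ((Real.exp (-(P * y * x)) * (P * y) ^ lam : ℝ) : ℂ) = ((P ^ lam : ℝ) : ℂ) * J := by
      rw [hJ, ← integral_const_mul]
      refine setIntegral_congr_fun measurableSet_Ioi fun y hy => ?_
      have hy0 : 0 < y := hy
      have e : P * y * x = P * x * y := by ring
      simp only [mul_div_cancel_left₀ y hP.ne', Real.mul_rpow hP.le hy0.le, e]
      push_cast
      ring
    rw [h3] at h2
    rw [Complex.ofReal_mul, mul_assoc, h2, Complex.real_smul, ← mul_assoc, ← Complex.ofReal_mul,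
      mul_inv_cancel₀ hP.ne', Complex.ofReal_one, one_mul]
  have h4 : ∫ y, a y * expFn (2 * (P * x / 2)) y ∂(nu lam) =
      (((lam + 1) * 2 ^ lam : ℝ) : ℂ) * J := by
    rw [integral_nu hl, hJ, ← integral_const_mul]
    refine setIntegral_congr_fun measurableSet_Ioi fun y hy => ?_
    have e : 2 * (P * x / 2) = P * x := by ring
    simp only [dens_eq (show 0 < y from hy), Complex.real_smul, expFn, e]
    push_cast
    ring
  rw [gammaFn, multiplier, h1, h4, ← mul_assoc, ← mul_assoc, ← Complex.ofReal_mul,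
    ← Complex.ofReal_mul]
  congr 2
  have hG : Real.Gamma (2 + lam) = (lam + 1) * Real.Gamma (lam + 1) := by
    rw [← Real.Gamma_add_one (by linarith : lam + 1 ≠ 0)]
    congr 1
    ring
  have hl1 : lam + 1 ≠ 0 := by linarith
  have hG0 : Real.Gamma (lam + 1) ≠ 0 := (Real.Gamma_pos_of_pos (by linarith)).ne'
  have e1 : (P * x / 2) ^ (1 + lam) * (2 * 2 ^ lam) = P * P ^ lam * x ^ (lam + 1) := by
    have h2 : (2 : ℝ) * 2 ^ lam = 2 ^ (1 + lam) := by
      rw [Real.rpow_add two_pos, Real.rpow_one]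
    have h3 : P * P ^ lam = P ^ (1 + lam) := by
      rw [Real.rpow_add hP, Real.rpow_one]
    rw [h2, h3, add_comm lam 1, ← Real.mul_rpow (by positivity) (by positivity),
      ← Real.mul_rpow hP.le hx.le]
    congr 1
    ring
  rw [hG]
  field_simp
  linear_combination -e1

theorem image_gammaFn (hl : -1 < lam) (a : ℝ → ℂ) {P : ℝ} (hP : 0 < P) :
    gammaFn lam a P '' Ioi 0 = multiplier lam a '' Ioi 0 := by
  ext μ
  constructor
  · rintro ⟨x, hx, rfl⟩
    have hx0 : 0 < x := hx
    exact ⟨P * x / 2, show 0 < P * x / 2 by positivity, (gammaFn_eq_multiplier hl a hP hx).symm⟩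
  · rintro ⟨ξ, hξ, rfl⟩
    have hξ0 : 0 < ξ := hξ
    refine ⟨2 * ξ / P, show 0 < 2 * ξ / P by positivity, ?_⟩
    rw [gammaFn_eq_multiplier hl a hP (by positivity)]
    congr 1
    field_simp

/-- Interchange of the integrations in `y` and `ξ`. The integral `∫ |a(y)| e^{-2 ξ y} dν_λ(y)` need
not be integrable in `ξ` near zero, so `k` has to vanish there. -/
theorem IsVerticalSymbol.integral_swap (hl : -1 < lam) (ha : IsVerticalSymbol lam a) {k : ℝ → ℂ}
    (hk : IntegrableOn k (Ioi 0)) {ε : ℝ} (hε : 0 < ε) (hkε : ∀ ξ < ε, 0 < ξ → k ξ = 0) :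
    ∫ y, a y * (∫ ξ in Ioi (0 : ℝ), k ξ * expFn (2 * ξ) y) ∂(nu lam) =
      ∫ ξ in Ioi (0 : ℝ), k ξ * ∫ y, a y * expFn (2 * ξ) y ∂(nu lam) := by
  have hprod : Integrable (fun s : ℝ × ℝ => a s.1 * (k s.2 * expFn (2 * s.2) s.1))
      ((nu lam).prod (volume.restrict (Ioi 0))) := by
    have h1 : Integrable (fun s : ℝ × ℝ => a s.1 * expFn (2 * ε) s.1 * k s.2)
        ((nu lam).prod (volume.restrict (Ioi 0))) :=
      (ha.integrable_nu hl (by positivity)).mul_prod hk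
    refine Integrable.mono h1 ?_ ?_
    · have m1 : AEStronglyMeasurable (fun s : ℝ × ℝ => a s.1)
          ((nu lam).prod (volume.restrict (Ioi 0))) := (ha.aestronglyMeasurable hl).comp_fst
      have m2 : AEStronglyMeasurable (fun s : ℝ × ℝ => k s.2)
          ((nu lam).prod (volume.restrict (Ioi 0))) := hk.aestronglyMeasurable.comp_snd
      have m3 : Continuous fun s : ℝ × ℝ => expFn (2 * s.2) s.1 :=
        continuous_expFn.comp (by fun_prop : Continuous fun s : ℝ × ℝ => (2 * s.2, s.1))
      exact m1.mul (m2.mul m3.aestronglyMeasurable)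
    · filter_upwards [ae_prod_restrict_Ioi (nu lam),
        Measure.quasiMeasurePreserving_fst.ae (ae_nu_pos hl)] with s hξ hy
      rcases lt_or_ge s.2 ε with h2 | h2
      · simp [hkε s.2 h2 hξ]
      · simp only [norm_mul, norm_expFn]
        have : Real.exp (-(2 * s.2 * s.1)) ≤ Real.exp (-(2 * ε * s.1)) :=
          Real.exp_le_exp.2 (by nlinarith)
        calc ‖a s.1‖ * (‖k s.2‖ * Real.exp (-(2 * s.2 * s.1)))
            ≤ ‖a s.1‖ * (‖k s.2‖ * Real.exp (-(2 * ε * s.1))) := by gcongr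
          _ = _ := by ring
  simp only [← integral_const_mul]
  rw [integral_integral_swap hprod]
  refine integral_congr_ae (ae_of_all _ fun ξ => ?_)
  refine integral_congr_ae (ae_of_all _ fun y => ?_)
  simp only
  ring

end Multiplier

/-! ### The Toeplitz operator multiplies symbols -/

section Action

variable {lam : ℝ} {p q : ℝ≥0∞} {a : ℝ → ℂ}

theorem toReal_ofReal_pi_inv : (ENNReal.ofReal Real.pi⁻¹).toReal = Real.pi⁻¹ :=
  ENNReal.toReal_ofReal (by positivity)

theorem integral_mu (lam : ℝ) (F : ℝ × ℝ → ℂ) :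
    ∫ w, F w ∂(mu lam) =
      (Real.pi : ℂ)⁻¹ * ∫ w, F w ∂((volume : Measure ℝ).prod (nu lam)) := by
  rw [mu, integral_smul_measure, toReal_ofReal_pi_inv, Complex.real_smul, Complex.ofReal_inv]

theorem integrable_mu_iff {E : Type*} [NormedAddCommGroup E] (lam : ℝ) (F : ℝ × ℝ → E) :
    Integrable F (mu lam) ↔ Integrable F ((volume : Measure ℝ).prod (nu lam)) := by
  rw [mu, integrable_smul_measure (by simp [Real.pi_pos]) ENNReal.ofReal_ne_top]

theorem ae_prod_nu_pos (hl : -1 < lam) (m : Measure ℝ) [SFinite m] :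
    ∀ᵐ w ∂(m.prod (nu lam)), 0 < w.2 :=
  Measure.quasiMeasurePreserving_snd.ae (ae_nu_pos hl)

theorem bergmanIntegrand_symbolMul (a : ℝ → ℂ) (f : ℍ → ℂ) (z : ℍ) (x : ℝ) {y : ℝ} (hy : 0 < y) :
    bergmanIntegrand lam (symbolMul a f) z (x, y) =
      a y * (f (pt x y) * kernelK lam z (pt x y)) := by
  simp only [bergmanIntegrand, symbolMul, LinearMap.coe_mk, AddHom.coe_mk, im_pt x hy]
  ring

theorem aestronglyMeasurable_bergmanIntegrand (hl : -1 < lam) (ha : IsVerticalSymbol lam a)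
    {f : ℍ → ℂ} (hf : IsHol f) (z : ℍ) :
    AEStronglyMeasurable (bergmanIntegrand lam (symbolMul a f) z)
      ((volume : Measure ℝ).prod (nu lam)) := by
  have m1 : AEStronglyMeasurable (fun w : ℝ × ℝ => a w.2)
      ((volume : Measure ℝ).prod (nu lam)) := (ha.aestronglyMeasurable hl).comp_snd
  have m2 : AEStronglyMeasurable (fun w : ℝ × ℝ => f (pt w.1 w.2))
      ((volume : Measure ℝ).prod (nu lam)) :=
    (aestronglyMeasurable_pt hf).mono_ac
      (Measure.AbsolutelyContinuous.rfl.prod (withDensity_absolutelyContinuous _ _))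
  have m3 : AEStronglyMeasurable (fun w : ℝ × ℝ =>
      -(Complex.I ^ (lam : ℂ)) * (1 / ((z : ℂ) - w.1 + w.2 * Complex.I) ^ (2 + lam : ℂ)))
      ((volume : Measure ℝ).prod (nu lam)) := Measurable.aestronglyMeasurable (by fun_prop)
  refine (m1.mul (m2.mul m3)).congr ?_
  filter_upwards [ae_prod_nu_pos hl volume] with w hw
  obtain ⟨x, y⟩ := w
  rw [bergmanIntegrand_symbolMul a f z x hw, kernelK_pt lam z x hw]
  rfl

theorem laplaceInt_congr {h k : ℝ → ℂ} (he : ∀ ξ > 0, h ξ = k ξ) : laplaceInt h = laplaceInt k := by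
  ext z
  refine setIntegral_congr_fun measurableSet_Ioi fun ξ hξ => ?_
  simp only [he ξ hξ]

/-- The Bergman projection of `a f`, for `f` with symbol supported away from zero and infinity. The
Fourier–Laplace integral of such a symbol decays exponentially in `y`, so that everything converges
absolutely. -/
theorem IsLaplace.bergmanProj_synth (hl : -1 < lam) (ha : IsVerticalSymbol lam a) {h : ℝ → ℂ}
    (hh : IsLaplace h) {ε R : ℝ} (hε : 0 < ε) (hsupp : ∀ ξ > 0, ξ ∉ Icc ε R → h ξ = 0) (z : ℍ) :
    Integrable (bergmanIntegrand lam (symbolMul a (synth h)) z) (mu lam) ∧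
      bergmanProj lam (symbolMul a (synth h)) z = synth (fun ξ => multiplier lam a ξ * h ξ) z := by
  have hint : IntegrableOn h (Ioi 0) := by
    refine Integrable.mono ((hh.integrableOn 1 one_pos).const_mul (Real.exp R : ℂ))
      hh.aestronglyMeasurable ((ae_restrict_iff' measurableSet_Ioi).2 (ae_of_all _ fun ξ hξ => ?_))
    by_cases hm : ξ ∈ Icc ε R
    · rw [norm_mul, norm_mul, norm_expFn, Complex.norm_real,
        Real.norm_of_nonneg (Real.exp_pos _).le, mul_left_comm, ← Real.exp_add]
      refine le_mul_of_one_le_right (norm_nonneg _) (Real.one_le_exp ?_)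
      linarith [hm.2]
    · rw [hsupp ξ hξ hm, norm_zero]
      positivity
  set M := ∫ ξ in Ioi (0 : ℝ), ‖h ξ‖ with hM
  -- The gap `(0, ε)` in the support makes the function decay like `e^{-ε y}`, which is what the
  -- integrability hypothesis on `a` requires.
  have hbound : ∀ x y : ℝ, 0 < y → ‖laplaceInt h (pt x y)‖ ≤ Real.exp (-(ε * y)) * M := by
    intro x y hy
    refine (norm_laplaceInt_le h _).trans ?_
    rw [UpperHalfPlane.coe_im, im_pt x hy, hM, ← integral_const_mul]
    refine setIntegral_mono_on (hh.integrableOn y hy).norm (hint.norm.const_mul _)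
      measurableSet_Ioi fun ξ hξ => ?_
    by_cases hm : ξ ∈ Icc ε R
    · rw [norm_mul, norm_expFn, mul_comm]
      gcongr
      exact hm.1
    · simp [hsupp ξ hξ hm]
  set s := ((Real.sqrt (2 * Real.pi) : ℝ) : ℂ) with hs
  have hI : Integrable (bergmanIntegrand lam (symbolMul a (synth h)) z)
      ((volume : Measure ℝ).prod (nu lam)) := by
    have h1 : Integrable (fun w : ℝ × ℝ => (‖s⁻¹‖ * M * kernelBound lam z w.1) *
        ‖a w.2 * expFn ε w.2‖) ((volume : Measure ℝ).prod (nu lam)) :=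
      ((integrable_kernelBound hl z).const_mul _).mul_prod (ha.integrable_nu hl hε).norm
    refine Integrable.mono' h1
      (aestronglyMeasurable_bergmanIntegrand hl ha (isHol_synth hh) z) ?_
    filter_upwards [ae_prod_nu_pos hl volume] with w hw
    obtain ⟨x, y⟩ := w
    simp only at hw
    rw [bergmanIntegrand_symbolMul a _ z x hw, synth, norm_mul, norm_mul, norm_mul, norm_mul,
      norm_expFn]
    calc ‖a y‖ * (‖s⁻¹‖ * ‖laplaceInt h (pt x y)‖ * ‖kernelK lam z (pt x y)‖)
        ≤ ‖a y‖ * (‖s⁻¹‖ * (Real.exp (-(ε * y)) * M) * kernelBound lam z x) := by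
          gcongr
          · exact hbound x y hw
          · exact norm_kernelK_le hl z x hw
      _ = _ := by ring
  refine ⟨(integrable_mu_iff lam _).2 hI, ?_⟩
  rw [bergmanProj, integral_mu, integral_prod_symm _ hI]
  set k : ℝ → ℂ := fun ξ => h ξ * ((ξ ^ (1 + lam) : ℝ) : ℂ) * Complex.exp (Complex.I * ξ * z)
    with hk
  have hki : IntegrableOn k (Ioi 0) := by
    refine Integrable.mono (hint.const_mul ((R ^ (1 + lam) : ℝ) : ℂ))
      ((hh.aestronglyMeasurable.mul (Measurable.aestronglyMeasurable (by fun_prop))).mul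
        (Measurable.aestronglyMeasurable (by fun_prop)))
      ((ae_restrict_iff' measurableSet_Ioi).2 (ae_of_all _ fun ξ hξ => ?_))
    have hξ0 : 0 < ξ := hξ
    by_cases hm : ξ ∈ Icc ε R
    · have h1 : ‖Complex.exp (Complex.I * ξ * z)‖ ≤ 1 := by
        rw [norm_exp_I_mul, Real.exp_le_one_iff]
        have := mul_pos hξ0 z.im_pos
        rw [UpperHalfPlane.coe_im]
        linarith
      have h2 : ξ ^ (1 + lam) ≤ R ^ (1 + lam) :=
        Real.rpow_le_rpow hξ0.le hm.2 (by linarith)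
      have hR : 0 < R := hξ0.trans_le hm.2
      rw [norm_mul, norm_mul, norm_mul, Complex.norm_real, Complex.norm_real,
        Real.norm_of_nonneg (by positivity), Real.norm_of_nonneg (by positivity)]
      calc ‖h ξ‖ * ξ ^ (1 + lam) * ‖Complex.exp (Complex.I * ξ * z)‖
          ≤ ‖h ξ‖ * R ^ (1 + lam) * 1 := by gcongr
        _ = _ := by ring
    · simp [hk, hsupp ξ hξ hm]
  have e1 : ∫ y, (∫ x : ℝ, bergmanIntegrand lam (symbolMul a (synth h)) z (x, y)) ∂(nu lam) =
      ∫ y, s⁻¹ * ((Real.Gamma (2 + lam) : ℂ)⁻¹ * (2 * Real.pi)) *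
        (a y * ∫ ξ in Ioi (0 : ℝ), k ξ * expFn (2 * ξ) y) ∂(nu lam) := by
    refine integral_congr_ae ?_
    filter_upwards [ae_nu_pos hl] with y hy
    have e2 : ∀ x : ℝ, bergmanIntegrand lam (symbolMul a (synth h)) z (x, y) =
        a y * s⁻¹ * (laplaceInt h (pt x y) * kernelK lam z (pt x y)) := by
      intro x
      rw [bergmanIntegrand_symbolMul a _ z x hy, synth]
      ring
    simp only [e2]
    rw [integral_const_mul, hh.integral_mul_kernelK hl z hy]
    ring
  rw [e1, integral_const_mul, ha.integral_swap hl hki hε fun ξ h1 h2 => by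
    simp [hk, hsupp ξ h2 fun h3 => (not_le.2 h1) h3.1], synth, laplaceInt, ← integral_const_mul,
    ← integral_const_mul, ← integral_const_mul]
  refine setIntegral_congr_fun measurableSet_Ioi fun ξ hξ => ?_
  have hpi : (Real.pi : ℂ) ≠ 0 := Complex.ofReal_ne_zero.2 Real.pi_ne_zero
  simp only [hk, multiplier, ← hs]
  push_cast
  field_simp

theorem IsTest.mul_smooth {v w : ℝ → ℂ} (hv : IsTest v) (hw : ContDiffOn ℝ ∞ w (Ioi 0)) :
    IsTest fun t => w t * v t := by
  refine ⟨?_, hv.compact.mul_left, (closure_mono fun t ht => ?_).trans hv.supp⟩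
  · rw [contDiff_iff_contDiffAt]
    intro t
    by_cases ht : t ∈ tsupport v
    · exact (hw.contDiffAt (Ioi_mem_nhds (hv.supp ht))).mul hv.smooth.contDiffAt
    · have h0 : (fun t => w t * v t) =ᶠ[nhds t] fun _ => 0 := by
        filter_upwards [(isClosed_tsupport v).isOpen_compl.mem_nhds ht] with r hr
        rw [image_eq_zero_of_notMem_tsupport hr, mul_zero]
      exact contDiffAt_const.congr_of_eventuallyEq h0
  · exact fun h => ht (by simp only [h, mul_zero])

theorem contDiffOn_rpow_ofReal (s : ℝ) :
    ContDiffOn ℝ ∞ (fun t : ℝ => ((t ^ s : ℝ) : ℂ)) (Ioi 0) := by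
  refine Complex.ofRealCLM.contDiff.comp_contDiffOn fun t ht => ?_
  exact (Real.contDiffAt_rpow_const_of_ne (show 0 < t from ht).ne').contDiffWithinAt

theorem IsTest.exists_schwartz {v : ℝ → ℂ} (hv : IsTest v) : ∃ u : 𝓢(ℝ, ℂ), ∀ t, u t = v t :=
  ⟨hv.compact.toSchwartzMap hv.smooth, fun _ => rfl⟩

/-- The kernel, smeared out horizontally in its first variable by `û`, is a Fourier transform in
its second variable. -/
theorem integral_fourierR_mul_kernelK (hl : -1 < lam) (u : 𝓢(ℝ, ℂ)) (x' : ℝ) {y : ℝ}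
    (hy : 0 < y) :
    ∫ x : ℝ, fourierR u x * kernelK lam (pt x 1) (pt x' y) =
      (Real.Gamma (2 + lam) : ℂ)⁻¹ * (((Real.sqrt (2 * Real.pi) : ℝ) : ℂ) *
        ∫ t in Ioi (0 : ℝ), ((t ^ (1 + lam) : ℝ) : ℂ) * expFn t (1 + y) * u t *
          Complex.exp (-(Complex.I * x' * t))) := by
  have hL : IsLaplace fun t : ℝ => ((t ^ (1 + lam) : ℝ) : ℂ) := isLaplace_rpow (by linarith)
  have hL' : IsLaplace fun t : ℝ => ((t ^ (1 + lam) : ℝ) : ℂ) *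
      Complex.exp (-(Complex.I * x' * t)) := by
    refine ⟨fun r hr => ?_⟩
    refine Integrable.mono (hL.integrableOn r hr)
      ((hL.aestronglyMeasurable.mul (by fun_prop)).mul (continuous_expFn.comp
        (by fun_prop : Continuous fun ξ : ℝ => (ξ, r))).aestronglyMeasurable)
      (ae_of_all _ fun ξ => ?_)
    have e : ‖Complex.exp (-(Complex.I * x' * ξ))‖ = 1 := by
      rw [Complex.norm_exp]
      simp
    rw [norm_mul, norm_mul, norm_mul, e, mul_one]
  have h1 := hL'.integral_fourierR_mul u (y := 1 + y) (by positivity)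
  have e1 : ∀ x : ℝ, fourierR u x * kernelK lam (pt x 1) (pt x' y) =
      (Real.Gamma (2 + lam) : ℂ)⁻¹ * (fourierR u x * laplaceInt (fun t : ℝ =>
        ((t ^ (1 + lam) : ℝ) : ℂ) * Complex.exp (-(Complex.I * x' * t)))
          (x + ((1 + y : ℝ) : ℂ) * Complex.I)) := by
    intro x
    rw [kernelK_eq hl, sub_conj_pt _ x' hy, coe_pt x one_pos, mul_left_comm]
    congr 2
    refine integral_congr_ae (ae_of_all _ fun t => ?_)
    have e2 : Complex.exp (Complex.I * t * (x + (1 : ℝ) * Complex.I - x' + y * Complex.I)) =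
        Complex.exp (-(Complex.I * x' * t)) *
          Complex.exp (Complex.I * t * (x + ((1 + y : ℝ) : ℂ) * Complex.I)) := by
      rw [← Complex.exp_add]
      congr 1
      push_cast
      ring
    simp only
    rw [e2]
    ring
  simp only [e1]
  rw [integral_const_mul, h1]
  congr 2
  refine integral_congr_ae (ae_of_all _ fun t => ?_)
  simp only
  ring

theorem integrable_schwartz_mul_rpow (w : 𝓢(ℝ, ℂ)) (r : ℝ) :
    Integrable fun x : ℝ => ‖w x‖ * (1 + |x|) ^ r := by
  obtain ⟨n, hn⟩ := exists_nat_ge r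
  have h1 := (((w.integrable_pow_mul volume 0).add (w.integrable_pow_mul volume n)).const_mul
    (2 ^ (n - 1) : ℝ))
  refine Integrable.mono' h1 ?_ (ae_of_all _ fun x => ?_)
  · have : Continuous fun x : ℝ => (1 + |x|) ^ r :=
      (continuous_const.add continuous_abs).rpow_const fun x =>
        Or.inl (show 1 + |x| ≠ 0 by positivity)
    exact (w.continuous.norm.mul this).aestronglyMeasurable
  · have h2 : (1 + |x|) ^ r ≤ 2 ^ (n - 1) * (1 + |x| ^ n) := by
      have h3 := Real.rpow_le_rpow_of_exponent_le (x := 1 + |x|) (by linarith [abs_nonneg x]) hn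
      rw [Real.rpow_natCast] at h3
      have h4 := add_pow_le zero_le_one (abs_nonneg x) n
      rw [one_pow] at h4
      exact h3.trans h4
    rw [Real.norm_of_nonneg (by positivity)]
    simp only [Pi.add_apply, pow_zero, one_mul, Real.norm_eq_abs]
    calc ‖w x‖ * (1 + |x|) ^ r ≤ ‖w x‖ * (2 ^ (n - 1) * (1 + |x| ^ n)) := by gcongr
      _ = _ := by ring

/-- The weak form of the action of the Toeplitz operator on symbols. The kernels `K(x + i, w)` for
different `x` are comparable up to polynomial factors, so absolute convergence of the Bergman
integral at `i` permits integrating it in `x` against the Fourier transform of a test function; then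
only frequencies in a compact subset of the open half-line matter. -/
theorem integral_fourierR_mul_bergmanProj (hl : -1 < lam) (ha : IsVerticalSymbol lam a)
    {h : ℝ → ℂ} (hh : IsLaplace h)
    (hI : Integrable (bergmanIntegrand lam (symbolMul a (synth h)) (pt 0 1)) (mu lam))
    (u : 𝓢(ℝ, ℂ)) (hu : IsTest u) :
    ∫ x : ℝ, fourierR u x * bergmanProj lam (symbolMul a (synth h)) (pt x 1) =
      ∫ ξ in Ioi (0 : ℝ), multiplier lam a ξ * h ξ * expFn ξ 1 * u ξ := by
  obtain ⟨w, hw⟩ := exists_schwartz_fourierR u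
  set s := ((Real.sqrt (2 * Real.pi) : ℝ) : ℂ) with hs
  have hpi : (Real.pi : ℂ) ≠ 0 := Complex.ofReal_ne_zero.2 Real.pi_ne_zero
  have hs2 : s * s = 2 * Real.pi := by
    rw [hs, ← Complex.ofReal_mul, Real.mul_self_sqrt (by positivity)]
    push_cast
    rfl
  rw [integrable_mu_iff] at hI
  set B := fun (x : ℝ) (v : ℝ × ℝ) => bergmanIntegrand lam (symbolMul a (synth h)) (pt x 1) v
    with hB
  -- The absolutely convergent integral at `i` dominates those at all `x + i`, up to a polynomial
  -- factor that the Schwartz function `û` absorbs.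
  have hprod : Integrable (fun t : ℝ × (ℝ × ℝ) => fourierR u t.1 * B t.1 t.2)
      ((volume : Measure ℝ).prod ((volume : Measure ℝ).prod (nu lam))) := by
    have h1 : Integrable (fun t : ℝ × (ℝ × ℝ) => (‖w t.1‖ * (1 + |t.1|) ^ (2 + lam)) * ‖B 0 t.2‖)
        ((volume : Measure ℝ).prod ((volume : Measure ℝ).prod (nu lam))) :=
      (integrable_schwartz_mul_rpow w _).mul_prod hI.norm
    have hpos : ∀ᵐ t ∂((volume : Measure ℝ).prod ((volume : Measure ℝ).prod (nu lam))),
        0 < t.2.2 :=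
      Measure.quasiMeasurePreserving_snd.ae (ae_prod_nu_pos hl volume)
    refine Integrable.mono' h1 ?_ ?_
    · have m1 : AEStronglyMeasurable (fun v : ℝ × ℝ => a v.2)
          ((volume : Measure ℝ).prod (nu lam)) := (ha.aestronglyMeasurable hl).comp_snd
      have m2 : AEStronglyMeasurable (fun v : ℝ × ℝ => synth h (pt v.1 v.2))
          ((volume : Measure ℝ).prod (nu lam)) :=
        (aestronglyMeasurable_pt (isHol_synth hh)).mono_ac
          (Measure.AbsolutelyContinuous.rfl.prod (withDensity_absolutelyContinuous _ _))
      have m3 : AEStronglyMeasurable (fun t : ℝ × (ℝ × ℝ) => a t.2.2 * synth h (pt t.2.1 t.2.2))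
          ((volume : Measure ℝ).prod ((volume : Measure ℝ).prod (nu lam))) :=
        (m1.mul m2).comp_snd
      have m4 : AEStronglyMeasurable (fun t : ℝ × (ℝ × ℝ) => -(Complex.I ^ (lam : ℂ)) *
          (1 / (((t.1 : ℂ) + (1 : ℝ) * Complex.I) - t.2.1 + t.2.2 * Complex.I) ^ (2 + lam : ℂ)))
          ((volume : Measure ℝ).prod ((volume : Measure ℝ).prod (nu lam))) :=
        Measurable.aestronglyMeasurable (by fun_prop)
      have m5 : AEStronglyMeasurable (fun t : ℝ × (ℝ × ℝ) => fourierR u t.1)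
          ((volume : Measure ℝ).prod ((volume : Measure ℝ).prod (nu lam))) := by
        simp only [hw]
        exact (w.continuous.comp continuous_fst).aestronglyMeasurable
      refine (m5.mul (m3.mul m4)).congr ?_
      filter_upwards [hpos] with t ht
      obtain ⟨x, x', y⟩ := t
      simp only [Pi.mul_apply, hB]
      rw [bergmanIntegrand_symbolMul a _ _ x' ht, kernelK_pt lam _ x' ht, coe_pt x one_pos]
      ring
    · filter_upwards [hpos] with t ht
      obtain ⟨x, x', y⟩ := t
      simp only [hB, hw] at ht ⊢
      rw [bergmanIntegrand_symbolMul a _ _ x' ht, bergmanIntegrand_symbolMul a _ _ x' ht]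
      simp only [norm_mul]
      calc ‖w x‖ * (‖a y‖ * (‖synth h (pt x' y)‖ * ‖kernelK lam (pt x 1) (pt x' y)‖))
          ≤ ‖w x‖ * (‖a y‖ * (‖synth h (pt x' y)‖ *
              ((1 + |x|) ^ (2 + lam) * ‖kernelK lam (pt 0 1) (pt x' y)‖))) := by
            gcongr
            exact norm_kernelK_pt_le hl x _
        _ = _ := by ring
  have e0 : ∀ x : ℝ, fourierR u x * bergmanProj lam (symbolMul a (synth h)) (pt x 1) =
      (Real.pi : ℂ)⁻¹ * ∫ v, fourierR u x * B x v ∂((volume : Measure ℝ).prod (nu lam)) := by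
    intro x
    rw [bergmanProj, integral_mu, integral_const_mul]
    ring
  simp only [e0]
  have hswap : Integrable (fun v => ∫ x, fourierR u x * B x v)
      ((volume : Measure ℝ).prod (nu lam)) := hprod.integral_prod_right
  rw [integral_const_mul, integral_integral_swap hprod, integral_prod_symm _ hswap]
  have huy : ∀ y : ℝ, IsTest fun t => ((t ^ (1 + lam) : ℝ) : ℂ) * (expFn (1 + y) t * u t) :=
    fun y => (hu.mul_smooth (contDiff_expFn (1 + y)).contDiffOn).mul_smooth
      (contDiffOn_rpow_ofReal _)
  have hcomm : ∀ x y : ℝ, expFn x y = expFn y x := fun x y => by rw [expFn, expFn, mul_comm]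
  set k : ℝ → ℂ := fun ξ => h ξ * expFn ξ 1 * (((ξ ^ (1 + lam) : ℝ) : ℂ) * u ξ) with hk
  -- On each horizontal line, the smeared kernel is the Fourier transform of a test function, and
  -- the multiplication formula applies.
  have e1 : ∀ y > 0, ∫ x' : ℝ, ∫ x : ℝ, fourierR u x * B x (x', y) =
      (2 * Real.pi / Real.Gamma (2 + lam) : ℂ) *
        (a y * ∫ ξ in Ioi (0 : ℝ), k ξ * expFn (2 * ξ) y) := by
    intro y hy
    obtain ⟨U, hU⟩ := (huy y).exists_schwartz
    have e2 : ∀ x' : ℝ, ∫ x : ℝ, fourierR u x * B x (x', y) =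
        a y * (Real.Gamma (2 + lam) : ℂ)⁻¹ * s *
          (fourierR U x' * laplaceInt h (x' + y * Complex.I)) := by
      intro x'
      have e3 : ∀ x : ℝ, fourierR u x * B x (x', y) = a y * synth h (pt x' y) *
          (fourierR u x * kernelK lam (pt x 1) (pt x' y)) := by
        intro x
        simp only [hB]
        rw [bergmanIntegrand_symbolMul a _ _ x' hy]
        ring
      simp only [e3]
      have e4 : fourierR U x' = s⁻¹ * ∫ t in Ioi (0 : ℝ), ((t ^ (1 + lam) : ℝ) : ℂ) *
          expFn t (1 + y) * u t * Complex.exp (-(Complex.I * x' * t)) := by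
        have e5 : ∀ t : ℝ, ((t ^ (1 + lam) : ℝ) : ℂ) *
            expFn t (1 + y) * u t * Complex.exp (-(Complex.I * x' * t)) =
            (((t ^ (1 + lam) : ℝ) : ℂ) * expFn t (1 + y) *
              Complex.exp (-(Complex.I * x' * t))) * u t := fun t => by ring
        simp only [e5]
        rw [fourierR, hu.setIntegral_Ioi]
        congr 1
        refine integral_congr_ae (ae_of_all _ fun t => ?_)
        simp only [hU, hcomm t (1 + y)]
        ring
      rw [integral_const_mul, integral_fourierR_mul_kernelK hl u x' hy, e4, synth, coe_pt x' hy]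
      ring
    simp only [e2]
    rw [integral_const_mul, hh.integral_fourierR_mul U hy]
    have e6 : ∀ ξ : ℝ, h ξ * expFn ξ y * U ξ = k ξ * expFn (2 * ξ) y := by
      intro ξ
      have e7 : expFn ξ y * expFn (1 + y) ξ = expFn ξ 1 * expFn (2 * ξ) y := by
        simp only [expFn, ← Complex.ofReal_mul, ← Real.exp_add]
        congr 2
        ring
      rw [hU, hk]
      linear_combination (h ξ * ((ξ ^ (1 + lam) : ℝ) : ℂ) * u ξ) * e7
    simp only [e6]
    linear_combination (a y * (Real.Gamma (2 + lam) : ℂ)⁻¹ *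
      ∫ ξ in Ioi (0 : ℝ), k ξ * expFn (2 * ξ) y) * hs2
  have e8 : ∫ y, (∫ x' : ℝ, ∫ x : ℝ, fourierR u x * B x (x', y)) ∂(nu lam) =
      ∫ y, (2 * Real.pi / Real.Gamma (2 + lam) : ℂ) *
        (a y * ∫ ξ in Ioi (0 : ℝ), k ξ * expFn (2 * ξ) y) ∂(nu lam) := by
    refine integral_congr_ae ?_
    filter_upwards [ae_nu_pos hl] with y hy
    exact e1 y hy
  have hv := hu.mul_smooth (contDiffOn_rpow_ofReal (1 + lam))
  have hki : IntegrableOn k (Ioi 0) := by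
    obtain ⟨C, hC⟩ := hv.smooth.continuous.bounded_above_of_compact_support hv.compact
    exact Integrable.mul_bdd (c := C) (hh.integrableOn 1 one_pos)
      hv.smooth.continuous.aestronglyMeasurable (ae_of_all _ hC)
  obtain ⟨δ, hδ, huδ⟩ := hu.exists_pos
  rw [e8, integral_const_mul, ha.integral_swap hl hki hδ fun ξ h1 _ => by
    simp [hk, huδ ξ h1], ← integral_const_mul, ← integral_const_mul]
  refine setIntegral_congr_fun measurableSet_Ioi fun ξ hξ => ?_
  simp only [hk, multiplier]
  push_cast
  field_simp

theorem IsLaplace.locallyIntegrableOn {h : ℝ → ℂ} (hh : IsLaplace h) :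
    LocallyIntegrableOn (fun ξ => h ξ * expFn ξ 1) (Ioi 0) :=
  (hh.integrableOn 1 one_pos).locallyIntegrableOn

section Operator

variable [Fact (-1 < lam)] [Fact (1 ≤ p)] [Fact (1 ≤ q)]

/-- Elements with symbol supported away from zero and infinity are in the domain of the Toeplitz
operator: the Bergman projection is synthesized from the symbol times the multiplier, which is
bounded on the support. -/
theorem IsSymbol.mem_toeplitzDomain (hp : p ≠ ⊤) (ha : IsVerticalSymbol lam a)
    {f : BergmanSpace lam p q} {h : ℝ → ℂ} (hf : IsSymbol f h) {ε R : ℝ} (hε : 0 < ε)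
    (hsupp : ∀ ξ > 0, ξ ∉ Icc ε R → h ξ = 0) : f ∈ (toeplitz lam p q a).domain := by
  have hl : -1 < lam := Fact.out
  have hproj := (hf.isLaplace hp).bergmanProj_synth hl ha hε hsupp
  have hcont : ContinuousOn (multiplier lam a) (Icc ε R) :=
    (continuousOn_multiplier hl ha).mono fun ξ hξ => hε.trans_le hξ.1
  obtain ⟨C, hC⟩ := isCompact_Icc.exists_bound_of_continuousOn hcont
  have hm : AEStronglyMeasurable ((Icc ε R).indicator (multiplier lam a))
      (volume.restrict (Ioi 0)) :=
    ((continuousOn_multiplier hl ha).aestronglyMeasurable measurableSet_Ioi).indicator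
      measurableSet_Icc
  obtain ⟨g, hg⟩ := hf.exists_mul hp hm (C := max C 0) fun ξ _ => by
    by_cases hξ : ξ ∈ Icc ε R
    · rw [indicator_of_mem hξ]
      exact (hC ξ hξ).trans (le_max_left _ _)
    · rw [indicator_of_notMem hξ, norm_zero]
      exact le_max_right _ _
  refine ⟨fun z => ?_, ?_⟩
  · rw [hf.toFun_eq hp]
    exact (hproj z).1
  · have e : bergmanProj lam (symbolMul a (toFunₗ f)) = toFunₗ g := by
      ext z
      have e1 : laplaceInt (fun ξ => multiplier lam a ξ * h ξ) =
          laplaceInt fun ξ => (Icc ε R).indicator (multiplier lam a) ξ * h ξ := by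
        refine laplaceInt_congr fun ξ hξ => ?_
        by_cases hm : ξ ∈ Icc ε R
        · rw [indicator_of_mem hm]
        · rw [hsupp ξ hξ hm, mul_zero, mul_zero]
      rw [hf.toFun_eq hp, hg.toFun_eq hp, (hproj z).2, synth, synth, e1]
    rw [e]
    exact g.2

/-- The Toeplitz operator with vertical symbol multiplies the symbols of all the elements of its
domain by the multiplier. -/
theorem IsSymbol.toeplitz (hp : p ≠ ⊤) (ha : IsVerticalSymbol lam a)
    {f : (toeplitz lam p q a).domain} {h : ℝ → ℂ} (hf : IsSymbol (f : BergmanSpace lam p q) h) :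
    IsSymbol (toeplitz lam p q a f) fun ξ => multiplier lam a ξ * h ξ := by
  have hl : -1 < lam := Fact.out
  obtain ⟨k, hk⟩ := exists_isSymbol hp (ToeplitzHalfPlane.toeplitz lam p q a f)
  have hh := hf.isLaplace hp
  have hkL := hk.isLaplace hp
  refine hk.congr hp ?_
  have hmh : LocallyIntegrableOn (fun ξ => multiplier lam a ξ * (h ξ * expFn ξ 1)) (Ioi 0) := by
    have := hh.locallyIntegrableOn.continuousOn_mul (continuousOn_multiplier hl ha)
      isOpen_Ioi.isLocallyClosed
    exact this
  -- Both symbols, damped by `e^{-ξ}`, are compared through their pairings with test functions.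
  have h0 := ae_eq_zero_of_forall_isTest
    (g := fun ξ => k ξ * expFn ξ 1 - multiplier lam a ξ * (h ξ * expFn ξ 1))
    (hkL.locallyIntegrableOn.sub hmh) fun v hv => ?_
  · filter_upwards [h0] with ξ hξ
    refine mul_right_cancel₀ (expFn_ne_zero ξ 1) ?_
    linear_combination hξ
  obtain ⟨u, hu⟩ := hv.exists_schwartz
  have hu' : IsTest u := by
    rw [show (u : ℝ → ℂ) = v from funext hu]
    exact hv
  have hfun : bergmanProj lam (symbolMul a (synth h)) = synth k := by
    rw [← hf.toFun_eq hp, ← hk.toFun_eq hp]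
    rfl
  have hI := f.2.1 (pt 0 1)
  rw [hf.toFun_eq hp] at hI
  have h1 := integral_fourierR_mul_bergmanProj hl ha hh hI u hu'
  have h2 := hkL.integral_fourierR_mul u one_pos
  have e1 : ∀ x : ℝ, fourierR u x * synth k (pt x 1) =
      ((Real.sqrt (2 * Real.pi) : ℝ) : ℂ)⁻¹ *
        (fourierR u x * laplaceInt k (x + (1 : ℝ) * Complex.I)) := by
    intro x
    rw [synth, coe_pt x one_pos]
    ring
  simp only [hfun, e1] at h1
  rw [integral_const_mul, h2, inv_mul_cancel_left₀ sqrt_two_pi_ne_zero] at h1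
  have e2 : ∀ ξ, (k ξ * expFn ξ 1 - multiplier lam a ξ * (h ξ * expFn ξ 1)) * v ξ =
      k ξ * expFn ξ 1 * u ξ - multiplier lam a ξ * h ξ * expFn ξ 1 * u ξ := by
    intro ξ
    rw [hu]
    ring
  simp only [e2]
  rw [integral_sub, h1, sub_self]
  · simp only [hu]
    exact integrableOn_mul_test hkL.locallyIntegrableOn hv
  · refine (integrableOn_mul_test hmh hv).congr_fun (fun ξ _ => ?_) measurableSet_Ioi
    simp only [hu]
    ring

end Operator

end Action

/-! ### Density of the domain and boundedness -/

section Bounded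

variable {lam : ℝ} {p q : ℝ≥0∞} [Fact (-1 < lam)] [Fact (1 ≤ p)] [Fact (1 ≤ q)]

/-- Truncating the symbol near zero and infinity approximates in norm; this uses `q < ∞`. -/
theorem IsSymbol.tendsto_truncation (hp : p ≠ ⊤) (hq : q ≠ ⊤) {f : BergmanSpace lam p q}
    {h : ℝ → ℂ} (hf : IsSymbol f h) {F : ℕ → BergmanSpace lam p q}
    (hF : ∀ n : ℕ, IsSymbol (F n) fun ξ =>
      (Icc ((n : ℝ) + 1)⁻¹ (n + 1)).indicator (fun _ => (1 : ℂ)) ξ * h ξ) :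
    Filter.Tendsto F Filter.atTop (nhds f) := by
  have hl : -1 < lam := Fact.out
  have hq0 : q ≠ 0 := (zero_lt_one.trans_le Fact.out).ne'
  have hQ : 0 < q.toReal := toReal_pos_of_fact hq
  have key : Filter.Tendsto (fun n => partialFourier (F n)) Filter.atTop
      (nhds (partialFourier f)) := by
    rw [Lp.tendsto_Lp_iff_tendsto_eLpNorm']
    have e : ∀ n, eLpNorm (⇑(partialFourier (F n)) - ⇑(partialFourier f)) q volume =
        (∫⁻ ξ, ‖(partialFourier (F n)) ξ - partialFourier f ξ‖ₑ ^ q.toReal) ^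
          (1 / q.toReal) := fun n => by
      rw [eLpNorm_eq_lintegral_rpow_enorm_toReal hq0 hq]
      rfl
    simp only [e]
    have h0 : (0 : ℝ≥0∞) = 0 ^ (1 / q.toReal) := (ENNReal.zero_rpow_of_pos (by positivity)).symm
    rw [h0]
    refine (ENNReal.continuous_rpow_const.tendsto 0).comp ?_
    have h1 : (0 : ℝ≥0∞) = ∫⁻ _ : ℝ, 0 := by simp
    rw [h1]
    have hdiff : ∀ᵐ ξ : ℝ, ∀ n : ℕ, (partialFourier (F n)) ξ - partialFourier f ξ =
        ((Icc ((n : ℝ) + 1)⁻¹ (n + 1)).indicator (fun _ => (1 : ℂ)) ξ - 1) •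
          partialFourier f ξ := by
      rw [ae_all_iff]
      intro n
      filter_upwards [hf.ae_eq, (hF n).ae_eq] with ξ e1 e2
      rw [e1, e2, sub_smul, one_smul, smul_smul]
    -- Each `ξ > 0` lies in `[1 / (n + 1), n + 1]` for all large `n`.
    refine tendsto_lintegral_of_dominated_convergence'
      (fun ξ => ‖partialFourier f ξ‖ₑ ^ q.toReal) (fun n => ?_) (fun n => ?_) ?_ ?_
    · exact ((Lp.aestronglyMeasurable _).sub (Lp.aestronglyMeasurable _)).enorm.pow_const _
    · filter_upwards [hdiff] with ξ hξ
      rw [hξ n]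
      gcongr
      by_cases hm : ξ ∈ Icc ((n : ℝ) + 1)⁻¹ (n + 1)
      · simp [indicator_of_mem hm]
      · simp [indicator_of_notMem hm]
    · exact (lintegral_rpow_enorm_lt_top_of_eLpNorm_lt_top hq0 hq (Lp.memLp _).2).ne
    · filter_upwards [hdiff, hf.ae_eq] with ξ hξ e1
      refine tendsto_const_nhds.congr' ?_
      rcases le_or_gt ξ 0 with h2 | h2
      · have h3 : partialFourier f ξ = 0 := by rw [e1, expLp_of_nonpos hl hp h2, smul_zero]
        refine Filter.Eventually.of_forall fun n => ?_
        simp only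
        rw [hξ n, h3, smul_zero, enorm_zero, ENNReal.zero_rpow_of_pos hQ]
      · filter_upwards [Filter.eventually_ge_atTop ⌈ξ⌉₊, Filter.eventually_ge_atTop ⌈ξ⁻¹⌉₊]
          with n h3 h4
        have h5 : ξ ≤ n := (Nat.le_ceil _).trans (by exact_mod_cast h3)
        have h6 : ξ⁻¹ ≤ n := (Nat.le_ceil _).trans (by exact_mod_cast h4)
        have hm : ξ ∈ Icc ((n : ℝ) + 1)⁻¹ (n + 1) :=
          ⟨inv_le_of_inv_le₀ h2 (by linarith), by linarith⟩
        rw [hξ n, indicator_of_mem hm, sub_self, zero_smul, enorm_zero,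
          ENNReal.zero_rpow_of_pos hQ]
  rw [tendsto_iff_norm_sub_tendsto_zero] at key ⊢
  have h2 := key.const_mul ‖((Real.sqrt Real.pi : ℝ) : ℂ)⁻¹‖
  rw [mul_zero] at h2
  refine h2.congr fun n => ?_
  rw [norm_eq, map_sub, ← norm_smul, smul_sub]
  rfl

variable {a : ℝ → ℂ}

/-- The domain of the Toeplitz operator contains the elements whose symbols vanish near zero and
infinity, which are dense. -/
theorem dense_toeplitzDomain (hp : p ≠ ⊤) (hq : q ≠ ⊤) (ha : IsVerticalSymbol lam a) :
    Dense ((toeplitz lam p q a).domain : Set (BergmanSpace lam p q)) := by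
  intro f
  obtain ⟨h, hf⟩ := exists_isSymbol hp f
  choose F hF using fun n : ℕ => hf.exists_mul hp
    (m := (Icc ((n : ℝ) + 1)⁻¹ (n + 1)).indicator fun _ => (1 : ℂ))
    (aestronglyMeasurable_const.indicator measurableSet_Icc) (C := 1)
    (fun ξ _ => by
      refine (norm_indicator_le_norm_self _ _).trans ?_
      simp)
  refine mem_closure_of_tendsto (hf.tendsto_truncation hp hq hF) (Filter.Eventually.of_forall ?_)
  intro n
  refine (hF n).mem_toeplitzDomain hp ha (ε := ((n : ℝ) + 1)⁻¹) (R := n + 1) (by positivity) ?_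
  intro ξ _ hm
  rw [indicator_of_notMem hm, zero_mul]

/-- A bound for the Toeplitz operator bounds the multiplier: at a point where the multiplier is
larger, elements with symbol concentrated near the point contradict the bound. -/
theorem norm_multiplier_le (hp : p ≠ ⊤) (ha : IsVerticalSymbol lam a) {C : ℝ} (hC0 : 0 ≤ C)
    (hC : ∀ f : (toeplitz lam p q a).domain,
      ‖toeplitz lam p q a f‖ ≤ C * ‖(f : BergmanSpace lam p q)‖) {ξ : ℝ} (hξ : 0 < ξ) :
    ‖multiplier lam a ξ‖ ≤ C := by
  have hl : -1 < lam := Fact.out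
  by_contra hlt
  obtain ⟨D, hCD, hD⟩ := exists_between (not_le.1 hlt)
  have hD0 : 0 < D := hC0.trans_lt hCD
  have hcont : ContinuousAt (fun t => ‖multiplier lam a t‖) ξ :=
    ((continuousOn_multiplier hl ha).continuousAt (Ioi_mem_nhds hξ)).norm
  obtain ⟨r, s, hr, hrs, f, hf0, hf⟩ := exists_localized lam p q hp hξ
    (hcont.eventually_const_lt hD)
  have hmem : f ∈ (toeplitz lam p q a).domain :=
    hf.mem_toeplitzDomain hp ha hr fun t _ ht => indicator_of_notMem ht _
  have hT := IsSymbol.toeplitz hp ha (f := ⟨f, hmem⟩) hf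
  have h1 := hT.norm_le hp hf (C := D⁻¹) (ae_of_all _ fun t => by
    by_cases ht : t ∈ Icc r s
    · rw [norm_mul, ← mul_assoc]
      refine le_mul_of_one_le_left (norm_nonneg _) ?_
      rw [inv_mul_eq_div, one_le_div hD0]
      exact (hrs ht).le
    · rw [indicator_of_notMem ht, mul_zero, norm_zero, mul_zero])
  have h2 := hC ⟨f, hmem⟩
  rw [inv_mul_eq_div, le_div_iff₀ hD0] at h1
  have h3 : 0 < ‖f‖ := norm_pos_iff.2 hf0
  simp only at h2
  nlinarith

theorem isBoundedOp_toeplitz_iff (hp : p ≠ ⊤) (ha : IsVerticalSymbol lam a) :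
    IsBoundedOp (toeplitz lam p q a) ↔ ∃ C : ℝ, ∀ ξ > 0, ‖multiplier lam a ξ‖ ≤ C := by
  constructor
  · rintro ⟨C, hC⟩
    refine ⟨max C 0, fun ξ hξ =>
      norm_multiplier_le (q := q) hp ha (le_max_right C 0) (fun f => ?_) hξ⟩
    refine (hC f).trans ?_
    gcongr
    exact le_max_left C 0
  · rintro ⟨C, hC⟩
    refine ⟨C, fun f => ?_⟩
    obtain ⟨h, hf⟩ := exists_isSymbol hp (f : BergmanSpace lam p q)
    refine hf.norm_le hp (hf.toeplitz hp ha) ?_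
    refine (ae_restrict_iff' measurableSet_Ioi).2 (ae_of_all _ fun ξ hξ => ?_)
    rw [norm_mul]
    gcongr
    exact hC ξ hξ

end Bounded

end ToeplitzHalfPlane

end

theorem mainTheorem3 (lam : ℝ) (p q : ℝ≥0∞) [Fact (-1 < lam)] [Fact (1 ≤ p)] [Fact (1 ≤ q)]
    (hp : p ≠ ⊤) (hq : q ≠ ⊤) (a : ℝ → ℂ) (ha : IsVerticalSymbol lam a) :
    Dense ((toeplitz lam p q a).domain : Set (BergmanSpace lam p q)) ∧
    (IsBoundedOp (toeplitz lam p q a) ↔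
      Bornology.IsBounded (gammaFn lam a p.toReal '' Ioi 0)) ∧
    (IsBoundedOp (toeplitz lam p q a) →
      ∃ T : BergmanSpace lam p q →L[ℂ] BergmanSpace lam p q,
        (∀ f : (toeplitz lam p q a).domain,
          T (f : BergmanSpace lam p q) = toeplitz lam p q a f) ∧
        spectrum ℂ T = closure (gammaFn lam a p.toReal '' Ioi 0)) := by
  have hl : -1 < lam := Fact.out
  rw [image_gammaFn hl a (toReal_pos_of_fact hp), isBoundedOp_toeplitz_iff hp ha]
  refine ⟨dense_toeplitzDomain hp hq ha, ?_, ?_⟩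
  · rw [isBounded_iff_forall_norm_le]
    simp only [forall_mem_image, mem_Ioi, gt_iff_lt]
  · rintro ⟨C, hC⟩
    have hm := continuousOn_multiplier hl ha
    obtain ⟨T, hT⟩ := exists_mulOperator (lam := lam) (p := p) (q := q) hp
      (hm.aestronglyMeasurable measurableSet_Ioi) hC
    refine ⟨T, fun f => ?_, spectrum_mulOperator hp hm hT⟩
    obtain ⟨h, hf⟩ := exists_isSymbol hp (f : BergmanSpace lam p q)
    exact (hT _ _ hf).eq_of_ae_eq hp (hf.toeplitz hp ha) (ae_of_all _ fun _ => rfl)
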